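/- Let $d\ge 3$, $p_d=d/(d-1)$, and let $E\subset(0,\infty)$ be an arbitrary set. Let $\sigma$ be the rotationally invariant probability measure on the unit sphere $S^{d-1}\subset\mathbb R^d$, and put $$A_tf(x)=\int_{S^{d-1}}f(x-ty)\,d\sigma(y),\qquad \mathcal M_Ef(x)=\sup_{t\in E}|A_tf(x)|.$$ A function $f:\mathbb R^d\to\mathbb C$ is called radial if $f(x)=f_0(|x|)$ for all $x$, for some function $f_0$. We say that $\mathcal M_E$ maps radial $L^{p}$ boundedly into $L^{p}$ if there is a constant $C<\infty$ such that for every radial $f\in L^p(\mathbb R^d)$ the following hold: for almost every $x$ the integrals $A_tf(x)$, $t\in E$, all converge absolutely; $\mathcal M_Ef\in L^p(\mathbb R^d)$; and $\|\mathcal M_Ef\|_{L^p}\le C\|f\|_{L^p}$. For $k\in\mathbb Z$ let $E^k=E\cap[2^k,2^{k+1}]$, and for $a>0$ let $N(E^k,a)$ be the minimal number of closed intervals of length $a$ needed to cover $E^k$. For a compact interval $I\subset\mathbb R$ of length $|I|$ let $T(I)=\{(x,t):x\in I,\ 0\le t\le|I|\}$. A measure $\mu$ on the upper half-plane is a Carleson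 measure if there is $C<\infty$ with $\mu(T(I))\le C|I|$ for every compact interval $I$ of positive length. Then $\mathcal M_E$ maps radial $L^{p_d}$ boundedly into $L^{p_d}$ if and only if the discrete measure $$\sum_{k\in\mathbb Z}\sum_{n=1}^\infty N(E^k,2^{k-n})\,2^{-n}\,n^{1/(d-1)}\,\delta_{(k,n)}$$ is a Carleson measure. Moreover, this measure is a Carleson measure if and only if $$\sup_{|I|\ge1}\frac1{|I|}\sum_{\substack{(k,n)\in T(I)\\ k\in\mathbb Z,\ n\ge 1}}N(E^k,2^{k-n})\,2^{-n}\,n^{1/(d-1)}<\infty,$$ where the supremum is over compact intervals $I$ of length at least $1$. -/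

import Mathlib

open MeasureTheory Set
open scoped ENNReal NNReal

noncomputable section

namespace SphericalMaximal

/-- Euclidean space of dimension `d`. -/
abbrev Euc (d : ℕ) : Type := EuclideanSpace ℝ (Fin d)

/-- The rotationally invariant measure on the unit sphere, normalized to have total mass one. -/
def sphereMeasure (d : ℕ) : Measure (Metric.sphere (0 : Euc d) 1) :=
  ((volume : Measure (Euc d)).toSphere univ)⁻¹ • (volume : Measure (Euc d)).toSphere

/-- The spherical mean `A_t f(x) = ∫ f(x - t y) dσ(y)`. -/
def sphericalMean {d : ℕ} (f : Euc d → ℂ) (t : ℝ) (x : Euc d) : ℂ :=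
  ∫ y, f (x - t • (y : Euc d)) ∂(sphereMeasure d)

/-- The integral defining `A_t f(x)` converges absolutely. -/
def MeanExists {d : ℕ} (f : Euc d → ℂ) (t : ℝ) (x : Euc d) : Prop :=
  Integrable (fun y : Metric.sphere (0 : Euc d) 1 => f (x - t • (y : Euc d))) (sphereMeasure d)

/-- The maximal function `sup_{t ∈ E} |A_t f(x)|`, with values in `[0, ∞]`. -/
def maximalFunction {d : ℕ} (E : Set ℝ) (f : Euc d → ℂ) (x : Euc d) : ℝ≥0∞ :=
  ⨆ t ∈ E, ‖sphericalMean f t x‖ₑ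

/-- `f(x) = f₀(|x|)` for some function `f₀`. -/
def IsRadial {d : ℕ} (f : Euc d → ℂ) : Prop :=
  ∃ f₀ : ℝ → ℂ, ∀ x, f x = f₀ ‖x‖

/-- `M_E` maps radial `L^p` boundedly into `L^p`: with a constant `C` independent of `f`, for
each radial `f` in `L^p` the spherical means with radii in `E` are well defined at almost every
point, `M_E f` belongs to `L^p`, and `‖M_E f‖_p ≤ C ‖f‖_p`. -/
def BoundedOnRadial (d : ℕ) (E : Set ℝ) (p : ℝ≥0∞) : Prop :=
  ∃ C : ℝ≥0, ∀ f : Euc d → ℂ, IsRadial f → MemLp f p volume →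
    (∀ᵐ x ∂(volume : Measure (Euc d)), ∀ t ∈ E, MeanExists f t x) ∧
    MemLp (maximalFunction E f) p volume ∧
    eLpNorm (maximalFunction E f) p volume ≤ C * eLpNorm f p volume

/-- The entropy number `N(A, a)`: the minimal number of intervals of length `a` covering `A`. -/
def entropyNumber (A : Set ℝ) (a : ℝ) : ℕ∞ :=
  ⨅ (s : Finset ℝ) (_ : A ⊆ ⋃ c ∈ s, Icc c (c + a)), (s.card : ℕ∞)

/-- The dyadic piece `E^k = [2^k, 2^{k+1}] ∩ E`. -/
def dyadicPiece (E : Set ℝ) (k : ℤ) : Set ℝ :=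
  Icc ((2 : ℝ) ^ k) ((2 : ℝ) ^ (k + 1)) ∩ E

/-- The weight `N(E^k, 2^{k-n}) 2^{-n} n^{1/(d-1)}`. -/
def weight (d : ℕ) (E : Set ℝ) (k : ℤ) (n : ℕ+) : ℝ≥0∞ :=
  (entropyNumber (dyadicPiece E k) ((2 : ℝ) ^ (k - (n : ℤ))) : ℝ≥0∞) *
    ENNReal.ofReal ((2 : ℝ) ^ (-(n : ℤ)) * ((n : ℕ) : ℝ) ^ (1 / ((d : ℝ) - 1)))

/-- The discrete measure `∑_k ∑_{n > 0} N(E^k, 2^{k-n}) 2^{-n} n^{1/(d-1)} δ_{(k,n)}`. -/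
def entropyMeasure (d : ℕ) (E : Set ℝ) : Measure (ℝ × ℝ) :=
  Measure.sum fun q : ℤ × ℕ+ =>
    weight d E q.1 q.2 • Measure.dirac ((q.1 : ℝ), ((q.2 : ℕ) : ℝ))

/-- The tent `{(x, t) : x ∈ I, 0 ≤ t ≤ |I|}` over the interval `I = [a, b]`. -/
def tent (a b : ℝ) : Set (ℝ × ℝ) :=
  {z | z.1 ∈ Icc a b ∧ 0 ≤ z.2 ∧ z.2 ≤ b - a}

/-- Carleson measures: the mass of the tent over `I` is at most a constant times `|I|`. -/
def IsCarleson (μ : Measure (ℝ × ℝ)) : Prop :=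
  ∃ C : ℝ≥0, ∀ a b : ℝ, a < b → μ (tent a b) ≤ C * ENNReal.ofReal (b - a)

/-- `sup_{|I| ≥ 1} |I|⁻¹ ∑_{(k,n) ∈ T(I)} N(E^k, 2^{k-n}) 2^{-n} n^{1/(d-1)}`. -/
def carlesonSup (d : ℕ) (E : Set ℝ) : ℝ≥0∞ :=
  ⨆ (a : ℝ) (b : ℝ) (_ : 1 ≤ b - a),
    (∑' q : {q : ℤ × ℕ+ // ((q.1 : ℝ), ((q.2 : ℕ) : ℝ)) ∈ tent a b}, weight d E q.1.1 q.1.2) /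
      ENNReal.ofReal (b - a)

end SphericalMaximal

end

/-! On radial functions a spherical mean is one-dimensional: with `r = |x|` and profile `g` it is a
constant times the integral of `kernel d r t s * g s` over `|r - t| < s < r + t`
(`lintegral_sphere_radial`). For `t` comparable to `r` the kernel is at most a constant times
`s^(d-2) / r^(d-1)`, and it is at least that size where `2|r - t| ≤ s ≤ r`. At `p = d/(d-1)` one has
`(d-1)p = d` and `p - 1 = 1/(d-1)`. Hence the profile `s^{-(d-1)}` carries comparable `L^p` mass in
all dyadic shells, and the mean sees about `n` shells when `|r - t|` is about `2^{k-n}` and `r`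
about `2^k`.

Sufficiency. Radii `t ≤ r/2` are controlled by the Hardy–Littlewood maximal function and radii `t ≥
2r` by a Hardy-type inequality, for every `E`. For comparable radii the interval `[2^k, 2^{k+1})` is
cut into layers of points at distance about `2^{k-n}` from `E`. On such a layer every mean is at
most `r^{-(d-1)}` times a sum of dyadic masses `G_j` over `|j - k| ≤ n + 2` (`radialMean_le_sum`),
while the sum of `G_j ^ p` is controlled by the `p`-th power of the norm. What remains is a Carleson
embedding on the integers (`tsum_mul_rpow_sum_Icc_le`) whose weight is the layer measure times
`n^p`. Writing `n^p` as a sum of `m^{p-1}`, `m ≤ n`, and exchanging sums replaces layers by full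
neighbourhoods of `E`, whose measure the entropy numbers bound. This yields exactly the weight
`N(E^k, 2^{k-m}) 2^{-m} m^{1/(d-1)}` (`sum_layerWeight_le`). The condition also makes the closure of
`E` a null set, which settles measurability and the exceptional set.

Necessity. The test profile is `s^{-(d-1)}` cut off to about `2L` dyadic shells; its `p`-th power
has integral at most a constant times `L`. At a point `r` of order `2^k` within `2^{k-n}` of `E^k`
its maximal function is at least a constant times `(n-1) r^{-(d-1)}` (`le_radialMean_testProfile`).
The `p`-th power of this lower bound, for the largest admissible `n`, dominates the whole sum of
`n^{p-1}` over all admissible `n`; integrating that sum produces the entropy weights over a box of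
side `L` (`exists_sum_natWeight_le`).

The two forms of the Carleson condition agree because a tent over an interval shorter than one
contains no point with `n ≥ 1`. -/

noncomputable section

namespace SphericalMaximal

/-! ### A Carleson embedding theorem for averages over balls -/

section Embedding

variable {X : Type*} [PseudoMetricSpace X] [TopologicalSpace.SeparableSpace X] [MeasurableSpace X]
  [OpensMeasurableSpace X] {μ : Measure X} {Ω ι : Type*} [MeasurableSpace Ω] {ν : Measure Ω}

/-- The average of `g` over a set. -/
def lavg (μ : Measure X) (g : X → ℝ≥0∞) (B : Set X) : ℝ≥0∞ := (∫⁻ x in B, g x ∂μ) / μ B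

/-- Where `g ≤ a` it contributes at most `a * μ B` to an integral exceeding `2 * a * μ B`, so the
rest comes from `{a < g}`. Keeping only that part on the right is what makes the later integration
over levels converge for every `p > 1`. -/
lemma mul_measure_le_of_lt_lavg {X : Type*} [MeasurableSpace X] {μ : Measure X}
    {g : X → ℝ≥0∞} (hg : Measurable g) {B : Set X}
    (h0 : μ B ≠ 0) (h1 : μ B ≠ ∞) {a : ℝ≥0∞} (ha : a ≠ ∞)
    (h : 2 * a < lavg μ g B) : a * μ B ≤ ∫⁻ x in B, {x | a < g x}.indicator g x ∂μ := by
  have hm : MeasurableSet {x | a < g x} := measurableSet_lt measurable_const hg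
  have h2 : 2 * a * μ B ≤ ∫⁻ x in B, g x ∂μ :=
    ((ENNReal.lt_div_iff_mul_lt (Or.inl h0) (Or.inl h1)).1 h).le
  have h3 : ∫⁻ x in B, g x ∂μ ≤ a * μ B + ∫⁻ x in B, {x | a < g x}.indicator g x ∂μ := by
    calc ∫⁻ x in B, g x ∂μ ≤ ∫⁻ x in B, (a + {x | a < g x}.indicator g x) ∂μ := by
          refine lintegral_mono fun x => ?_
          by_cases hx : a < g x
          · simp [indicator, hx]
          · simpa only [indicator, mem_ofPred_eq, hx, if_false, add_zero] using not_lt.1 hx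
      _ = _ := by
          rw [lintegral_add_left measurable_const]
          simp
  have h4 : a * μ B ≠ ∞ := ENNReal.mul_ne_top ha h1
  have h5 : a * μ B + a * μ B ≤ a * μ B + ∫⁻ x in B, {x | a < g x}.indicator g x ∂μ := by
    calc _ = 2 * a * μ B := by ring
      _ ≤ _ := h2.trans h3
  exact (ENNReal.add_le_add_iff_left h4).1 h5

/-- A weak type bound for averages over a family of balls satisfying a Carleson condition. -/
lemma weak_type_lavg {c : ι → X} {ρ : ι → ℝ} (π : ι → Ω)
    (hρ : ∀ i, 0 < ρ i) (h0 : ∀ i, μ (Metric.closedBall (c i) (ρ i)) ≠ 0)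
    (h1 : ∀ i, μ (Metric.closedBall (c i) (ρ i)) ≠ ∞) {C : ℝ≥0∞}
    (hC : ∀ j, ν (π '' {i | Metric.closedBall (c i) (ρ i) ⊆ Metric.closedBall (c j) (5 * ρ j)}) ≤
      C * μ (Metric.closedBall (c j) (ρ j)))
    {g : X → ℝ≥0∞} (hg : Measurable g) {a : ℝ≥0∞} (ha : a ≠ ∞) :
    a * ν (π '' {i | 2 * a < lavg μ g (Metric.closedBall (c i) (ρ i))}) ≤
      C * ∫⁻ x, {x | a < g x}.indicator g x ∂μ := by
  -- Vitali's covering lemma requires bounded radii; the bound `R` is removed at the end by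
  -- continuity from below, the sets being increasing in `R`.
  have key : ∀ R : ℕ, a * ν (π '' {i | 2 * a < lavg μ g (Metric.closedBall (c i) (ρ i)) ∧
      ρ i ≤ R}) ≤ C * ∫⁻ x, {x | a < g x}.indicator g x ∂μ := by
    intro R
    obtain ⟨u, hut, hdisj, hcov⟩ := Vitali.exists_disjoint_subfamily_covering_enlargement_closedBall
      {i | 2 * a < lavg μ g (Metric.closedBall (c i) (ρ i)) ∧ ρ i ≤ R} c ρ R (fun i hi => hi.2)
      5 (by norm_num)
    have hcount : u.Countable := hdisj.countable_of_nonempty_interior fun i _ =>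
      ⟨c i, Metric.ball_subset_interior_closedBall (Metric.mem_ball_self (hρ i))⟩
    have hsub : π '' {i | 2 * a < lavg μ g (Metric.closedBall (c i) (ρ i)) ∧ ρ i ≤ R} ⊆
        ⋃ j ∈ u, π '' {i | Metric.closedBall (c i) (ρ i) ⊆
          Metric.closedBall (c j) (5 * ρ j)} := by
      rintro _ ⟨i, hi, rfl⟩
      obtain ⟨j, hj, hij⟩ := hcov i hi
      exact mem_biUnion hj ⟨i, hij, rfl⟩
    calc _ ≤ a * ∑' j : u, C * μ (Metric.closedBall (c j) (ρ j)) := by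
          gcongr
          refine (measure_mono hsub).trans ((measure_biUnion_le ν hcount _).trans ?_)
          exact ENNReal.tsum_le_tsum fun j => hC j
      _ = C * ∑' j : u, a * μ (Metric.closedBall (c j) (ρ j)) := by
          rw [ENNReal.tsum_mul_left, ENNReal.tsum_mul_left]; ring
      _ ≤ C * ∑' j : u, ∫⁻ x in Metric.closedBall (c j) (ρ j),
            {x | a < g x}.indicator g x ∂μ := by
          gcongr with j
          exact mul_measure_le_of_lt_lavg hg (h0 _) (h1 _) ha (hut j.2).1
      _ = C * ∫⁻ x in ⋃ j ∈ u, Metric.closedBall (c j) (ρ j),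
            {x | a < g x}.indicator g x ∂μ := by
          rw [lintegral_biUnion hcount (fun j _ => Metric.isClosed_closedBall.measurableSet) hdisj]
      _ ≤ _ := by
          gcongr
          exact Measure.restrict_le_self
  have hU : π '' {i | 2 * a < lavg μ g (Metric.closedBall (c i) (ρ i))} =
      ⋃ R : ℕ, π '' {i | 2 * a < lavg μ g (Metric.closedBall (c i) (ρ i)) ∧ ρ i ≤ R} := by
    rw [← image_iUnion]
    congr 1
    ext i
    simp only [mem_ofPred_eq, mem_iUnion, exists_and_left, iff_self_and]
    exact fun _ => exists_nat_ge _
  rw [hU, Monotone.measure_iUnion, ENNReal.mul_iSup]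
  · exact iSup_le key
  · intro R R' hR
    exact image_mono fun i hi => ⟨hi.1, hi.2.trans (by exact_mod_cast hR)⟩

lemma setLIntegral_rpow_Ioo {q : ℝ} (hq : -1 < q) {a : ℝ} (ha : 0 ≤ a) :
    ∫⁻ t in Ioo 0 a, ENNReal.ofReal (t ^ q) = ENNReal.ofReal (a ^ (q + 1) / (q + 1)) := by
  have h := integral_rpow (a := 0) (b := a) (r := q) (Or.inl hq)
  rw [Real.zero_rpow (by linarith), sub_zero, intervalIntegral.integral_of_le ha] at h
  rw [← h, ofReal_integral_eq_lintegral_ofReal]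
  · rw [Measure.restrict_congr_set Ioo_ae_eq_Ioc]
  · exact (intervalIntegral.intervalIntegrable_rpow' hq).1
  · filter_upwards [ae_restrict_mem measurableSet_Ioc] with y hy
    exact Real.rpow_nonneg hy.1.le _

lemma lintegral_Ioi_indicator_rpow {q : ℝ} (hq : -1 < q) {x : ℝ≥0∞} (hx : x ≠ ∞) :
    ∫⁻ t in Ioi (0 : ℝ), {t : ℝ | ENNReal.ofReal t < x}.indicator
      (fun t => ENNReal.ofReal (t ^ q)) t = ENNReal.ofReal (1 / (q + 1)) * x ^ (q + 1) := by
  have hs : {t : ℝ | ENNReal.ofReal t < x} ∩ Ioi 0 = Ioo 0 x.toReal := by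
    ext t
    simp only [mem_inter_iff, mem_ofPred_eq, mem_Ioi, mem_Ioo]
    constructor
    · rintro ⟨h1, h2⟩
      exact ⟨h2, (ENNReal.ofReal_lt_iff_lt_toReal h2.le hx).1 h1⟩
    · rintro ⟨h1, h2⟩
      exact ⟨(ENNReal.ofReal_lt_iff_lt_toReal h1.le hx).2 h2, h1⟩
  have hm : MeasurableSet {t : ℝ | ENNReal.ofReal t < x} :=
    measurableSet_lt ENNReal.measurable_ofReal measurable_const
  rw [lintegral_indicator hm, Measure.restrict_restrict hm, hs,
    setLIntegral_rpow_Ioo hq ENNReal.toReal_nonneg, div_eq_inv_mul, ← one_div,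
    ENNReal.ofReal_mul (by positivity [show 0 < q + 1 by linarith]),
    ← ENNReal.ofReal_rpow_of_nonneg ENNReal.toReal_nonneg (by linarith), ENNReal.ofReal_toReal hx]

/-- This direction of the layer-cake formula also covers `x = ∞`, which is reached through finite
values `y ≤ x`. -/
lemma rpow_le_lintegral_indicator {p : ℝ} (hp : 0 < p) (x : ℝ≥0∞) :
    x ^ p ≤ ENNReal.ofReal p * ∫⁻ t in Ioi (0 : ℝ), {t : ℝ | ENNReal.ofReal t < x}.indicator
      (fun t => ENNReal.ofReal (t ^ (p - 1))) t := by
  have fin : ∀ y : ℝ≥0∞, y ≠ ∞ → y ≤ x → y ^ p ≤ ENNReal.ofReal p * ∫⁻ t in Ioi (0 : ℝ),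
      {t : ℝ | ENNReal.ofReal t < x}.indicator (fun t => ENNReal.ofReal (t ^ (p - 1))) t := by
    intro y hy hyx
    have h := lintegral_Ioi_indicator_rpow (q := p - 1) (by linarith) hy
    rw [sub_add_cancel] at h
    calc y ^ p = ENNReal.ofReal p * (ENNReal.ofReal (1 / p) * y ^ p) := by
          rw [← mul_assoc, ← ENNReal.ofReal_mul hp.le, mul_one_div_cancel hp.ne']; simp
      _ = ENNReal.ofReal p * ∫⁻ t in Ioi (0 : ℝ), {t : ℝ | ENNReal.ofReal t < y}.indicator
          (fun t => ENNReal.ofReal (t ^ (p - 1))) t := by rw [h]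
      _ ≤ _ := by
          gcongr ENNReal.ofReal p * ∫⁻ t in Ioi (0 : ℝ), ?_
          exact indicator_le_indicator_of_subset (fun t ht => lt_of_lt_of_le ht hyx)
            (fun _ => zero_le) _
  by_cases hx : x = ∞
  · subst hx
    rw [ENNReal.top_rpow_of_pos hp]
    refine ENNReal.le_of_forall_nnreal_lt fun r _ => ?_
    have h := fin ((r : ℝ≥0∞) ^ (1 / p)) (by simp [hp.le]) le_top
    rwa [← ENNReal.rpow_mul, one_div_mul_cancel hp.ne', ENNReal.rpow_one] at h
  · exact fin x hx le_rfl

/-- A Carleson embedding theorem: averages over a family of balls are bounded from `L^p(μ)` to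
`L^p(ν)`, for `p > 1`, as soon as `ν` satisfies a Carleson condition with respect to the
family. -/
theorem lintegral_iSup_lavg_rpow_le [SFinite μ] [SFinite ν] {c : ι → X} {ρ : ι → ℝ} (π : ι → Ω)
    (hρ : ∀ i, 0 < ρ i) (h0 : ∀ i, μ (Metric.closedBall (c i) (ρ i)) ≠ 0)
    (h1 : ∀ i, μ (Metric.closedBall (c i) (ρ i)) ≠ ∞) {C : ℝ≥0∞}
    (hC : ∀ j, ν (π '' {i | Metric.closedBall (c i) (ρ i) ⊆ Metric.closedBall (c j) (5 * ρ j)}) ≤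
      C * μ (Metric.closedBall (c j) (ρ j)))
    {g : X → ℝ≥0∞} (hg : Measurable g) (hfin : ∀ x, g x ≠ ∞) {p : ℝ} (hp : 1 < p) :
    ∫⁻ w, (⨆ (i : ι) (_ : π i = w), lavg μ g (Metric.closedBall (c i) (ρ i))) ^ p ∂ν ≤
      C * ENNReal.ofReal (2 ^ p * (p / (p - 1))) * ∫⁻ x, g x ^ p ∂μ := by
  set M : Ω → ℝ≥0∞ := fun w => ⨆ (i : ι) (_ : π i = w), lavg μ g (Metric.closedBall (c i) (ρ i))
    with hM
  -- A supremum over an arbitrary index set need not be measurable. The lower integral is attained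
  -- by a measurable minorant, to which Tonelli applies. The division by 2 matches the level `2 * a`
  -- in the weak type bound.
  obtain ⟨h, hhm, hhM, hhint⟩ := exists_measurable_le_lintegral_eq ν (fun w => (M w / 2) ^ p)
  have hp0 : 0 < p := by linarith
  set φ : Ω → ℝ≥0∞ := fun w => h w ^ (1 / p)
  have hφm : Measurable φ := hhm.pow_const _
  have hφM : ∀ w, φ w ≤ M w / 2 := fun w => by
    rw [← ENNReal.rpow_le_rpow_iff hp0]
    simp only [φ, ← ENNReal.rpow_mul, one_div_mul_cancel hp0.ne', ENNReal.rpow_one]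
    exact hhM w
  have hφh : ∀ w, φ w ^ p = h w := fun w => by
    simp only [φ, ← ENNReal.rpow_mul, one_div_mul_cancel hp0.ne', ENNReal.rpow_one]
  have hlev : ∀ t : ℝ, ENNReal.ofReal t * ν {w | ENNReal.ofReal t < φ w} ≤
      C * ∫⁻ x, {x | ENNReal.ofReal t < g x}.indicator g x ∂μ := by
    intro t
    refine le_trans ?_ (weak_type_lavg π hρ h0 h1 hC hg ENNReal.ofReal_ne_top)
    gcongr
    intro w hw
    have h2 : 2 * ENNReal.ofReal t < M w := by
      have := lt_of_lt_of_le hw (hφM w)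
      rw [ENNReal.lt_div_iff_mul_lt (by simp) (by simp)] at this
      rwa [mul_comm]
    simp only [hM, lt_iSup_iff] at h2
    obtain ⟨i, hi, hi2⟩ := h2
    exact ⟨i, hi2, hi⟩
  have hmeas1 : Measurable (Function.uncurry fun (w : Ω) (t : ℝ) =>
      {t : ℝ | ENNReal.ofReal t < φ w}.indicator (fun t => ENNReal.ofReal (t ^ (p - 1))) t) := by
    have : (Function.uncurry fun (w : Ω) (t : ℝ) =>
        {t : ℝ | ENNReal.ofReal t < φ w}.indicator (fun t => ENNReal.ofReal (t ^ (p - 1))) t) =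
        {z : Ω × ℝ | ENNReal.ofReal z.2 < φ z.1}.indicator
          (fun z => ENNReal.ofReal (z.2 ^ (p - 1))) := by
      ext ⟨w, t⟩; rfl
    rw [this]
    refine Measurable.indicator (by fun_prop) ?_
    exact measurableSet_lt (by fun_prop) (by fun_prop)
  have hmeas2 : Measurable (Function.uncurry fun (t : ℝ) (x : X) => ENNReal.ofReal (t ^ (p - 2)) *
      {x : X | ENNReal.ofReal t < g x}.indicator g x) := by
    have : (Function.uncurry fun (t : ℝ) (x : X) => ENNReal.ofReal (t ^ (p - 2)) *
        {x : X | ENNReal.ofReal t < g x}.indicator g x) =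
        fun z => ENNReal.ofReal (z.1 ^ (p - 2)) * {z : ℝ × X | ENNReal.ofReal z.1 < g z.2}.indicator
          (fun z => g z.2) z := by
      ext ⟨w, t⟩; rfl
    rw [this]
    refine Measurable.mul (by fun_prop) (Measurable.indicator (by fun_prop) ?_)
    exact measurableSet_lt (by fun_prop) (by fun_prop)
  -- Marcinkiewicz's argument: one factor `t` of `t^(p-1)` is spent on the weak type bound, and the
  -- remaining `t^(p-2)` is integrable at 0 because `p > 1`.
  have hmain : ∫⁻ w, φ w ^ p ∂ν ≤ C * ENNReal.ofReal (p / (p - 1)) * ∫⁻ x, g x ^ p ∂μ := by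
    calc ∫⁻ w, φ w ^ p ∂ν ≤ ∫⁻ w, (ENNReal.ofReal p * ∫⁻ t in Ioi (0 : ℝ),
          {t : ℝ | ENNReal.ofReal t < φ w}.indicator
          (fun t => ENNReal.ofReal (t ^ (p - 1))) t) ∂ν :=
          lintegral_mono fun w => rpow_le_lintegral_indicator hp0 _
      _ = ENNReal.ofReal p * ∫⁻ t in Ioi (0 : ℝ), ∫⁻ w, {t : ℝ | ENNReal.ofReal t < φ w}.indicator
          (fun t => ENNReal.ofReal (t ^ (p - 1))) t ∂ν := by
          rw [lintegral_const_mul _ hmeas1.lintegral_prod_right,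
            lintegral_lintegral_swap hmeas1.aemeasurable]
      _ ≤ ENNReal.ofReal p * ∫⁻ t in Ioi (0 : ℝ), C * ∫⁻ x, ENNReal.ofReal (t ^ (p - 2)) *
          {x : X | ENNReal.ofReal t < g x}.indicator g x ∂μ := by
          gcongr ENNReal.ofReal p * ?_
          refine setLIntegral_mono_ae' measurableSet_Ioi (Filter.Eventually.of_forall ?_)
          intro t (ht : 0 < t)
          have e1 : ∫⁻ w, {t : ℝ | ENNReal.ofReal t < φ w}.indicator
              (fun t => ENNReal.ofReal (t ^ (p - 1))) t ∂ν =
              ENNReal.ofReal (t ^ (p - 1)) * ν {w | ENNReal.ofReal t < φ w} := by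
            rw [← lintegral_indicator_const (measurableSet_lt measurable_const hφm)]
            rfl
          have e2 : t ^ (p - 1) = t ^ (p - 2) * t := by
            rw [← Real.rpow_add_one ht.ne']; congr 1; ring
          rw [e1, lintegral_const_mul' _ _ ENNReal.ofReal_ne_top, e2,
            ENNReal.ofReal_mul (by positivity), mul_assoc, mul_left_comm C]
          exact mul_le_mul_right (hlev t) _
      _ = ENNReal.ofReal p * C * ∫⁻ x, g x * (∫⁻ t in Ioi (0 : ℝ),
            {t : ℝ | ENNReal.ofReal t < g x}.indicator
              (fun t => ENNReal.ofReal (t ^ (p - 2))) t) ∂μ := by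
          rw [lintegral_const_mul _ hmeas2.lintegral_prod_right,
            lintegral_lintegral_swap hmeas2.aemeasurable, mul_assoc]
          congr 3
          ext x
          rw [← lintegral_const_mul' _ _ (hfin x)]
          congr 1
          ext t
          simp only [indicator, mem_ofPred_eq]
          split_ifs <;> ring
      _ = ENNReal.ofReal p * C * ∫⁻ x, ENNReal.ofReal (1 / (p - 1)) * g x ^ p ∂μ := by
          congr 2
          ext x
          rw [lintegral_Ioi_indicator_rpow (by linarith) (hfin x), mul_left_comm,
            show p - 2 + 1 = p - 1 by ring]
          congr 1
          have := ENNReal.rpow_add_of_nonneg (x := g x) 1 (p - 1) (by norm_num) (by linarith)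
          rw [ENNReal.rpow_one] at this
          rw [← this]; congr 1; ring
      _ = _ := by
          rw [lintegral_const_mul' _ _ ENNReal.ofReal_ne_top, div_eq_mul_one_div p,
            ENNReal.ofReal_mul hp0.le]
          ring
  calc ∫⁻ w, M w ^ p ∂ν = ENNReal.ofReal (2 ^ p) * ∫⁻ w, (M w / 2) ^ p ∂ν := by
        rw [← lintegral_const_mul' _ _ ENNReal.ofReal_ne_top]
        congr 1
        ext w
        rw [← ENNReal.ofReal_rpow_of_pos (by norm_num), ← ENNReal.mul_rpow_of_nonneg _ _ hp0.le]
        congr 1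
        rw [show ENNReal.ofReal 2 = 2 by simp, ENNReal.mul_div_cancel (by simp) (by simp)]
    _ ≤ ENNReal.ofReal (2 ^ p) * (C * ENNReal.ofReal (p / (p - 1)) * ∫⁻ x, g x ^ p ∂μ) := by
        gcongr
        rw [hhint]
        simpa only [hφh] using hmain
    _ = _ := by
        rw [ENNReal.ofReal_mul (by positivity)]; ring

end Embedding

/-! ### Polar coordinates and integration over the sphere -/

lemma finrank_euc (d : ℕ) : Module.finrank ℝ (Euc d) = d := by simp

lemma volumeIoiPow_lintegral (n : ℕ) {F : ℝ → ℝ≥0∞} (hF : Measurable F) :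
    ∫⁻ r, F (r : ℝ) ∂(Measure.volumeIoiPow n) =
      ∫⁻ r in Ioi (0 : ℝ), ENNReal.ofReal (r ^ n) * F r := by
  have hF' : Measurable fun r : Ioi (0 : ℝ) => F r := hF.comp measurable_subtype_coe
  rw [Measure.volumeIoiPow, lintegral_withDensity_eq_lintegral_mul _ (by fun_prop) hF']
  exact lintegral_subtype_comap measurableSet_Ioi (fun r => ENNReal.ofReal (r ^ n) * F r)

/-- Integration in polar coordinates. -/
lemma lintegral_polar {d : ℕ} [NeZero d] {F : Euc d → ℝ≥0∞} (hF : Measurable F) :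
    ∫⁻ x, F x = ∫⁻ y, (∫⁻ r in Ioi (0 : ℝ), ENNReal.ofReal (r ^ (d - 1)) *
      F (r • (y : Euc d))) ∂(volume : Measure (Euc d)).toSphere := by
  have hmp := (volume : Measure (Euc d)).measurePreserving_homeomorphUnitSphereProd
  have hmeas : Measurable fun z : Metric.sphere (0 : Euc d) 1 × Ioi (0 : ℝ) =>
      F ((z.2 : ℝ) • (z.1 : Euc d)) := hF.comp (by fun_prop)
  calc ∫⁻ x, F x = ∫⁻ x in ({0}ᶜ : Set (Euc d)), F x := by rw [restrict_compl_singleton]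
    _ = ∫⁻ x : ({(0)}ᶜ : Set (Euc d)), F x ∂(Measure.comap Subtype.val volume) :=
        (lintegral_subtype_comap (measurableSet_singleton _).compl _).symm
    _ = ∫⁻ x : ({(0)}ᶜ : Set (Euc d)), (fun z : Metric.sphere (0 : Euc d) 1 × Ioi (0 : ℝ) =>
          F ((z.2 : ℝ) • (z.1 : Euc d))) (homeomorphUnitSphereProd (Euc d) x)
          ∂(Measure.comap Subtype.val volume) := by
        congr 1
        ext x
        have hx : ‖(x : Euc d)‖ ≠ 0 := norm_ne_zero_iff.2 x.2
        simp [smul_smul, hx]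
    _ = _ := by
        rw [hmp.lintegral_comp hmeas, lintegral_prod _ hmeas.aemeasurable, finrank_euc]
        congr 1
        ext y
        exact volumeIoiPow_lintegral (d - 1) (F := fun r => F (r • (y : Euc d)))
          (hF.comp (by fun_prop))

/-- The total mass of the surface measure. -/
def area (d : ℕ) : ℝ≥0∞ := (volume : Measure (Euc d)).toSphere univ

lemma area_ne_zero (d : ℕ) [NeZero d] : area d ≠ 0 := by
  have : Nontrivial (Euc d) := by
    have : Nonempty (Fin d) := ⟨0⟩
    infer_instance
  exact (Measure.measure_univ_ne_zero).2 (Measure.toSphere_ne_zero _)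

lemma area_ne_top (d : ℕ) : area d ≠ ∞ := measure_ne_top _ _

lemma lintegral_norm {d : ℕ} [NeZero d] {G : ℝ → ℝ≥0∞} (hG : Measurable G) :
    ∫⁻ x : Euc d, G ‖x‖ =
      area d * ∫⁻ r in Ioi (0 : ℝ), ENNReal.ofReal (r ^ (d - 1)) * G r := by
  have hG' : Measurable fun x : Euc d => G ‖x‖ := hG.comp measurable_norm
  rw [lintegral_polar hG', area, mul_comm, ← lintegral_const]
  congr 1
  ext y
  refine setLIntegral_congr_fun measurableSet_Ioi fun r (hr : 0 < r) => ?_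
  have : ‖(y : Euc d)‖ = 1 := by simp
  simp [norm_smul, this, abs_of_pos hr]

/-- Fubini for the splitting of the space into the first coordinate and its orthogonal complement,
with polar coordinates in the complement. -/
lemma lintegral_firstCoord {n : ℕ} [NeZero n] {Q : ℝ → ℝ → ℝ≥0∞}
    (hQ : Measurable (Function.uncurry Q)) :
    ∫⁻ x : Euc (n + 1), Q (x 0) ‖x‖ = area n * ∫⁻ u : ℝ, ∫⁻ s in Ioi (0 : ℝ),
      ENNReal.ofReal (s ^ (n - 1)) * Q u √(u ^ 2 + s ^ 2) := by
  have e1 := PiLp.volume_preserving_ofLp (Fin (n + 1))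
  have e2 := volume_preserving_piFinSuccAbove (fun _ : Fin (n + 1) => ℝ) 0
  have e3 := (MeasurePreserving.id (volume : Measure ℝ)).prod (PiLp.volume_preserving_toLp (Fin n))
  have e := (e3.comp e2).comp e1
  have hm : Measurable fun z : ℝ × Euc n => Q z.1 √(z.1 ^ 2 + ‖z.2‖ ^ 2) :=
    hQ.comp (f := fun z : ℝ × Euc n => (z.1, √(z.1 ^ 2 + ‖z.2‖ ^ 2))) (by fun_prop)
  calc ∫⁻ x : Euc (n + 1), Q (x 0) ‖x‖ = ∫⁻ z : ℝ × Euc n, Q z.1 √(z.1 ^ 2 + ‖z.2‖ ^ 2) := by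
        refine Eq.trans ?_ (e.lintegral_comp hm)
        congr 1
        ext x
        congr 1
        rw [EuclideanSpace.norm_eq, EuclideanSpace.norm_eq, Real.sq_sqrt (by positivity),
          Fin.sum_univ_succ]
        simp [MeasurableEquiv.piFinSuccAbove, Fin.tail]
    _ = _ := by
        rw [Measure.volume_eq_prod, lintegral_prod _ hm.aemeasurable,
          ← lintegral_const_mul' _ _ (area_ne_top n)]
        congr 1
        ext u
        exact lintegral_norm (G := fun s => Q u √(u ^ 2 + s ^ 2))
          (hQ.comp (f := fun s : ℝ => (u, √(u ^ 2 + s ^ 2))) (by fun_prop))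

lemma lintegral_halfPlane_polar {Q : ℝ × ℝ → ℝ≥0∞} (hQ : Measurable Q) :
    ∫⁻ u : ℝ, ∫⁻ s in Ioi (0 : ℝ), Q (u, s) =
      ∫⁻ R in Ioi (0 : ℝ), ∫⁻ θ in Ioo 0 Real.pi,
        ENNReal.ofReal R * Q (R * Real.cos θ, R * Real.sin θ) := by
  have hind : Measurable ({z : ℝ × ℝ | 0 < z.2}.indicator Q) :=
    hQ.indicator (measurableSet_lt measurable_const measurable_snd)
  have hm : Measurable fun p : ℝ × ℝ => ENNReal.ofReal p.1 •
      {z : ℝ × ℝ | 0 < z.2}.indicator Q (polarCoord.symm p) := by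
    simp only [polarCoord_symm_apply, smul_eq_mul]
    exact Measurable.mul (by fun_prop) (hind.comp (by fun_prop))
  have h := lintegral_comp_polarCoord_symm ({z : ℝ × ℝ | 0 < z.2}.indicator Q)
  calc ∫⁻ u : ℝ, ∫⁻ s in Ioi (0 : ℝ), Q (u, s)
      = ∫⁻ z, {z : ℝ × ℝ | 0 < z.2}.indicator Q z := by
        rw [Measure.volume_eq_prod, lintegral_prod _ hind.aemeasurable]
        congr 1
        ext u
        rw [← lintegral_indicator measurableSet_Ioi]
        rfl
    _ = _ := by
        rw [← h, polarCoord_target, Measure.volume_eq_prod, ← Measure.prod_restrict,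
          lintegral_prod _ hm.aemeasurable]
        refine setLIntegral_congr_fun measurableSet_Ioi fun R (hR : 0 < R) => ?_
        simp only [polarCoord_symm_apply, smul_eq_mul]
        rw [← lintegral_indicator measurableSet_Ioo, ← lintegral_indicator measurableSet_Ioo]
        congr 1
        ext θ
        have hpi := Real.pi_pos
        by_cases h1 : θ ∈ Ioo 0 Real.pi
        · have h2 : θ ∈ Ioo (-Real.pi) Real.pi := ⟨by linarith [h1.1], h1.2⟩
          have h3 : 0 < R * Real.sin θ := mul_pos hR (Real.sin_pos_of_mem_Ioo h1)
          simp [indicator, h1.1, h1.2, h2.1, h3]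
        · rw [indicator_of_notMem h1]
          by_cases h2 : θ ∈ Ioo (-Real.pi) Real.pi
          · have h4 : θ ≤ 0 := by
              by_contra h5
              exact h1 ⟨not_le.1 h5, h2.2⟩
            have h3 : ¬ 0 < R * Real.sin θ := by
              rw [not_lt]
              exact mul_nonpos_of_nonneg_of_nonpos hR.le
                (Real.sin_nonpos_of_nonpos_of_neg_pi_le h4 h2.1.le)
            simp [indicator, h3]
          · rw [indicator_of_notMem h2]

/-- The Funk-Hecke type formula for functions depending on one coordinate only. -/
lemma lintegral_toSphere_firstCoord {n : ℕ} [NeZero n] {h : ℝ → ℝ≥0∞} (hh : Measurable h) :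
    ∫⁻ y, h ((y : Euc (n + 1)) 0) ∂(volume : Measure (Euc (n + 1))).toSphere =
      area n * ∫⁻ θ in Ioo 0 Real.pi, ENNReal.ofReal (Real.sin θ ^ (n - 1)) * h (Real.cos θ) := by
  set I : ℝ≥0∞ := ∫⁻ r in Ioi (0 : ℝ), (Iio 1).indicator (fun r => ENNReal.ofReal (r ^ n)) r
  have hI : I = ENNReal.ofReal (1 / (n + 1)) := by
    have := setLIntegral_rpow_Ioo (q := n) (a := 1) (by linarith [n.cast_nonneg (α := ℝ)])
      zero_le_one
    simp only [Real.rpow_natCast, Real.one_rpow] at this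
    rw [← this]
    simp only [I]
    rw [lintegral_indicator measurableSet_Iio, Measure.restrict_restrict measurableSet_Iio,
      inter_comm, Ioi_inter_Iio]
  have hI0 : I ≠ 0 := by rw [hI]; simp; positivity
  have hI1 : I ≠ ∞ := by rw [hI]; simp
  -- After multiplication by `I`, both sides become the integral of `h (x 0 / ‖x‖)` over the unit
  -- ball, computed once in polar coordinates of the whole space and once by slicing along the first
  -- coordinate. The factor `I` is finite and nonzero and cancels.
  set Q : ℝ → ℝ → ℝ≥0∞ := fun u s => (Iio 1).indicator 1 s * h (u / s)
  have hQ : Measurable (Function.uncurry Q) := by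
    have h1 : Measurable ((Iio (1:ℝ)).indicator (1 : ℝ → ℝ≥0∞)) :=
      measurable_one.indicator measurableSet_Iio
    exact Measurable.mul (h1.comp measurable_snd) (hh.comp (by fun_prop))
  have hF : Measurable fun x : Euc (n + 1) => Q (x 0) ‖x‖ :=
    hQ.comp (f := fun x : Euc (n + 1) => (x 0, ‖x‖)) (by fun_prop)
  have e1 : ∫⁻ x : Euc (n + 1), Q (x 0) ‖x‖ =
      I * ∫⁻ y, h ((y : Euc (n + 1)) 0) ∂(volume : Measure (Euc (n + 1))).toSphere := by
    rw [lintegral_polar hF, ← lintegral_const_mul' _ _ hI1]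
    congr 1
    ext y
    rw [← lintegral_mul_const _ (by
      exact (Measurable.indicator (by fun_prop) measurableSet_Iio))]
    refine setLIntegral_congr_fun measurableSet_Ioi fun r (hr : 0 < r) => ?_
    have : ‖(y : Euc (n + 1))‖ = 1 := by simp
    simp only [Q, norm_smul, this, Real.norm_eq_abs, abs_of_pos hr, mul_one, PiLp.smul_apply,
      smul_eq_mul, mul_div_cancel_left₀ _ hr.ne', Nat.add_sub_cancel]
    by_cases h1 : r < 1 <;> simp [h1]
  have hQ2 : Measurable fun z : ℝ × ℝ => ENNReal.ofReal (z.2 ^ (n - 1)) *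
      Q z.1 √(z.1 ^ 2 + z.2 ^ 2) :=
    Measurable.mul (by fun_prop)
      (hQ.comp (f := fun z : ℝ × ℝ => (z.1, √(z.1 ^ 2 + z.2 ^ 2))) (by fun_prop))
  have e2 : ∫⁻ x : Euc (n + 1), Q (x 0) ‖x‖ = I * (area n * ∫⁻ θ in Ioo 0 Real.pi,
      ENNReal.ofReal (Real.sin θ ^ (n - 1)) * h (Real.cos θ)) := by
    rw [lintegral_firstCoord hQ, mul_left_comm]
    congr 1
    refine (lintegral_halfPlane_polar hQ2).trans ?_
    simp only [I]
    rw [← lintegral_mul_const _ (by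
      exact (Measurable.indicator (by fun_prop) measurableSet_Iio))]
    refine setLIntegral_congr_fun measurableSet_Ioi fun R (hR : 0 < R) => ?_
    rw [← lintegral_const_mul' _ _ (by
      by_cases h1 : R < 1 <;> simp [h1])]
    refine setLIntegral_congr_fun measurableSet_Ioo fun θ hθ => ?_
    have h2 : √((R * Real.cos θ) ^ 2 + (R * Real.sin θ) ^ 2) = R := by
      rw [show (R * Real.cos θ) ^ 2 + (R * Real.sin θ) ^ 2 =
        R ^ 2 * (Real.sin θ ^ 2 + Real.cos θ ^ 2) by ring, Real.sin_sq_add_cos_sq, mul_one,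
        Real.sqrt_sq hR.le]
    simp only [h2, Q, mul_div_cancel_left₀ _ hR.ne']
    have hn : n - 1 + 1 = n := Nat.sub_add_cancel (NeZero.one_le)
    by_cases h1 : R < 1
    · simp only [h1, indicator, mem_Iio, if_true, Pi.one_apply, one_mul]
      rw [← mul_assoc, ← mul_assoc, ← ENNReal.ofReal_mul hR.le, ← ENNReal.ofReal_mul (by positivity)]
      congr 2
      rw [mul_pow, ← mul_assoc, ← pow_succ', hn]
    · simp [h1]
  exact (ENNReal.mul_right_inj hI0 hI1).1 (e1.symm.trans e2)

/-- Rotation invariance is inherited from Lebesgue measure: `F` is extended to the unit ball as a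
function of `x / ‖x‖`, and the radial factor `I` cancels. -/
lemma lintegral_toSphere_isometry {d : ℕ} [NeZero d] (L : Euc d ≃ₗᵢ[ℝ] Euc d) {F : Euc d → ℝ≥0∞}
    (hF : Measurable F) :
    ∫⁻ y, F (L (y : Euc d)) ∂(volume : Measure (Euc d)).toSphere =
      ∫⁻ y, F (y : Euc d) ∂(volume : Measure (Euc d)).toSphere := by
  set I : ℝ≥0∞ := ∫⁻ r in Ioi (0 : ℝ), (Iio 1).indicator (fun r => ENNReal.ofReal (r ^ (d - 1))) r
  have hI : I = ENNReal.ofReal (1 / ((d - 1 : ℕ) + 1)) := by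
    have := setLIntegral_rpow_Ioo (q := (d - 1 : ℕ)) (a := 1)
      (by linarith [(d - 1).cast_nonneg (α := ℝ)]) zero_le_one
    simp only [Real.rpow_natCast, Real.one_rpow] at this
    rw [← this]
    simp only [I]
    rw [lintegral_indicator measurableSet_Iio, Measure.restrict_restrict measurableSet_Iio,
      inter_comm, Ioi_inter_Iio]
  have hI0 : I ≠ 0 := by rw [hI]; simp; positivity
  have hI1 : I ≠ ∞ := by rw [hI]; simp
  have key : ∀ {F : Euc d → ℝ≥0∞}, Measurable F →
      ∫⁻ x : Euc d, (Iio 1).indicator 1 ‖x‖ * F (‖x‖⁻¹ • x) =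
        I * ∫⁻ y, F (y : Euc d) ∂(volume : Measure (Euc d)).toSphere := by
    intro F hF
    have h1 : Measurable ((Iio (1:ℝ)).indicator (1 : ℝ → ℝ≥0∞)) :=
      measurable_one.indicator measurableSet_Iio
    have hm : Measurable fun x : Euc d => (Iio 1).indicator 1 ‖x‖ * F (‖x‖⁻¹ • x) :=
      Measurable.mul (h1.comp measurable_norm) (hF.comp (by fun_prop))
    rw [lintegral_polar hm, ← lintegral_const_mul' _ _ hI1]
    congr 1
    ext y
    rw [← lintegral_mul_const _ (by
      exact (Measurable.indicator (by fun_prop) measurableSet_Iio))]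
    refine setLIntegral_congr_fun measurableSet_Ioi fun r (hr : 0 < r) => ?_
    have : ‖(y : Euc d)‖ = 1 := by simp
    simp only [norm_smul, this, Real.norm_eq_abs, abs_of_pos hr, mul_one, smul_smul,
      inv_mul_cancel₀ hr.ne', one_smul]
    by_cases h1 : r < 1 <;> simp [h1]
  refine (ENNReal.mul_right_inj hI0 hI1).1 ?_
  have hFL : Measurable fun x => F (L x) := hF.comp L.continuous.measurable
  have h1 : Measurable ((Iio (1:ℝ)).indicator (1 : ℝ → ℝ≥0∞)) :=
    measurable_one.indicator measurableSet_Iio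
  have hm : Measurable fun x : Euc d => (Iio 1).indicator 1 ‖x‖ * F (‖x‖⁻¹ • x) :=
    Measurable.mul (h1.comp measurable_norm) (hF.comp (by fun_prop))
  rw [← key hF, ← key hFL, ← L.measurePreserving.lintegral_comp hm]
  simp

/-! ### Spherical means of radial functions as one-dimensional integrals -/

/-- The density of the distribution of `‖x - t y‖`, `y` on the unit sphere, where `‖x‖ = r`. -/
def kernel (d : ℕ) (r t s : ℝ) : ℝ :=
  √(1 - ((r ^ 2 + t ^ 2 - s ^ 2) / (2 * r * t)) ^ 2) ^ (d - 3) * (s / (r * t))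

/-- The law of cosines: `θ` is the angle at the origin in a triangle with sides `r` and `t`, and the
third side sweeps `(|r - t|, r + t)`. -/
lemma image_chord {r t : ℝ} (hr : 0 < r) (ht : 0 < t) :
    (fun θ => √(r ^ 2 + t ^ 2 - 2 * r * t * Real.cos θ)) '' Ioo 0 Real.pi = Ioo |r - t| (r + t) := by
  have hrt : 0 < r * t := mul_pos hr ht
  ext s
  constructor
  · rintro ⟨θ, hθ, rfl⟩
    have h1 : Real.cos θ < 1 := by
      rw [← Real.cos_zero]
      exact Real.cos_lt_cos_of_nonneg_of_le_pi le_rfl hθ.2.le hθ.1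
    have h2 : -1 < Real.cos θ := by
      rw [← Real.cos_pi]
      exact Real.cos_lt_cos_of_nonneg_of_le_pi hθ.1.le le_rfl hθ.2
    constructor
    · rw [← Real.sqrt_sq_eq_abs]
      apply Real.sqrt_lt_sqrt (sq_nonneg _)
      nlinarith
    · rw [Real.sqrt_lt' (by linarith)]
      nlinarith
  · rintro ⟨h1, h2⟩
    have hs : 0 < s := lt_of_le_of_lt (abs_nonneg _) h1
    have h3 : (r - t) ^ 2 < s ^ 2 := by rw [sq_lt_sq, abs_of_pos hs]; exact h1
    have h4 : s ^ 2 < (r + t) ^ 2 := by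
      rw [sq_lt_sq, abs_of_pos hs, abs_of_pos (by linarith)]; exact h2
    have h5 : (r ^ 2 + t ^ 2 - s ^ 2) / (2 * r * t) < 1 := by
      rw [div_lt_one (by positivity)]; nlinarith
    have h6 : -1 < (r ^ 2 + t ^ 2 - s ^ 2) / (2 * r * t) := by
      rw [lt_div_iff₀ (by positivity)]; nlinarith
    refine ⟨Real.arccos ((r ^ 2 + t ^ 2 - s ^ 2) / (2 * r * t)),
      ⟨Real.arccos_pos.2 h5, ?_⟩, ?_⟩
    · exact lt_of_le_of_ne (Real.arccos_le_pi _) fun h => by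
        rw [Real.arccos_eq_pi] at h; linarith
    · dsimp only
      rw [Real.cos_arccos h6.le h5.le, mul_div_cancel₀ _ (by positivity)]
      rw [show r ^ 2 + t ^ 2 - (r ^ 2 + t ^ 2 - s ^ 2) = s ^ 2 by ring, Real.sqrt_sq hs.le]

/-- The substitution `s = √(r² + t² - 2rt cos θ)` has `ds = (rt sin θ / s) dθ`. It absorbs one power
of the sine, and the remaining `n = d - 3` powers, rewritten in terms of `s`, form the kernel. -/
lemma lintegral_chord (n : ℕ) {r t : ℝ} (hr : 0 < r) (ht : 0 < t) (H : ℝ → ℝ≥0∞) :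
    ∫⁻ θ in Ioo 0 Real.pi, ENNReal.ofReal (Real.sin θ ^ (n + 1)) *
      H √(r ^ 2 + t ^ 2 - 2 * r * t * Real.cos θ) =
    ∫⁻ s in Ioo |r - t| (r + t), ENNReal.ofReal (kernel (n + 3) r t s) * H s := by
  have hrt : 0 < r * t := mul_pos hr ht
  have hpos : ∀ θ ∈ Ioo 0 Real.pi, 0 < r ^ 2 + t ^ 2 - 2 * r * t * Real.cos θ := by
    intro θ hθ
    have h1 : Real.cos θ < 1 := by
      rw [← Real.cos_zero]
      exact Real.cos_lt_cos_of_nonneg_of_le_pi le_rfl hθ.2.le hθ.1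
    nlinarith [sq_nonneg (r - t)]
  have hinj : InjOn (fun θ => √(r ^ 2 + t ^ 2 - 2 * r * t * Real.cos θ)) (Ioo 0 Real.pi) := by
    intro a ha b hb hab
    have h := (Real.sqrt_inj (hpos a ha).le (hpos b hb).le).1 hab
    refine Real.injOn_cos ⟨ha.1.le, ha.2.le⟩ ⟨hb.1.le, hb.2.le⟩ ?_
    have h2 : (2 * r * t) * Real.cos a = (2 * r * t) * Real.cos b := by linarith
    exact mul_left_cancel₀ (by positivity) h2
  have hder : ∀ θ ∈ Ioo 0 Real.pi, HasDerivWithinAt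
      (fun θ => √(r ^ 2 + t ^ 2 - 2 * r * t * Real.cos θ))
      (r * t * Real.sin θ / √(r ^ 2 + t ^ 2 - 2 * r * t * Real.cos θ)) (Ioo 0 Real.pi) θ := by
    intro θ hθ
    have h1 := (((Real.hasDerivAt_cos θ).const_mul (2 * r * t)).const_sub (r ^ 2 + t ^ 2)).sqrt
      (hpos θ hθ).ne'
    refine (h1.congr_deriv ?_).hasDerivWithinAt
    field_simp
  rw [← image_chord hr ht, lintegral_image_eq_lintegral_abs_deriv_mul measurableSet_Ioo hder hinj]
  refine setLIntegral_congr_fun measurableSet_Ioo fun θ hθ => ?_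
  have hs : 0 < √(r ^ 2 + t ^ 2 - 2 * r * t * Real.cos θ) := Real.sqrt_pos.2 (hpos θ hθ)
  have hsin : 0 < Real.sin θ := Real.sin_pos_of_mem_Ioo hθ
  have hk : kernel (n + 3) r t √(r ^ 2 + t ^ 2 - 2 * r * t * Real.cos θ) =
      Real.sin θ ^ n * (√(r ^ 2 + t ^ 2 - 2 * r * t * Real.cos θ) / (r * t)) := by
    rw [kernel, Real.sq_sqrt (hpos θ hθ).le, sub_sub_cancel, mul_div_cancel_left₀ _ (by positivity),
      ← Real.sin_sq, Real.sqrt_sq hsin.le]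
    simp
  rw [hk, ← mul_assoc, ← ENNReal.ofReal_mul (abs_nonneg _), abs_of_pos (by positivity)]
  congr 2
  rw [pow_succ]
  generalize √(r ^ 2 + t ^ 2 - 2 * r * t * Real.cos θ) = s at hs
  field_simp

/-- The normalizing constant of the density. -/
def kernelConst (d : ℕ) : ℝ≥0∞ := (area d)⁻¹ * area (d - 1)

lemma kernelConst_ne_top {d : ℕ} (hd : 3 ≤ d) : kernelConst d ≠ ∞ := by
  have : NeZero d := ⟨by omega⟩
  exact ENNReal.mul_ne_top (ENNReal.inv_ne_top.2 (area_ne_zero d)) (area_ne_top _)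

lemma kernelConst_ne_zero {d : ℕ} (hd : 3 ≤ d) : kernelConst d ≠ 0 := by
  have : NeZero (d - 1) := ⟨by omega⟩
  exact mul_ne_zero (ENNReal.inv_ne_zero.2 (area_ne_top d)) (area_ne_zero _)

lemma exists_isometry_firstCoord {n : ℕ} {x : Euc (n + 1)} :
    ∃ L : Euc (n + 1) ≃ₗᵢ[ℝ] Euc (n + 1), L (EuclideanSpace.single 0 ‖x‖) = x := by
  refine ⟨_, Submodule.reflection_sub (v := EuclideanSpace.single 0 ‖x‖) (w := x) ?_⟩
  simp

/-- Spherical averages of radial functions as integrals over an interval. -/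
lemma lintegral_sphere_radial {d : ℕ} (hd : 3 ≤ d) {x : Euc d} (hx : x ≠ 0) {t : ℝ} (ht : 0 < t)
    {H : ℝ → ℝ≥0∞} (hH : Measurable H) :
    ∫⁻ y, H ‖x - t • (y : Euc d)‖ ∂(sphereMeasure d) = kernelConst d *
      ∫⁻ s in Ioo |‖x‖ - t| (‖x‖ + t), ENNReal.ofReal (kernel d ‖x‖ t s) * H s := by
  obtain ⟨n, rfl⟩ : ∃ n, d = n + 3 := ⟨d - 3, by omega⟩
  obtain ⟨L, hL⟩ := exists_isometry_firstCoord (n := n + 2) (x := x)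
  have hr : 0 < ‖x‖ := norm_pos_iff.2 hx
  have hF : Measurable fun y : Euc (n + 3) => H ‖x - t • y‖ := hH.comp (by fun_prop)
  rw [sphereMeasure, lintegral_smul_measure, ← lintegral_toSphere_isometry L hF]
  have e : ∀ y : Metric.sphere (0 : Euc (n + 3)) 1, H ‖x - t • L (y : Euc (n + 3))‖ =
      H √(‖x‖ ^ 2 + t ^ 2 - 2 * ‖x‖ * t * (y : Euc (n + 3)) 0) := by
    intro y
    have hy : ‖(y : Euc (n + 3))‖ = 1 := by simp
    congr 1
    nth_rw 1 [← hL]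
    rw [← map_smul, ← map_sub, L.norm_map, ← Real.sqrt_sq (norm_nonneg (_ - _)),
      norm_sub_sq_real, norm_smul, hy]
    congr 1
    simp [EuclideanSpace.inner_single_left, inner_smul_right]
    ring
  simp_rw [e]
  rw [lintegral_toSphere_firstCoord (n := n + 2)
    (h := fun u => H √(‖x‖ ^ 2 + t ^ 2 - 2 * ‖x‖ * t * u)) (hH.comp (by fun_prop)),
    show n + 2 - 1 = n + 1 by omega, lintegral_chord n hr ht, kernelConst, smul_eq_mul, mul_assoc]
  rfl

/-! ### Measurable profiles and measurability of the maximal function -/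

/-- The profile of a measurable radial function agrees almost everywhere with a measurable
function. -/
lemma exists_measurable_profile {d : ℕ} [NeZero d] {f : Euc d → ℂ}
    (hf : AEStronglyMeasurable f volume) {f₀ : ℝ → ℂ} (hf₀ : ∀ x, f x = f₀ ‖x‖) :
    ∃ f₁ : ℝ → ℂ, Measurable f₁ ∧ volume {s | 0 < s ∧ f₀ s ≠ f₁ s} = 0 := by
  have : Nontrivial (Euc d) := by
    have : Nonempty (Fin d) := ⟨0⟩
    infer_instance
  have hmp := (volume : Measure (Euc d)).measurePreserving_homeomorphUnitSphereProd
  have h1 : AEStronglyMeasurable (fun x : ({0}ᶜ : Set (Euc d)) => f x)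
      (Measure.comap Subtype.val volume) := by
    have h := hf.restrict (s := ({0}ᶜ : Set (Euc d)))
    rw [← map_comap_subtype_coe (measurableSet_singleton _).compl] at h
    exact ((MeasurableEmbedding.subtype_coe
      (measurableSet_singleton _).compl).aestronglyMeasurable_map_iff).1 h
  have h2 : AEStronglyMeasurable (fun z : Metric.sphere (0 : Euc d) 1 × Ioi (0 : ℝ) => f₀ z.2)
      ((volume : Measure (Euc d)).toSphere.prod
        (Measure.volumeIoiPow (Module.finrank ℝ (Euc d) - 1))) := by
    rw [← hmp.aestronglyMeasurable_comp_iff (Homeomorph.measurableEmbedding _)]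
    refine h1.congr (Filter.Eventually.of_forall fun x => ?_)
    simp [hf₀]
  have : NeZero (volume : Measure (Euc d)).toSphere := ⟨Measure.toSphere_ne_zero _⟩
  -- In polar coordinates the function does not depend on the direction, so one good slice already
  -- gives the measurability of `f₀`. Positivity of the radial density then transfers it to Lebesgue
  -- measure.
  obtain ⟨y, hy⟩ := h2.prodMk_left.exists
  have h3 : AEStronglyMeasurable (fun s : Ioi (0 : ℝ) => f₀ s)
      (Measure.comap Subtype.val volume) := by
    refine AEStronglyMeasurable.mono_ac (withDensity_absolutelyContinuous' ?_ ?_) hy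
    · fun_prop
    · refine Filter.Eventually.of_forall fun s => ?_
      simpa using pow_pos s.2.out _
  have h4 : AEStronglyMeasurable f₀ (volume.restrict (Ioi (0 : ℝ))) := by
    rw [← map_comap_subtype_coe measurableSet_Ioi]
    exact ((MeasurableEmbedding.subtype_coe measurableSet_Ioi).aestronglyMeasurable_map_iff).2 h3
  refine ⟨h4.mk f₀, h4.stronglyMeasurable_mk.measurable, ?_⟩
  have h5 := (ae_restrict_iff' measurableSet_Ioi).1 h4.ae_eq_mk
  rw [ae_iff] at h5
  convert h5 using 3
  simp

instance {d : ℕ} : IsFiniteMeasure (sphereMeasure d) := by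
  rcases Nat.eq_zero_or_pos d with rfl | hd
  · have : IsEmpty (Metric.sphere (0 : Euc 0) 1) := by
      refine ⟨fun y => ?_⟩
      have h1 : ‖(y : Euc 0)‖ = 1 := by simp
      rw [Subsingleton.elim (y : Euc 0) 0] at h1
      simp at h1
    rw [Measure.eq_zero_of_isEmpty (sphereMeasure 0)]
    infer_instance
  · have : NeZero d := ⟨hd.ne'⟩
    refine ⟨?_⟩
    rw [sphereMeasure, Measure.smul_apply, smul_eq_mul]
    exact ENNReal.mul_lt_top (ENNReal.inv_lt_top.2 (pos_iff_ne_zero.2 (area_ne_zero d)))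
      (measure_lt_top _ _)

/-- The distribution of `‖x - t y‖` has a density, so a null set of radii is not seen. This holds
for each individual `t`, so an uncountable `E` causes no difficulty. The point 0 is added to the
null set because nothing is known about `f₁ 0`. -/
lemma sphere_ae_eq_profile {d : ℕ} (hd : 3 ≤ d) {f₀ f₁ : ℝ → ℂ}
    (h : volume {s | 0 < s ∧ f₀ s ≠ f₁ s} = 0) {x : Euc d} (hx : x ≠ 0) {t : ℝ} (ht : 0 < t) :
    ∀ᵐ y : Metric.sphere (0 : Euc d) 1 ∂(sphereMeasure d),
      f₀ ‖x - t • (y : Euc d)‖ = f₁ ‖x - t • (y : Euc d)‖ := by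
  obtain ⟨N, hN, hNm, hN0⟩ := exists_measurable_superset_of_null h
  have hN' : MeasurableSet (N ∪ {0}) := hNm.union (measurableSet_singleton 0)
  have hm : Measurable ((N ∪ {0}).indicator (1 : ℝ → ℝ≥0∞)) := measurable_one.indicator hN'
  have h0 := lintegral_sphere_radial hd hx ht hm
  have h1 : ∀ᵐ s : ℝ, s ∉ N ∪ {0} := by
    have h3 : volume (N ∪ {(0 : ℝ)}) = 0 := measure_union_null hN0 (by simp)
    exact measure_eq_zero_iff_ae_notMem.1 h3
  have h2 : ∫⁻ s in Ioo |‖x‖ - t| (‖x‖ + t), ENNReal.ofReal (kernel d ‖x‖ t s) *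
      (N ∪ {0}).indicator 1 s = 0 := by
    rw [lintegral_congr_ae (g := fun _ => 0)]
    · simp
    · refine ae_restrict_of_ae ?_
      filter_upwards [h1] with s hs
      rw [indicator_of_notMem hs, mul_zero]
  have hm' : Measurable fun y : Metric.sphere (0 : Euc d) 1 =>
      (N ∪ {0}).indicator (1 : ℝ → ℝ≥0∞) ‖x - t • (y : Euc d)‖ := hm.comp (by fun_prop)
  rw [h2, mul_zero, lintegral_eq_zero_iff hm'] at h0
  filter_upwards [h0] with y hy
  have hy' : ‖x - t • (y : Euc d)‖ ∉ N ∪ {0} := by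
    intro hmem
    rw [indicator_of_mem hmem] at hy
    simp at hy
  by_contra hne
  refine hy' ?_
  rcases (norm_nonneg (x - t • (y : Euc d))).eq_or_lt with h3 | h3
  · exact Or.inr h3.symm
  · exact Or.inl (hN ⟨h3, hne⟩)

section Profile

variable {d : ℕ} {f : Euc d → ℂ} {f₀ f₁ : ℝ → ℂ}

lemma lintegral_enorm_sphere (hd : 3 ≤ d) (hf₀ : ∀ x, f x = f₀ ‖x‖) (hf₁ : Measurable f₁)
    (h : volume {s | 0 < s ∧ f₀ s ≠ f₁ s} = 0) {x : Euc d} (hx : x ≠ 0) {t : ℝ} (ht : 0 < t) :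
    ∫⁻ y, ‖f (x - t • (y : Euc d))‖ₑ ∂(sphereMeasure d) = kernelConst d *
      ∫⁻ s in Ioo |‖x‖ - t| (‖x‖ + t), ENNReal.ofReal (kernel d ‖x‖ t s) * ‖f₁ s‖ₑ := by
  rw [← lintegral_sphere_radial hd hx ht hf₁.enorm]
  refine lintegral_congr_ae ?_
  filter_upwards [sphere_ae_eq_profile hd h hx ht] with y hy
  rw [hf₀, hy]

lemma meanExists_of_lintegral_ne_top (hd : 3 ≤ d) (hf₀ : ∀ x, f x = f₀ ‖x‖) (hf₁ : Measurable f₁)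
    (h : volume {s | 0 < s ∧ f₀ s ≠ f₁ s} = 0) {x : Euc d} (hx : x ≠ 0) {t : ℝ} (ht : 0 < t)
    (hfin : ∫⁻ s in Ioo |‖x‖ - t| (‖x‖ + t), ENNReal.ofReal (kernel d ‖x‖ t s) * ‖f₁ s‖ₑ ≠ ∞) :
    MeanExists f t x := by
  refine ⟨?_, ?_⟩
  · have hm : Measurable fun y : Metric.sphere (0 : Euc d) 1 => f₁ ‖x - t • (y : Euc d)‖ :=
      hf₁.comp (by fun_prop)
    refine hm.aestronglyMeasurable.congr ?_
    filter_upwards [sphere_ae_eq_profile hd h hx ht] with y hy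
    rw [hf₀, hy]
  · rw [HasFiniteIntegral, lintegral_enorm_sphere hd hf₀ hf₁ h hx ht]
    exact (ENNReal.mul_ne_top (kernelConst_ne_top hd) hfin).lt_top

lemma enorm_sphericalMean_le (hd : 3 ≤ d) (hf₀ : ∀ x, f x = f₀ ‖x‖) (hf₁ : Measurable f₁)
    (h : volume {s | 0 < s ∧ f₀ s ≠ f₁ s} = 0) {x : Euc d} (hx : x ≠ 0) {t : ℝ} (ht : 0 < t) :
    ‖sphericalMean f t x‖ₑ ≤ kernelConst d *
      ∫⁻ s in Ioo |‖x‖ - t| (‖x‖ + t), ENNReal.ofReal (kernel d ‖x‖ t s) * ‖f₁ s‖ₑ := by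
  rw [← lintegral_enorm_sphere hd hf₀ hf₁ h hx ht]
  exact enorm_integral_le_lintegral_enorm _

lemma kernel_measurable (d : ℕ) (r t : ℝ) : Measurable (kernel d r t) := by
  unfold kernel
  fun_prop

lemma kernel_nonneg {d : ℕ} {r t s : ℝ} (hr : 0 ≤ r) (ht : 0 ≤ t) (hs : 0 ≤ s) :
    0 ≤ kernel d r t s := by
  unfold kernel
  positivity

lemma kernel_le_div {d : ℕ} {r t s : ℝ} (hr : 0 ≤ r) (ht : 0 ≤ t) (hs : 0 ≤ s) :
    kernel d r t s ≤ s / (r * t) := by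
  unfold kernel
  refine mul_le_of_le_one_left (by positivity) (pow_le_one₀ (Real.sqrt_nonneg _) ?_)
  rw [Real.sqrt_le_one]
  linarith [sq_nonneg ((r ^ 2 + t ^ 2 - s ^ 2) / (2 * r * t))]

/-- The integral is written over the whole line with an indicator, so that dependence on `‖x‖` can
be handled by dominated convergence on a fixed space. -/
lemma sphericalMean_eq (hd : 3 ≤ d) (hf₀ : ∀ x, f x = f₀ ‖x‖) (hf₁ : Measurable f₁)
    (h : volume {s | 0 < s ∧ f₀ s ≠ f₁ s} = 0) {x : Euc d} (hx : x ≠ 0) {t : ℝ} (ht : 0 < t) :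
    sphericalMean f t x = (kernelConst d).toReal • ∫ s, (Ioo |‖x‖ - t| (‖x‖ + t)).indicator
      (fun s => kernel d ‖x‖ t s • f₁ s) s := by
  have hr : 0 < ‖x‖ := norm_pos_iff.2 hx
  have hφ : Measurable fun y : Metric.sphere (0 : Euc d) 1 => ‖x - t • (y : Euc d)‖ := by fun_prop
  have hk : Measurable fun s => ENNReal.ofReal (kernel d ‖x‖ t s) :=
    (kernel_measurable d _ _).ennreal_ofReal
  have hmap : Measure.map (fun y : Metric.sphere (0 : Euc d) 1 => ‖x - t • (y : Euc d)‖)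
      (sphereMeasure d) = kernelConst d • (volume.restrict (Ioo |‖x‖ - t| (‖x‖ + t))).withDensity
        (fun s => ENNReal.ofReal (kernel d ‖x‖ t s)) := by
    refine Measure.ext_of_lintegral _ fun H hH => ?_
    rw [lintegral_map hH hφ, lintegral_sphere_radial hd hx ht hH, lintegral_smul_measure,
      lintegral_withDensity_eq_lintegral_mul _ hk hH]
    rfl
  calc sphericalMean f t x = ∫ y, f₁ ‖x - t • (y : Euc d)‖ ∂(sphereMeasure d) := by
        refine integral_congr_ae ?_
        filter_upwards [sphere_ae_eq_profile hd h hx ht] with y hy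
        rw [hf₀, hy]
    _ = ∫ s, f₁ s ∂(Measure.map (fun y : Metric.sphere (0 : Euc d) 1 => ‖x - t • (y : Euc d)‖)
          (sphereMeasure d)) := (integral_map hφ.aemeasurable hf₁.aestronglyMeasurable).symm
    _ = _ := by
        rw [hmap, integral_smul_measure, integral_withDensity_eq_integral_toReal_smul hk
          (by simp), ← integral_indicator measurableSet_Ioo]
        congr 2
        ext s
        by_cases hs : s ∈ Ioo |‖x‖ - t| (‖x‖ + t)
        · have hs0 : 0 ≤ s := (abs_nonneg _).trans hs.1.le
          simp [indicator_of_mem hs, ENNReal.toReal_ofReal (kernel_nonneg hr.le ht.le hs0)]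
        · simp [indicator_of_notMem hs]

/-- Since `r ≠ t`, the range of integration stays away from 0, where the profile need not be
integrable, and the kernel stays bounded. The indicator is discontinuous in `r` only for the two
values of `s` at the endpoints. -/
lemma continuousAt_mean_integral (hf₁ : Measurable f₁)
    (hint : ∀ a b : ℝ, 0 < a → ∫⁻ s in Icc a b, ‖f₁ s‖ₑ ≠ ∞) {r t : ℝ} (hr : 0 < r) (ht : 0 < t)
    (hrt : r ≠ t) :
    ContinuousAt (fun r => ∫ s, (Ioo |r - t| (r + t)).indicator
      (fun s => kernel d r t s • f₁ s) s) r := by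
  -- With this choice `|r' - t| ≥ ε` and `r' ≥ ε` whenever `|r' - r| < ε`, which gives the
  -- dominating constant `B`.
  set ε : ℝ := min |r - t| r / 2
  have hrt' : 0 < |r - t| := abs_pos.2 (sub_ne_zero.2 hrt)
  have hε : 0 < ε := by positivity
  have hε1 : 2 * ε ≤ |r - t| := by
    have := min_le_left |r - t| r
    simp only [ε]; linarith
  have hε2 : 2 * ε ≤ r := by
    have := min_le_right |r - t| r
    simp only [ε]; linarith
  set B : ℝ := (r + ε + t) / (ε * t)
  have hB : 0 < B := by positivity
  have hnhds : ∀ᶠ r' in nhds r, |r' - r| < ε := by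
    have := Metric.ball_mem_nhds r hε
    filter_upwards [this] with r' hr'
    rwa [Metric.mem_ball, Real.dist_eq] at hr'
  refine continuousAt_of_dominated
    (bound := (Icc ε (r + ε + t)).indicator (fun s => B * ‖f₁ s‖)) ?_ ?_ ?_ ?_
  · refine Filter.Eventually.of_forall fun r' => ?_
    exact (((kernel_measurable d r' t).smul hf₁).indicator measurableSet_Ioo).aestronglyMeasurable
  · filter_upwards [hnhds] with r' hr'
    rw [abs_lt] at hr'
    refine Filter.Eventually.of_forall fun s => ?_
    by_cases hs : s ∈ Ioo |r' - t| (r' + t)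
    · have h1 : |r - t| ≤ |r' - t| + ε := by
        have e1 : |r - t| ≤ |r - r'| + |r' - t| := abs_sub_le _ _ _
        have e2 : |r - r'| ≤ ε := abs_le.2 ⟨by linarith, by linarith⟩
        linarith
      have hs' : s ∈ Icc ε (r + ε + t) := ⟨by linarith [hs.1], by linarith [hs.2]⟩
      have hs0 : 0 ≤ s := hε.le.trans hs'.1
      rw [indicator_of_mem hs, indicator_of_mem hs', norm_smul, Real.norm_eq_abs,
        abs_of_nonneg (kernel_nonneg (by linarith) ht.le hs0)]
      refine mul_le_mul_of_nonneg_right ?_ (norm_nonneg _)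
      refine (kernel_le_div (by linarith) ht.le hs0).trans ?_
      simp only [B]
      gcongr
      · exact hs'.2
      · linarith
    · rw [indicator_of_notMem hs, norm_zero]
      exact indicator_nonneg (fun s _ => by positivity) _
  · rw [integrable_indicator_iff measurableSet_Icc]
    refine Integrable.const_mul ⟨hf₁.norm.aestronglyMeasurable, ?_⟩ _
    rw [HasFiniteIntegral]
    simpa using (hint ε (r + ε + t) hε).lt_top
  · have h1 : ∀ᵐ s : ℝ, s ≠ |r - t| := by simp [ae_iff]
    have h2 : ∀ᵐ s : ℝ, s ≠ r + t := by simp [ae_iff]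
    filter_upwards [h1, h2] with s hs1 hs2
    have hk : ContinuousAt (fun r => kernel d r t s • f₁ s) r := by
      unfold kernel
      have : r * t ≠ 0 := by positivity
      have : 2 * r * t ≠ 0 := by positivity
      fun_prop (disch := assumption)
    have hc1 : ContinuousAt (fun r : ℝ => |r - t|) r := by fun_prop
    have hc2 : ContinuousAt (fun r : ℝ => r + t) r := by fun_prop
    by_cases hs : s ∈ Ioo |r - t| (r + t)
    · refine hk.congr ?_
      filter_upwards [hc1.eventually_lt_const hs.1, hc2.eventually_const_lt hs.2] with r' h3 h4
      rw [indicator_of_mem (show s ∈ Ioo |r' - t| (r' + t) from ⟨h3, h4⟩)]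
    · refine (continuousAt_const (y := (0 : ℂ))).congr ?_
      rcases lt_or_gt_of_ne hs1 with h3 | h3
      · filter_upwards [hc1.eventually_const_lt h3] with r' h4
        rw [indicator_of_notMem fun h => absurd h.1 (not_lt.2 h4.le)]
      · have h4 : r + t < s := by
          rcases lt_or_gt_of_ne hs2 with h5 | h5
          · exact absurd ⟨h3, h5⟩ hs
          · exact h5
        filter_upwards [hc2.eventually_lt_const h4] with r' h5
        rw [indicator_of_notMem fun h => absurd h.2 (not_lt.2 h5.le)]

lemma volume_norm_mem_eq_zero {d : ℕ} [NeZero d] {S : Set ℝ} (hSm : MeasurableSet S)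
    (hS : volume S = 0) : volume {x : Euc d | ‖x‖ ∈ S} = 0 := by
  have hm : Measurable (S.indicator (1 : ℝ → ℝ≥0∞)) := measurable_one.indicator hSm
  have h1 := lintegral_norm (d := d) hm
  have h2 : ∫⁻ r in Ioi (0 : ℝ), ENNReal.ofReal (r ^ (d - 1)) * S.indicator 1 r = 0 := by
    rw [lintegral_congr_ae (g := fun _ => 0)]
    · simp
    · refine ae_restrict_of_ae ?_
      have : ∀ᵐ s : ℝ, s ∉ S := by rw [ae_iff]; simpa using hS
      filter_upwards [this] with s hs
      simp [indicator_of_notMem hs]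
  rw [h2, mul_zero] at h1
  rw [← h1]
  exact (lintegral_indicator_one (measurable_norm hSm)).symm

/-- The supremum may be uncountable. Off the null set where `‖x‖` lies in `closure E` or `x = 0` all
means are continuous, so their supremum is lower semicontinuous. -/
lemma aemeasurable_maximalFunction (hd : 3 ≤ d) (hf₀ : ∀ x, f x = f₀ ‖x‖) (hf₁ : Measurable f₁)
    (h : volume {s | 0 < s ∧ f₀ s ≠ f₁ s} = 0)
    (hint : ∀ a b : ℝ, 0 < a → ∫⁻ s in Icc a b, ‖f₁ s‖ₑ ≠ ∞) {E : Set ℝ} (hE : E ⊆ Ioi 0)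
    (hE0 : volume (closure E) = 0) : AEMeasurable (maximalFunction E f) volume := by
  have : NeZero d := ⟨by omega⟩
  have hS : volume (closure E ∪ {0}) = 0 := measure_union_null hE0 (by simp)
  have hSc : IsClosed (closure E ∪ {0}) := isClosed_closure.union isClosed_singleton
  set U : Set (Euc d) := {x | ‖x‖ ∉ closure E ∪ {0}} with hU
  have hUo : IsOpen U := hSc.isOpen_compl.preimage continuous_norm
  have hU0 : volume Uᶜ = 0 := by
    refine Eq.trans (congrArg _ ?_) (volume_norm_mem_eq_zero (d := d) hSc.measurableSet hS)
    ext x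
    simp only [hU, mem_compl_iff, mem_ofPred_eq, not_not]
  have hlsc : LowerSemicontinuous fun x : U => maximalFunction E f x := by
    refine lowerSemicontinuous_biSup fun t ht => ?_
    refine Continuous.lowerSemicontinuous ?_
    refine (continuous_iff_continuousAt.2 fun x => ?_).enorm
    have hx : ‖(x : Euc d)‖ ≠ 0 := fun h => x.2 (Or.inr h)
    have hxt : ‖(x : Euc d)‖ ≠ t := fun h => x.2 (Or.inl (h ▸ subset_closure ht))
    have hc := continuousAt_mean_integral (d := d) hf₁ hint
      (lt_of_le_of_ne (norm_nonneg _) hx.symm) (hE ht) hxt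
    have hc2 : ContinuousAt (fun x : U => (kernelConst d).toReal • ∫ s,
        (Ioo |‖(x : Euc d)‖ - t| (‖(x : Euc d)‖ + t)).indicator
        (fun s => kernel d ‖(x : Euc d)‖ t s • f₁ s) s) x := by
      have hc3 := ContinuousAt.comp (f := fun x : U => ‖(x : Euc d)‖) (x := x) hc (by fun_prop)
      exact hc3.const_smul (kernelConst d).toReal
    refine hc2.congr (Filter.Eventually.of_forall fun z => ?_)
    have hz : (z : Euc d) ≠ 0 := fun h => z.2 (Or.inr (by simp [h]))
    exact (sphericalMean_eq hd hf₀ hf₁ h hz (hE ht)).symm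
  have h1 := aemeasurable_restrict_of_measurable_subtype (μ := volume) hUo.measurableSet
    hlsc.measurable
  rwa [Measure.restrict_eq_self_of_ae_mem] at h1
  rw [ae_iff]
  exact hU0

end Profile

/-! ### Radii much smaller or much larger than the distance to the origin -/

/-- The measure `s^{d-1} ds` on `(0, ∞)`. -/
def radialMeasure (d : ℕ) : Measure ℝ :=
  (volume.restrict (Ioi 0)).withDensity fun s => ENNReal.ofReal (s ^ (d - 1))

instance (d : ℕ) : SFinite (radialMeasure d) := by
  unfold radialMeasure; infer_instance

/-- The spherical mean over radius `t` at distance `r` from the origin, up to a constant, of the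
radial function with profile `g`. -/
def radialMean (d : ℕ) (g : ℝ → ℝ≥0∞) (r t : ℝ) : ℝ≥0∞ :=
  ∫⁻ s in Ioo |r - t| (r + t), ENNReal.ofReal (kernel d r t s) * g s

lemma lintegral_radialMeasure' (d : ℕ) (F : ℝ → ℝ≥0∞) :
    ∫⁻ s, F s ∂(radialMeasure d) = ∫⁻ s in Ioi (0 : ℝ), ENNReal.ofReal (s ^ (d - 1)) * F s := by
  rw [radialMeasure, lintegral_withDensity_eq_lintegral_mul_non_measurable]
  · rfl
  · fun_prop
  · simp

lemma setLIntegral_radialMeasure (d : ℕ) (F : ℝ → ℝ≥0∞) {A : Set ℝ} (hA : MeasurableSet A)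
    (hA0 : A ⊆ Ioi 0) :
    ∫⁻ s in A, F s ∂(radialMeasure d) = ∫⁻ s in A, ENNReal.ofReal (s ^ (d - 1)) * F s := by
  rw [radialMeasure, restrict_withDensity hA, Measure.restrict_restrict hA,
    inter_eq_left.2 hA0, lintegral_withDensity_eq_lintegral_mul_non_measurable]
  · rfl
  · fun_prop
  · simp

lemma radialMeasure_Icc_le (d : ℕ) {a b : ℝ} :
    radialMeasure d (Icc a b) ≤ ENNReal.ofReal (b - a) * ENNReal.ofReal (b ^ (d - 1)) := by
  rw [radialMeasure, withDensity_apply _ measurableSet_Icc,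
    Measure.restrict_restrict measurableSet_Icc]
  calc _ ≤ ∫⁻ s in Icc a b ∩ Ioi 0, ENNReal.ofReal (b ^ (d - 1)) := by
        refine setLIntegral_mono' (measurableSet_Icc.inter measurableSet_Ioi) fun s hs => ?_
        have : 0 < s := hs.2
        exact ENNReal.ofReal_le_ofReal (pow_le_pow_left₀ this.le hs.1.2 _)
    _ ≤ ∫⁻ s in Icc a b, ENNReal.ofReal (b ^ (d - 1)) :=
        lintegral_mono_set inter_subset_left
    _ = _ := by rw [setLIntegral_const, Real.volume_Icc, mul_comm]

lemma le_radialMeasure_Icc (d : ℕ) {a b : ℝ} (ha : 0 < a) :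
    ENNReal.ofReal (b - a) * ENNReal.ofReal (a ^ (d - 1)) ≤ radialMeasure d (Icc a b) := by
  have h1 := setLIntegral_radialMeasure d 1 (measurableSet_Icc (a := a) (b := b))
    (fun s hs => lt_of_lt_of_le ha hs.1)
  simp only [Pi.one_apply, mul_one, setLIntegral_one] at h1
  rw [h1]
  calc _ = ∫⁻ s in Icc a b, ENNReal.ofReal (a ^ (d - 1)) := by
        rw [setLIntegral_const, Real.volume_Icc, mul_comm]
    _ ≤ _ := by
        refine setLIntegral_mono' measurableSet_Icc fun s hs => ?_
        exact ENNReal.ofReal_le_ofReal (pow_le_pow_left₀ ha.le hs.1 _)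

lemma measurable_setLIntegral_closedBall {μ : Measure ℝ} [SFinite μ] {g : ℝ → ℝ≥0∞}
    (hg : Measurable g) (ρ : ℝ) : Measurable fun r => ∫⁻ s in Metric.closedBall r ρ, g s ∂μ := by
  have h : Measurable (Function.uncurry fun r s : ℝ => (Metric.closedBall r ρ).indicator g s) := by
    have : (Function.uncurry fun r s : ℝ => (Metric.closedBall r ρ).indicator g s) =
        {z : ℝ × ℝ | dist z.2 z.1 ≤ ρ}.indicator (fun z => g z.2) := by
      ext ⟨r, s⟩; rfl
    rw [this]
    refine Measurable.indicator (by fun_prop) ?_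
    exact measurableSet_le (by fun_prop) measurable_const
  have h2 := h.lintegral_prod_right (ν := μ)
  simpa only [lintegral_indicator Metric.isClosed_closedBall.measurableSet] using h2

/-- Radii much smaller than the distance to the origin. -/
lemma lintegral_radialMean_small {d : ℕ} {p : ℝ} (hp : 1 < p) :
    ∃ C : ℝ≥0∞, C ≠ ∞ ∧ ∀ g : ℝ → ℝ≥0∞, Measurable g → (∀ s, g s ≠ ∞) →
      ∃ H : ℝ → ℝ≥0∞, Measurable H ∧
        (∀ r t, 0 < t → t ≤ r / 2 → radialMean d g r t ^ p ≤ H r) ∧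
        ∫⁻ r, H r ∂(radialMeasure d) ≤ C * ∫⁻ s, g s ^ p ∂(radialMeasure d) := by
  -- Indices are a centre `r` and a dyadic radius `2^j ≤ r`. With `π` the centre and `ν = μ`, the
  -- embedding theorem is the Hardy–Littlewood maximal theorem for `radialMeasure d`.
  set ι := {z : ℝ × ℤ // (2 : ℝ) ^ z.2 ≤ z.1}
  set c : ι → ℝ := fun i => i.1.1
  set ρ : ι → ℝ := fun i => 2 ^ i.1.2
  have hρ : ∀ i, 0 < ρ i := fun i => by positivity
  have hρc : ∀ i, ρ i ≤ c i := fun i => i.2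
  have hball : ∀ i, Metric.closedBall (c i) (ρ i) = Icc (c i - ρ i) (c i + ρ i) := fun i =>
    Real.closedBall_eq_Icc
  have hlow : ∀ i, ENNReal.ofReal (ρ i) * ENNReal.ofReal (c i ^ (d - 1)) ≤
      radialMeasure d (Metric.closedBall (c i) (ρ i)) := by
    intro i
    -- Only the right half of the ball is used, since its left endpoint may be 0.
    have h := le_radialMeasure_Icc d (a := c i) (b := c i + ρ i) ((hρ i).trans_le (hρc i))
    rw [add_sub_cancel_left] at h
    rw [hball]
    exact h.trans (measure_mono (Icc_subset_Icc_left (by linarith [hρ i])))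
  have hup : ∀ i, radialMeasure d (Metric.closedBall (c i) (ρ i)) ≤
      ENNReal.ofReal (2 * ρ i * (2 * c i) ^ (d - 1)) := by
    intro i
    have h1 := hρ i
    have h2 := hρc i
    rw [hball]
    refine (radialMeasure_Icc_le d).trans ?_
    rw [← ENNReal.ofReal_mul (by linarith)]
    refine ENNReal.ofReal_le_ofReal ?_
    have h2 : (c i + ρ i) ^ (d - 1) ≤ (2 * c i) ^ (d - 1) :=
      pow_le_pow_left₀ (by linarith) (by linarith) _
    nlinarith
  have h0 : ∀ i, radialMeasure d (Metric.closedBall (c i) (ρ i)) ≠ 0 := by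
    intro i h
    have h1 := hlow i
    have h2 := hρ i
    have h3 : 0 < c i ^ (d - 1) := pow_pos (h2.trans_le (hρc i)) _
    rw [h, nonpos_iff_eq_zero, mul_eq_zero, ENNReal.ofReal_eq_zero, ENNReal.ofReal_eq_zero] at h1
    rcases h1 with h1 | h1 <;> linarith
  have h1 : ∀ i, radialMeasure d (Metric.closedBall (c i) (ρ i)) ≠ ∞ := fun i =>
    ((hup i).trans_lt ENNReal.ofReal_lt_top).ne
  -- The fivefold ball has length `10 ρ`, and its points are at most `c + 5ρ ≤ 6c`.
  have hC : ∀ j, radialMeasure d (c ''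
      {i | Metric.closedBall (c i) (ρ i) ⊆ Metric.closedBall (c j) (5 * ρ j)}) ≤
      ENNReal.ofReal (10 * 6 ^ (d - 1)) * radialMeasure d (Metric.closedBall (c j) (ρ j)) := by
    intro j
    have hsub : c '' {i | Metric.closedBall (c i) (ρ i) ⊆ Metric.closedBall (c j) (5 * ρ j)} ⊆
        Icc (c j - 5 * ρ j) (c j + 5 * ρ j) := by
      rintro _ ⟨i, hi, rfl⟩
      rw [← Real.closedBall_eq_Icc]
      exact hi (Metric.mem_closedBall_self (hρ i).le)
    refine (measure_mono hsub).trans (le_trans ?_ (mul_le_mul_right (hlow j) _))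
    have h1 := hρ j
    have h2 := hρc j
    refine (radialMeasure_Icc_le d).trans ?_
    rw [← ENNReal.ofReal_mul (by linarith), ← ENNReal.ofReal_mul h1.le,
      ← ENNReal.ofReal_mul (by positivity)]
    refine ENNReal.ofReal_le_ofReal ?_
    have h2 : (c j + 5 * ρ j) ^ (d - 1) ≤ (6 * c j) ^ (d - 1) :=
      pow_le_pow_left₀ (by linarith) (by linarith) _
    rw [mul_pow] at h2
    nlinarith
  have hmean : ∀ g : ℝ → ℝ≥0∞, ∀ (i : ι) (t : ℝ), 0 < t → t ≤ c i / 2 → t ≤ ρ i → ρ i ≤ 2 * t →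
      radialMean d g (c i) t ≤
      ENNReal.ofReal (6 * 4 ^ (d - 1)) *
        lavg (radialMeasure d) g (Metric.closedBall (c i) (ρ i)) := by
    intro g i t ht htr hti hit
    set r := c i
    have hr : 0 < r := by linarith
    have hsub : Icc (r - t) (r + t) ⊆ Ioi 0 := fun s hs => by
      simp only [mem_Ioi]; linarith [hs.1]
    have hI : ∫⁻ s in Metric.closedBall r (ρ i), g s ∂(radialMeasure d) =
        lavg (radialMeasure d) g (Metric.closedBall r (ρ i)) *
          radialMeasure d (Metric.closedBall r (ρ i)) :=
      (ENNReal.div_mul_cancel (h0 i) (h1 i)).symm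
    calc radialMean d g r t ≤ ∫⁻ s in Icc (r - t) (r + t), ENNReal.ofReal
          (3 * 2 ^ (d - 1) / (2 * t * r ^ (d - 1))) * (ENNReal.ofReal (s ^ (d - 1)) * g s) := by
          rw [radialMean, abs_of_nonneg (by linarith)]
          refine (lintegral_mono_set Ioo_subset_Icc_self).trans ?_
          refine setLIntegral_mono' measurableSet_Icc fun s hs => ?_
          rw [← mul_assoc, ← ENNReal.ofReal_mul (by positivity)]
          refine mul_le_mul_left (ENNReal.ofReal_le_ofReal ?_) _
          have hs0 : 0 < s := hsub hs
          refine (kernel_le_div hr.le ht.le hs0.le).trans ?_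
          have e1 : s ≤ 3 / 2 * r := by linarith [hs.2]
          have e2 : r ^ (d - 1) ≤ 2 ^ (d - 1) * s ^ (d - 1) := by
            rw [← mul_pow]
            exact pow_le_pow_left₀ hr.le (by linarith [hs.1]) _
          calc s / (r * t) ≤ (3 / 2 * r) / (r * t) := by gcongr
            _ = 3 / (2 * t * r ^ (d - 1)) * r ^ (d - 1) := by field_simp
            _ ≤ 3 / (2 * t * r ^ (d - 1)) * (2 ^ (d - 1) * s ^ (d - 1)) := by gcongr
            _ = _ := by ring
      _ = ENNReal.ofReal (3 * 2 ^ (d - 1) / (2 * t * r ^ (d - 1))) *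
          ∫⁻ s in Icc (r - t) (r + t), g s ∂(radialMeasure d) := by
          rw [lintegral_const_mul' _ _ ENNReal.ofReal_ne_top,
            ← setLIntegral_radialMeasure d _ measurableSet_Icc hsub]
      _ ≤ ENNReal.ofReal (3 * 2 ^ (d - 1) / (2 * t * r ^ (d - 1))) *
          ∫⁻ s in Metric.closedBall r (ρ i), g s ∂(radialMeasure d) := by
          rw [← Real.closedBall_eq_Icc]
          gcongr
      _ ≤ ENNReal.ofReal (3 * 2 ^ (d - 1) / (2 * t * r ^ (d - 1))) *
          (lavg (radialMeasure d) g (Metric.closedBall r (ρ i)) *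
          ENNReal.ofReal (2 * (2 * t) * (2 * r) ^ (d - 1))) := by
          rw [hI]
          gcongr
          refine (hup i).trans (ENNReal.ofReal_le_ofReal ?_)
          gcongr
      _ = _ := by
          rw [mul_comm (lavg _ _ _), ← mul_assoc, ← ENNReal.ofReal_mul (by positivity)]
          congr 2
          rw [mul_pow, show (4 : ℝ) = 2 * 2 by norm_num, mul_pow]
          field_simp
          ring
  set A : ℝ≥0∞ := ENNReal.ofReal (6 * 4 ^ (d - 1)) ^ p
  have hA : A ≠ ∞ := ENNReal.rpow_ne_top_of_nonneg (by linarith) ENNReal.ofReal_ne_top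
  refine ⟨A * (ENNReal.ofReal (10 * 6 ^ (d - 1)) * ENNReal.ofReal (2 ^ p * (p / (p - 1)))),
    by finiteness, ?_⟩
  intro g hg hfin
  -- Dyadic radii make this a countable supremum, hence measurable; rounding `t` up to a power of 2
  -- costs only a constant.
  set M : ℝ → ℝ≥0∞ := fun r => ⨆ j : ℤ, (Ici ((2 : ℝ) ^ j)).indicator
    (fun r => lavg (radialMeasure d) g (Metric.closedBall r (2 ^ j))) r
  have hM : Measurable M := by
    refine Measurable.iSup fun j => Measurable.indicator ?_ measurableSet_Ici
    have h2 := measurable_setLIntegral_closedBall (μ := radialMeasure d) measurable_one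
      ((2 : ℝ) ^ j)
    simp only [Pi.one_apply, setLIntegral_one] at h2
    exact (measurable_setLIntegral_closedBall hg _).div h2
  refine ⟨fun r => A * M r ^ p, (hM.pow_const p).const_mul A, fun r t ht htr => ?_, ?_⟩
  · simp only [A]
    rw [← ENNReal.mul_rpow_of_nonneg _ _ (by linarith)]
    refine ENNReal.rpow_le_rpow ?_ (by linarith)
    obtain ⟨j, hj1, hj2⟩ := exists_mem_Ioc_zpow ht (by norm_num : (1 : ℝ) < 2)
    rw [zpow_add_one₀ (by norm_num)] at hj2
    have e1 : (2 : ℝ) ^ (j + 1) = 2 ^ j * 2 := zpow_add_one₀ (by norm_num) j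
    have hjr : (2 : ℝ) ^ (j + 1) ≤ r := by linarith
    refine (hmean g ⟨(r, j + 1), hjr⟩ t ht htr (by simp only [ρ]; linarith)
      (by simp only [ρ]; linarith)).trans ?_
    gcongr
    refine le_iSup_of_le (j + 1) ?_
    rw [indicator_of_mem (show r ∈ Ici ((2 : ℝ) ^ (j + 1)) from hjr)]
  · have key := lintegral_iSup_lavg_rpow_le (μ := radialMeasure d) (ν := radialMeasure d)
      c (c := c) (ρ := ρ) hρ h0 h1 hC hg hfin hp
    rw [lintegral_const_mul _ (hM.pow_const p), mul_assoc]
    gcongr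
    refine le_trans (lintegral_mono fun r => ?_) key
    refine ENNReal.rpow_le_rpow (iSup_le fun j => ?_) (by linarith)
    by_cases hj : r ∈ Ici ((2 : ℝ) ^ j)
    · rw [indicator_of_mem hj]
      exact le_iSup₂_of_le (f := fun (i : ι) (_ : c i = r) =>
        lavg (radialMeasure d) g (Metric.closedBall (c i) (ρ i))) ⟨(r, j), hj⟩ rfl le_rfl
    · rw [indicator_of_notMem hj]
      exact zero_le

/-- Hölder's inequality against the constant function. -/
lemma lintegral_rpow_le_measure_rpow_mul {α : Type*} [MeasurableSpace α] {μ : Measure α}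
    {g : α → ℝ≥0∞} (hg : AEMeasurable g μ) {p : ℝ} (hp : 1 < p) :
    (∫⁻ x, g x ∂μ) ^ p ≤ μ univ ^ (p - 1) * ∫⁻ x, g x ^ p ∂μ := by
  have hpq : p.HolderConjugate (p / (p - 1)) := Real.HolderConjugate.conjExponent hp
  have h := ENNReal.lintegral_mul_le_Lp_mul_Lq μ hpq hg (aemeasurable_const (b := (1 : ℝ≥0∞)))
  have hp0 : 0 < p := by linarith
  have h2 := ENNReal.rpow_le_rpow h hp0.le
  rw [ENNReal.mul_rpow_of_nonneg _ _ hp0.le, ← ENNReal.rpow_mul, ← ENNReal.rpow_mul,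
    one_div_mul_cancel hp0.ne', ENNReal.rpow_one, mul_comm] at h2
  have h3 : (p - 1) / p * p = p - 1 := div_mul_cancel₀ _ hp0.ne'
  simpa [h3, mul_comm] using h2

/-- Radii much larger than the distance to the origin. -/
lemma lintegral_radialMean_large {d : ℕ} (hd : 3 ≤ d) {p : ℝ} (hp : 1 < p) :
    ∃ C : ℝ≥0∞, C ≠ ∞ ∧ ∀ g : ℝ → ℝ≥0∞, Measurable g →
      ∃ H : ℝ → ℝ≥0∞, Measurable H ∧
        (∀ r t, 0 < r → 2 * r ≤ t → radialMean d g r t ^ p ≤ H r) ∧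
        ∫⁻ r, H r ∂(radialMeasure d) ≤ C * ∫⁻ s, g s ^ p ∂(radialMeasure d) := by
  have hp0 : 0 < p := by linarith
  refine ⟨ENNReal.ofReal (2 ^ p * 2 ^ (p - 1)), ENNReal.ofReal_ne_top, fun g hg => ?_⟩
  -- For `t ≥ 2r` the kernel is at most `2/r` on an interval of length `2r` inside `(r, ∞)`. Hölder
  -- then gives a bound independent of `t`, and Tonelli finishes because the integral of `r^(d-2)`
  -- over `(0, s)` is at most `s^(d-1)`.
  have hpt : ∀ r t : ℝ, 0 < r → 2 * r ≤ t → radialMean d g r t ^ p ≤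
      ENNReal.ofReal (2 ^ p * 2 ^ (p - 1)) *
        (ENNReal.ofReal r⁻¹ * ∫⁻ s in Ioi r, g s ^ p) := by
    intro r t hr ht
    have hle : radialMean d g r t ≤ ENNReal.ofReal (2 / r) * ∫⁻ s in Ioo |r - t| (r + t), g s := by
      rw [radialMean, ← lintegral_const_mul' _ _ ENNReal.ofReal_ne_top]
      refine setLIntegral_mono' measurableSet_Ioo fun s hs => ?_
      refine mul_le_mul_left (ENNReal.ofReal_le_ofReal ?_) _
      have hs0 : 0 ≤ s := (abs_nonneg _).trans hs.1.le
      refine (kernel_le_div hr.le (by linarith) hs0).trans ?_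
      rw [div_le_div_iff₀ (mul_pos hr (by linarith)) hr]
      have := hs.2
      nlinarith [mul_pos hr (show 0 < t by linarith)]
    have hsub : Ioo |r - t| (r + t) ⊆ Ioi r := fun s hs => by
      have h1 := hs.1
      rw [abs_sub_comm, abs_of_nonneg (by linarith)] at h1
      simp only [mem_Ioi]; linarith
    have hvol : volume.restrict (Ioo |r - t| (r + t)) univ = ENNReal.ofReal (2 * r) := by
      rw [Measure.restrict_apply_univ, Real.volume_Ioo, abs_sub_comm, abs_of_nonneg (by linarith)]
      congr 1; ring
    calc radialMean d g r t ^ p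
        ≤ (ENNReal.ofReal (2 / r) * ∫⁻ s in Ioo |r - t| (r + t), g s) ^ p :=
          ENNReal.rpow_le_rpow hle hp0.le
      _ ≤ ENNReal.ofReal (2 / r) ^ p * (ENNReal.ofReal (2 * r) ^ (p - 1) *
            ∫⁻ s in Ioo |r - t| (r + t), g s ^ p) := by
          rw [ENNReal.mul_rpow_of_nonneg _ _ hp0.le]
          gcongr
          have := lintegral_rpow_le_measure_rpow_mul
            (μ := volume.restrict (Ioo |r - t| (r + t))) hg.aemeasurable hp
          rwa [hvol] at this
      _ ≤ ENNReal.ofReal (2 / r) ^ p * (ENNReal.ofReal (2 * r) ^ (p - 1) *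
            ∫⁻ s in Ioi r, g s ^ p) := by
          gcongr
      _ = _ := by
          rw [← mul_assoc, ← mul_assoc, ENNReal.ofReal_rpow_of_pos (by positivity),
            ENNReal.ofReal_rpow_of_pos (by positivity), ← ENNReal.ofReal_mul (by positivity),
            ← ENNReal.ofReal_mul (by positivity)]
          congr 2
          rw [Real.div_rpow (by norm_num) hr.le, Real.mul_rpow (by norm_num) hr.le,
            Real.rpow_sub_one hr.ne']
          have := Real.rpow_pos_of_pos hr p
          field_simp
  have hmeas : Measurable (Function.uncurry fun r s : ℝ => ENNReal.ofReal (r ^ (d - 2)) *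
      (Ioi r).indicator (fun s => g s ^ p) s) := by
    have : (Function.uncurry fun r s : ℝ => ENNReal.ofReal (r ^ (d - 2)) *
        (Ioi r).indicator (fun s => g s ^ p) s) = fun z => ENNReal.ofReal (z.1 ^ (d - 2)) *
          {z : ℝ × ℝ | z.1 < z.2}.indicator (fun z => g z.2 ^ p) z := by
      ext ⟨r, s⟩; rfl
    rw [this]
    refine Measurable.mul (by fun_prop) (Measurable.indicator (by fun_prop) ?_)
    exact measurableSet_lt measurable_fst measurable_snd
  have hd2 : d - 1 = d - 2 + 1 := by omega
  have hmeas' : Measurable fun r => ∫⁻ s in Ioi r, g s ^ p := by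
    have h : Measurable (Function.uncurry fun r s : ℝ => (Ioi r).indicator (fun s => g s ^ p) s) := by
      have : (Function.uncurry fun r s : ℝ => (Ioi r).indicator (fun s => g s ^ p) s) =
          {z : ℝ × ℝ | z.1 < z.2}.indicator (fun z => g z.2 ^ p) := by
        ext ⟨r, s⟩; rfl
      rw [this]
      refine Measurable.indicator (by fun_prop) ?_
      exact measurableSet_lt measurable_fst measurable_snd
    simpa only [lintegral_indicator measurableSet_Ioi] using h.lintegral_prod_right (ν := volume)
  refine ⟨fun r => ENNReal.ofReal (2 ^ p * 2 ^ (p - 1)) *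
    (ENNReal.ofReal r⁻¹ * ∫⁻ s in Ioi r, g s ^ p),
    Measurable.const_mul (Measurable.mul (by fun_prop) hmeas') _, hpt, ?_⟩
  calc ∫⁻ r, ENNReal.ofReal (2 ^ p * 2 ^ (p - 1)) *
        (ENNReal.ofReal r⁻¹ * ∫⁻ s in Ioi r, g s ^ p) ∂(radialMeasure d)
      ≤ ∫⁻ r in Ioi (0 : ℝ), ENNReal.ofReal (2 ^ p * 2 ^ (p - 1)) *
        ∫⁻ s in Ioi (0 : ℝ), ENNReal.ofReal (r ^ (d - 2)) *
          (Ioi r).indicator (fun s => g s ^ p) s := by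
        rw [lintegral_radialMeasure']
        refine setLIntegral_mono' measurableSet_Ioi fun r (hr : 0 < r) => ?_
        refine le_of_eq ?_
        rw [lintegral_const_mul' _ _ ENNReal.ofReal_ne_top, lintegral_indicator measurableSet_Ioi,
          Measure.restrict_restrict measurableSet_Ioi, inter_eq_left.2 (Ioi_subset_Ioi hr.le),
          mul_left_comm, ← mul_assoc (ENNReal.ofReal (r ^ (d - 1))),
          ← ENNReal.ofReal_mul (by positivity), hd2, pow_succ, mul_assoc (r ^ (d - 2)),
          mul_inv_cancel₀ hr.ne', mul_one]
    _ = ENNReal.ofReal (2 ^ p * 2 ^ (p - 1)) * ∫⁻ s in Ioi (0 : ℝ), ∫⁻ r in Ioi (0 : ℝ),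
          ENNReal.ofReal (r ^ (d - 2)) * (Ioi r).indicator (fun s => g s ^ p) s := by
        rw [lintegral_const_mul' _ _ ENNReal.ofReal_ne_top,
          lintegral_lintegral_swap hmeas.aemeasurable]
    _ ≤ _ := by
        rw [lintegral_radialMeasure']
        gcongr ENNReal.ofReal (2 ^ p * 2 ^ (p - 1)) * ?_
        refine setLIntegral_mono' measurableSet_Ioi fun s (hs : 0 < s) => ?_
        calc ∫⁻ r in Ioi (0 : ℝ), ENNReal.ofReal (r ^ (d - 2)) *
              (Ioi r).indicator (fun s => g s ^ p) s
            = ∫⁻ r in Ioi (0 : ℝ), (Iio s).indicator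
              (fun r => ENNReal.ofReal (r ^ (d - 2)) * g s ^ p) r := by
              congr 1
              ext r
              by_cases h : r < s <;> simp [indicator, h]
          _ = ∫⁻ r in Ioo 0 s, ENNReal.ofReal (r ^ (d - 2)) * g s ^ p := by
              rw [lintegral_indicator measurableSet_Iio, Measure.restrict_restrict
                measurableSet_Iio, inter_comm, Ioi_inter_Iio]
          _ ≤ ∫⁻ r in Ioo 0 s, ENNReal.ofReal (s ^ (d - 2)) * g s ^ p := by
              refine setLIntegral_mono' measurableSet_Ioo fun r hr => ?_
              gcongr
              · exact hr.1.le
              · exact hr.2.le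
          _ = _ := by
              rw [setLIntegral_const, Real.volume_Ioo, sub_zero, mul_right_comm,
                ← ENNReal.ofReal_mul (by positivity), hd2, pow_succ]

/-! ### The Carleson embedding on the integers -/

/-- A discrete Carleson embedding theorem for sums over integer intervals. -/
lemma tsum_mul_rpow_sum_Icc_le {p : ℝ} (hp : 1 < p) {w : ℤ × ℕ → ℝ≥0∞} {K : ℝ≥0∞}
    (hw : ∀ (k₀ : ℤ) (L : ℕ), 1 ≤ L → ∑ k ∈ Finset.Icc (k₀ - L) (k₀ + L),
      ∑ n ∈ Finset.range (L + 1), w (k, n) * (2 * n + 5 : ℝ≥0∞) ^ p ≤ K * L)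
    {G : ℤ → ℝ≥0∞} (hG : ∀ j, G j ≠ ∞) :
    ∑' z : ℤ × ℕ, w z * (∑ j ∈ Finset.Icc (z.1 - (z.2 + 2 : ℕ)) (z.1 + (z.2 + 2 : ℕ)), G j) ^ p ≤
      K * ENNReal.ofReal (5 * (2 ^ p * (p / (p - 1)))) * ∑' j, G j ^ p := by
  have hp0 : 0 < p := by linarith
  set B : ℤ × ℕ → Set ℤ := fun z => Metric.closedBall z.1 ((z.2 + 2 : ℕ) : ℝ)
  have hB : ∀ (k : ℤ) (n : ℕ), Metric.closedBall k ((n : ℕ) : ℝ) =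
      (Finset.Icc (k - n) (k + n) : Finset ℤ) := by
    intro k n
    rw [Int.closedBall_eq_Icc, Finset.coe_Icc]
    congr 1
    · rw [show ((k : ℝ) - n) = ((k - n : ℤ) : ℝ) by push_cast; ring, Int.ceil_intCast]
    · rw [show ((k : ℝ) + n) = ((k + n : ℤ) : ℝ) by push_cast; ring, Int.floor_intCast]
  have hcard : ∀ (k : ℤ) (n : ℕ), (Finset.Icc (k - n) (k + n)).card = 2 * n + 1 := by
    intro k n; rw [Int.card_Icc]; omega
  have hcount : ∀ z, (Measure.count : Measure ℤ) (B z) = 2 * z.2 + 5 := by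
    intro z
    simp only [B]
    rw [hB, Measure.count_apply_finset, hcard]
    push_cast; ring
  -- The ball of radius `n + 2` contains `2n + 5` integers. Moving this factor into the measure
  -- turns the sums into averages.
  set v : ℤ × ℕ → ℝ≥0∞ := fun z => w z * (2 * z.2 + 5 : ℝ≥0∞) ^ p
  set ν : Measure (ℤ × ℕ) := Measure.count.withDensity v
  have hvm : Measurable v := measurable_of_countable v
  have hC : ∀ z : ℤ × ℕ, ν ((id : ℤ × ℕ → ℤ × ℕ) '' {i | Metric.closedBall i.1 ((i.2 + 2 : ℕ) : ℝ) ⊆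
      Metric.closedBall z.1 (5 * ((z.2 + 2 : ℕ) : ℝ))}) ≤
      5 * K * (Measure.count : Measure ℤ) (Metric.closedBall z.1 ((z.2 + 2 : ℕ) : ℝ)) := by
    intro z
    -- A ball inside the fivefold ball has its centre within `L` of `z.1` and radius at most `L`, so
    -- its index lies in the box of the hypothesis.
    set L : ℕ := 5 * (z.2 + 2)
    have hL : (5 * ((z.2 + 2 : ℕ) : ℝ)) = (L : ℝ) := by simp [L]
    have hsub : ((id : ℤ × ℕ → ℤ × ℕ) '' {i | Metric.closedBall i.1 ((i.2 + 2 : ℕ) : ℝ) ⊆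
      Metric.closedBall z.1 (5 * ((z.2 + 2 : ℕ) : ℝ))}) ⊆
        ((Finset.Icc (z.1 - L) (z.1 + L)) ×ˢ Finset.range (L + 1) : Finset (ℤ × ℕ)) := by
      rintro _ ⟨⟨k, n⟩, hi, rfl⟩
      simp only [mem_ofPred_eq] at hi
      rw [hL, hB, hB, Finset.coe_Icc, Finset.coe_Icc] at hi
      have h1 := hi (show k + ((n + 2 : ℕ) : ℤ) ∈ Icc _ _ from ⟨by omega, le_rfl⟩)
      have h2 := hi (show k - ((n + 2 : ℕ) : ℤ) ∈ Icc _ _ from ⟨le_rfl, by omega⟩)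
      simp only [mem_Icc] at h1 h2
      simp only [id, Finset.coe_product, mem_prod, Finset.coe_Icc, mem_Icc, Finset.coe_range,
        mem_Iio]
      omega
    calc _ ≤ ν ((Finset.Icc (z.1 - L) (z.1 + L)) ×ˢ Finset.range (L + 1) : Finset (ℤ × ℕ)) :=
          measure_mono hsub
      _ = ∑ k ∈ Finset.Icc (z.1 - L) (z.1 + L), ∑ n ∈ Finset.range (L + 1),
            w (k, n) * (2 * n + 5 : ℝ≥0∞) ^ p := by
          rw [← Finset.sum_product', withDensity_apply _ (Finset.measurableSet _),
            lintegral_finset]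
          simp [v]
      _ ≤ K * L := hw _ _ (by omega)
      _ ≤ _ := by
          have := hcount z
          simp only [B] at this
          rw [this, mul_comm 5 K, mul_assoc]
          gcongr
          simp only [L]
          norm_cast
          omega
  have key := lintegral_iSup_lavg_rpow_le (μ := (Measure.count : Measure ℤ)) (ν := ν)
    (c := fun z : ℤ × ℕ => z.1) (ρ := fun z => ((z.2 + 2 : ℕ) : ℝ)) id (fun z => by positivity)
    (fun z => by
      have := hcount z
      simp only [B] at this
      rw [this]; simp)
    (fun z => by
      have := hcount z
      simp only [B] at this
      rw [this]; finiteness) hC (g := G) (measurable_of_countable G) hG hp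
  have hl : ∀ z : ℤ × ℕ, (⨆ (i : ℤ × ℕ) (_ : id i = z), lavg (Measure.count : Measure ℤ) G
      (Metric.closedBall i.1 ((i.2 + 2 : ℕ) : ℝ))) =
      (∑ j ∈ Finset.Icc (z.1 - (z.2 + 2 : ℕ)) (z.1 + (z.2 + 2 : ℕ)), G j) / (2 * z.2 + 5) := by
    intro z
    simp only [id, iSup_iSup_eq_left]
    have := hcount z
    simp only [B] at this
    rw [lavg, this, hB, lintegral_finset]
    simp
  simp only [hl] at key
  rw [lintegral_withDensity_eq_lintegral_mul _ hvm (measurable_of_countable _), lintegral_count,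
    lintegral_count] at key
  calc _ = ∑' z : ℤ × ℕ, (v * fun z : ℤ × ℕ => ((∑ j ∈ Finset.Icc (z.1 - (z.2 + 2 : ℕ))
        (z.1 + (z.2 + 2 : ℕ)), G j) / (2 * z.2 + 5)) ^ p) z := by
        congr 1
        ext z
        simp only [v, Pi.mul_apply]
        rw [mul_assoc, ← ENNReal.mul_rpow_of_nonneg _ _ hp0.le, ENNReal.mul_div_cancel]
        · simp
        · finiteness
    _ ≤ _ := key
    _ = _ := by
        rw [ENNReal.ofReal_mul (by norm_num : (0:ℝ) ≤ 5)]
        simp only [ENNReal.ofReal_ofNat]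
        ring

/-! ### Entropy numbers and neighbourhoods of E -/

lemma exists_finset_of_entropyNumber_ne_top {A : Set ℝ} {a : ℝ} (h : entropyNumber A a ≠ ⊤) :
    ∃ s : Finset ℝ, A ⊆ ⋃ c ∈ s, Icc c (c + a) ∧ (s.card : ℕ∞) ≤ entropyNumber A a := by
  have h1 : entropyNumber A a < entropyNumber A a + 1 := ENat.lt_add_one_iff h |>.2 le_rfl
  conv_lhs at h1 => unfold entropyNumber
  simp only [iInf_lt_iff] at h1
  obtain ⟨s, hs, hlt⟩ := h1
  exact ⟨s, hs, (ENat.lt_add_one_iff h).1 hlt⟩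

/-- The measure of a neighborhood is controlled by the entropy number. -/
lemma volume_thickening_le (A : Set ℝ) {a h : ℝ} (ha : 0 < a) (hh : 0 < h) :
    volume (⋃ t ∈ A, Metric.ball t h) ≤
      (entropyNumber A a : ℝ≥0∞) * ENNReal.ofReal (a + 2 * h) := by
  by_cases htop : entropyNumber A a = ⊤
  · rw [htop, ENat.toENNReal_top, ENNReal.top_mul]
    · exact le_top
    · simp; positivity
  obtain ⟨s, hs, hcard⟩ := exists_finset_of_entropyNumber_ne_top htop
  have hsub : (⋃ t ∈ A, Metric.ball t h) ⊆ ⋃ c ∈ s, Icc (c - h) (c + a + h) := by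
    intro r hr
    simp only [mem_iUnion, exists_prop] at hr
    obtain ⟨t, ht, hrt⟩ := hr
    have := hs ht
    simp only [mem_iUnion, exists_prop] at this ⊢
    obtain ⟨c, hc, htc⟩ := this
    rw [Metric.mem_ball, Real.dist_eq, abs_lt] at hrt
    exact ⟨c, hc, by linarith [htc.1], by linarith [htc.2]⟩
  calc volume (⋃ t ∈ A, Metric.ball t h) ≤ ∑ c ∈ s, volume (Icc (c - h) (c + a + h)) :=
        (measure_mono hsub).trans (measure_biUnion_finset_le _ _)
    _ = s.card * ENNReal.ofReal (a + 2 * h) := by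
        rw [Finset.sum_congr rfl (g := fun _ => ENNReal.ofReal (a + 2 * h))]
        · simp
        · intro c _
          rw [Real.volume_Icc]; congr 1; ring
    _ ≤ _ := by
        gcongr
        have := ENat.toENNReal_le.2 hcard
        simpa using this

/-- The dyadic interval `[2^k, 2^{k+1})`. -/
def dyadicIco (k : ℤ) : Set ℝ := Ico ((2 : ℝ) ^ k) ((2 : ℝ) ^ (k + 1))

lemma measurableSet_dyadicIco (k : ℤ) : MeasurableSet (dyadicIco k) := measurableSet_Ico

lemma mem_dyadicIco_pos {k : ℤ} {r : ℝ} (h : r ∈ dyadicIco k) : 0 < r :=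
  lt_of_lt_of_le (by positivity) h.1

lemma volume_dyadicIco (k : ℤ) : volume (dyadicIco k) = ENNReal.ofReal (2 ^ k) := by
  rw [dyadicIco, Real.volume_Ico]
  congr 1
  rw [zpow_add_one₀ (by norm_num)]
  ring

lemma exists_mem_dyadicIco {r : ℝ} (hr : 0 < r) : ∃ k, r ∈ dyadicIco k := by
  obtain ⟨k, hk⟩ := exists_mem_Ico_zpow hr (by norm_num : (1 : ℝ) < 2)
  exact ⟨k, hk⟩

lemma iUnion_dyadicIco : ⋃ k, dyadicIco k = Ioi 0 := by
  ext r
  simp only [mem_iUnion, mem_Ioi]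
  exact ⟨fun ⟨k, hk⟩ => mem_dyadicIco_pos hk, exists_mem_dyadicIco⟩

lemma pairwise_disjoint_dyadicIco : Pairwise (Function.onFun Disjoint dyadicIco) := by
  have h : Monotone fun k : ℤ => (2 : ℝ) ^ k := fun a b hab =>
    zpow_le_zpow_right₀ (by norm_num) hab
  exact h.pairwise_disjoint_on_Ico_succ

/-- The set of points in a dyadic interval which are close to `E`. -/
def nearSet (E : Set ℝ) (k : ℤ) : ℕ → Set ℝ
  | 0 => dyadicIco k
  | n + 1 => dyadicIco k ∩ ⋃ t ∈ E ∩ Ioo ((2 : ℝ) ^ (k - 1)) (2 ^ (k + 2)),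
      Metric.ball t (2 ^ (k - n))

lemma measurableSet_nearSet (E : Set ℝ) (k : ℤ) (n : ℕ) : MeasurableSet (nearSet E k n) := by
  cases n with
  | zero => exact measurableSet_dyadicIco k
  | succ n =>
    refine (measurableSet_dyadicIco k).inter (IsOpen.measurableSet ?_)
    exact isOpen_biUnion fun t _ => Metric.isOpen_ball

lemma nearSet_succ_subset (E : Set ℝ) (k : ℤ) (n : ℕ) : nearSet E k (n + 1) ⊆ nearSet E k n := by
  cases n with
  | zero => exact inter_subset_left
  | succ n =>
    refine inter_subset_inter_right _ (iUnion₂_mono fun t _ => Metric.ball_subset_ball ?_)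
    exact zpow_le_zpow_right₀ (by norm_num) (by push_cast; omega)

lemma nearSet_antitone (E : Set ℝ) (k : ℤ) : Antitone (nearSet E k) :=
  antitone_nat_of_succ_le (nearSet_succ_subset E k)

lemma nearSet_subset (E : Set ℝ) (k : ℤ) (n : ℕ) : nearSet E k n ⊆ dyadicIco k :=
  nearSet_antitone E k (Nat.zero_le n)

/-- The weights of the entropy measure, indexed by natural numbers. -/
def natWeight (d : ℕ) (E : Set ℝ) (k : ℤ) (n : ℕ) : ℝ≥0∞ :=
  (entropyNumber (dyadicPiece E k) ((2 : ℝ) ^ (k - (n : ℤ))) : ℝ≥0∞) *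
    ENNReal.ofReal ((2 : ℝ) ^ (-(n : ℤ)) * (n : ℝ) ^ (1 / ((d : ℝ) - 1)))

/-- Radii between `2^(k-1)` and `2^(k+2)` lie in three dyadic pieces, whence the three weights. With
`m = n + 1` the thickening `h` is `2 * 2^(k-m)`, and each covering interval grows to length at most
`3h = 6 * 2^k * 2^(-m)`. -/
lemma mul_volume_nearSet_le (d : ℕ) (E : Set ℝ) (k : ℤ) {m : ℕ} (hm : 1 ≤ m) :
    ENNReal.ofReal ((m : ℝ) ^ (1 / ((d : ℝ) - 1))) * volume (nearSet E k m) ≤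
      6 * ENNReal.ofReal (2 ^ k) *
        (natWeight d E (k - 1) m + natWeight d E k m + natWeight d E (k + 1) m) := by
  obtain ⟨n, rfl⟩ : ∃ n, m = n + 1 := ⟨m - 1, by omega⟩
  set c : ℝ := ((n + 1 : ℕ) : ℝ) ^ (1 / ((d : ℝ) - 1))
  have hc : 0 ≤ c := by positivity
  set h : ℝ := 2 ^ (k - n)
  have hh : 0 < h := by positivity
  have one : ∀ j : ℤ, j ≤ k + 1 →
      ENNReal.ofReal c * volume (⋃ t ∈ dyadicPiece E j, Metric.ball t h) ≤
      6 * ENNReal.ofReal (2 ^ k) * natWeight d E j (n + 1) := by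
    intro j hj
    have ha : (2 : ℝ) ^ (j - (n + 1 : ℕ)) ≤ h :=
      zpow_le_zpow_right₀ (by norm_num) (by push_cast; omega)
    calc _ ≤ ENNReal.ofReal c * ((entropyNumber (dyadicPiece E j) (2 ^ (j - (n + 1 : ℕ))) : ℝ≥0∞) *
          ENNReal.ofReal (2 ^ (j - (n + 1 : ℕ)) + 2 * h)) := by
          gcongr
          exact volume_thickening_le _ (by positivity) hh
      _ ≤ ENNReal.ofReal c * ((entropyNumber (dyadicPiece E j) (2 ^ (j - (n + 1 : ℕ))) : ℝ≥0∞) *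
          ENNReal.ofReal (3 * h)) := by
          gcongr
          linarith
      _ = _ := by
          rw [natWeight]
          have : 3 * h = 6 * 2 ^ k * 2 ^ (-((n + 1 : ℕ) : ℤ)) := by
            simp only [h]
            rw [zpow_sub₀ (by norm_num), zpow_neg, zpow_natCast, zpow_natCast, pow_succ]
            field_simp
            norm_num
          rw [this, ENNReal.ofReal_mul (by positivity), ENNReal.ofReal_mul (by positivity),
            ENNReal.ofReal_mul (by positivity), ENNReal.ofReal_ofNat]
          ring
  have hsub : nearSet E k (n + 1) ⊆ ((⋃ t ∈ dyadicPiece E (k - 1), Metric.ball t h) ∪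
      ⋃ t ∈ dyadicPiece E k, Metric.ball t h) ∪ ⋃ t ∈ dyadicPiece E (k + 1), Metric.ball t h := by
    rintro r ⟨_, hr⟩
    simp only [mem_iUnion, exists_prop, mem_union] at hr ⊢
    obtain ⟨t, ⟨htE, ht1, ht2⟩, htr⟩ := hr
    rcases le_total t (2 ^ k) with h1 | h1
    · exact Or.inl (Or.inl ⟨t, ⟨⟨ht1.le, by simpa using h1⟩, htE⟩, htr⟩)
    rcases le_total t (2 ^ (k + 1)) with h2 | h2
    · exact Or.inl (Or.inr ⟨t, ⟨⟨h1, h2⟩, htE⟩, htr⟩)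
    · exact Or.inr ⟨t, ⟨⟨h2, by rw [add_assoc]; exact ht2.le⟩, htE⟩, htr⟩
  calc _ ≤ ENNReal.ofReal c * (volume (⋃ t ∈ dyadicPiece E (k - 1), Metric.ball t h) +
        volume (⋃ t ∈ dyadicPiece E k, Metric.ball t h) +
        volume (⋃ t ∈ dyadicPiece E (k + 1), Metric.ball t h)) := by
        gcongr
        refine (measure_mono hsub).trans ((measure_union_le _ _).trans ?_)
        gcongr
        exact measure_union_le _ _
    _ ≤ _ := by
        rw [mul_add, mul_add, mul_add, mul_add]
        exact add_le_add (add_le_add (one _ (by omega)) (one _ (by omega))) (one _ (by omega))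

/-- Finite sums over boxes are controlled by the Carleson supremum. -/
lemma sum_natWeight_le (d : ℕ) (E : Set ℝ) (k₀ : ℤ) {M L : ℕ} (hM : 1 ≤ M) (hL : L ≤ 2 * M) :
    ∑ k ∈ Finset.Icc (k₀ - M) (k₀ + M), ∑ m ∈ Finset.range L, natWeight d E k (m + 1) ≤
      carlesonSup d E * (2 * M) := by
  -- The interval has length `2M`, and `L ≤ 2M` puts the whole box inside its tent.
  set a : ℝ := k₀ - M
  set b : ℝ := k₀ + M
  have hM' : (1 : ℝ) ≤ M := by exact_mod_cast hM
  have hab : b - a = 2 * M := by simp only [a, b]; ring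
  have hsup : (∑' q : {q : ℤ × ℕ+ // ((q.1 : ℝ), ((q.2 : ℕ) : ℝ)) ∈ tent a b},
      weight d E q.1.1 q.1.2) / ENNReal.ofReal (b - a) ≤ carlesonSup d E := by
    unfold carlesonSup
    exact le_iSup_of_le a (le_iSup₂_of_le (f := fun (b : ℝ) (_ : 1 ≤ b - a) =>
      (∑' q : {q : ℤ × ℕ+ // ((q.1 : ℝ), ((q.2 : ℕ) : ℝ)) ∈ tent a b},
        weight d E q.1.1 q.1.2) / ENNReal.ofReal (b - a)) b (by linarith) le_rfl)
  rw [ENNReal.div_le_iff (by simp [hab]; omega) ENNReal.ofReal_ne_top] at hsup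
  have h2 : ENNReal.ofReal (b - a) = 2 * M := by
    rw [hab, ENNReal.ofReal_mul (by norm_num)]; simp
  rw [h2] at hsup
  refine le_trans ?_ hsup
  set e : ℤ × ℕ ↪ ℤ × ℕ+ := ⟨fun q => (q.1, q.2.succPNat), fun q q' h => by
    simp only [Prod.mk.injEq] at h
    exact Prod.ext h.1 (Nat.succPNat_injective h.2)⟩
  set P : Set (ℤ × ℕ+) := {q | ((q.1 : ℝ), ((q.2 : ℕ) : ℝ)) ∈ tent a b}
  have h3 : ∑' q : {q : ℤ × ℕ+ // ((q.1 : ℝ), ((q.2 : ℕ) : ℝ)) ∈ tent a b},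
      weight d E q.1.1 q.1.2 = ∑' q, P.indicator (fun q => weight d E q.1 q.2) q :=
    tsum_subtype P (fun q => weight d E q.1 q.2)
  rw [h3]
  refine le_trans (le_of_eq ?_) (ENNReal.sum_le_tsum
    ((Finset.Icc (k₀ - M) (k₀ + M) ×ˢ Finset.range L).map e))
  rw [Finset.sum_map, Finset.sum_product]
  refine Finset.sum_congr rfl fun k hk => Finset.sum_congr rfl fun m hm => ?_
  rw [Finset.mem_Icc] at hk
  rw [Finset.mem_range] at hm
  have hmem : e (k, m) ∈ P := by
    have h1 : ((k₀ - M : ℤ) : ℝ) ≤ (k : ℝ) := by exact_mod_cast hk.1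
    have h2 : (k : ℝ) ≤ ((k₀ + M : ℤ) : ℝ) := by exact_mod_cast hk.2
    have h3 : ((m + 1 : ℕ) : ℝ) ≤ ((2 * M : ℕ) : ℝ) := by exact_mod_cast (by omega)
    push_cast at h1 h2 h3
    refine ⟨⟨h1, h2⟩, ?_, ?_⟩
    · exact Nat.cast_nonneg _
    · rw [hab]
      exact (by push_cast; exact h3 : ((m + 1 : ℕ) : ℝ) ≤ 2 * M)
  rw [indicator_of_mem hmem]
  rfl

/-- Bernoulli's inequality bounds the increment `(n+1)^p - n^p` by `p (n+1)^(p-1)`. This is where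
the exponent `p - 1 = 1/(d-1)` of the weight comes from. -/
lemma rpow_le_mul_sum_rpow {p : ℝ} (hp : 1 ≤ p) (n : ℕ) :
    (n : ℝ) ^ p ≤ p * ∑ m ∈ Finset.range n, ((m + 1 : ℕ) : ℝ) ^ (p - 1) := by
  induction n with
  | zero => simp [Real.zero_rpow (by linarith : p ≠ 0)]
  | succ n ih =>
    rw [Finset.sum_range_succ, mul_add]
    have hn : (0 : ℝ) < ((n + 1 : ℕ) : ℝ) := by positivity
    have hb := one_add_mul_self_le_rpow_one_add (s := -1 / ((n + 1 : ℕ) : ℝ)) (p := p) (by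
      rw [le_div_iff₀ hn]; push_cast; linarith [n.cast_nonneg (α := ℝ)]) hp
    have e1 : 1 + -1 / ((n + 1 : ℕ) : ℝ) = n / ((n + 1 : ℕ) : ℝ) := by
      field_simp; push_cast; ring
    rw [e1, Real.div_rpow (by positivity) hn.le, le_div_iff₀ (by positivity)] at hb
    rw [Real.rpow_sub_one hn.ne']
    have e2 : (1 + p * (-1 / ((n + 1 : ℕ) : ℝ))) * ((n + 1 : ℕ) : ℝ) ^ p =
        ((n + 1 : ℕ) : ℝ) ^ p - p * (((n + 1 : ℕ) : ℝ) ^ p / ((n + 1 : ℕ) : ℝ)) := by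
      field_simp; ring
    rw [e2] at hb
    linarith

/-- The neighbouring pieces `k ± 1` are absorbed by enlarging the box by one; `72` arises from `6 *
3 * 2(L+1) ≤ 72 L`. -/
lemma sum_mul_volume_nearSet_le (d : ℕ) (E : Set ℝ) (k₀ : ℤ) {L : ℕ} (hL : 1 ≤ L) :
    ∑ k ∈ Finset.Icc (k₀ - L) (k₀ + L), (ENNReal.ofReal (2 ^ k))⁻¹ *
      ∑ m ∈ Finset.range L, ENNReal.ofReal (((m + 1 : ℕ) : ℝ) ^ (1 / ((d : ℝ) - 1))) *
        volume (nearSet E k (m + 1)) ≤ 72 * carlesonSup d E * L := by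
  have hL' : (1 : ℝ≥0∞) ≤ L := by exact_mod_cast hL
  set S : ℤ → ℝ≥0∞ := fun k => ∑ m ∈ Finset.range L, natWeight d E k (m + 1)
  have hS : ∑ k ∈ Finset.Icc (k₀ - (L + 1 : ℕ)) (k₀ + (L + 1 : ℕ)), S k ≤
      carlesonSup d E * (2 * (L + 1 : ℕ)) := sum_natWeight_le d E k₀ (by omega) (by omega)
  have hshift : ∀ i : ℤ, -1 ≤ i → i ≤ 1 → ∑ k ∈ Finset.Icc (k₀ - L) (k₀ + L), S (k + i) ≤
      carlesonSup d E * (2 * (L + 1 : ℕ)) := by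
    intro i h1 h2
    refine le_trans ?_ hS
    calc _ = ∑ k ∈ (Finset.Icc (k₀ - L) (k₀ + L)).map (addRightEmbedding i), S k := by
          rw [Finset.sum_map]; rfl
      _ ≤ _ := by
          refine Finset.sum_le_sum_of_subset ?_
          rw [Finset.map_add_right_Icc]
          refine Finset.Icc_subset_Icc (by push_cast; omega) (by push_cast; omega)
  calc _ ≤ ∑ k ∈ Finset.Icc (k₀ - L) (k₀ + L), 6 * (S (k + -1) + S (k + 0) + S (k + 1)) := by
        refine Finset.sum_le_sum fun k _ => ?_
        have h0 : ENNReal.ofReal ((2 : ℝ) ^ k) ≠ 0 := by simp; positivity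
        calc _ ≤ (ENNReal.ofReal (2 ^ k))⁻¹ * ∑ m ∈ Finset.range L, 6 * ENNReal.ofReal (2 ^ k) *
              (natWeight d E (k - 1) (m + 1) + natWeight d E k (m + 1) +
                natWeight d E (k + 1) (m + 1)) := by
              refine mul_le_mul_right (Finset.sum_le_sum fun m _ => ?_) _
              exact mul_volume_nearSet_le d E k (by omega)
          _ = (ENNReal.ofReal (2 ^ k))⁻¹ * ENNReal.ofReal (2 ^ k) *
              (6 * (S (k + -1) + S (k + 0) + S (k + 1))) := by
              rw [← Finset.mul_sum, Finset.sum_add_distrib, Finset.sum_add_distrib]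
              simp only [S, add_zero, ← sub_eq_add_neg]
              ring
          _ = _ := by rw [ENNReal.inv_mul_cancel h0 ENNReal.ofReal_ne_top, one_mul]
    _ ≤ 6 * (carlesonSup d E * (2 * (L + 1 : ℕ)) + carlesonSup d E * (2 * (L + 1 : ℕ)) +
          carlesonSup d E * (2 * (L + 1 : ℕ))) := by
        rw [← Finset.mul_sum, Finset.sum_add_distrib, Finset.sum_add_distrib]
        gcongr
        · exact hshift _ (by omega) (by omega)
        · exact hshift _ (by omega) (by omega)
        · exact hshift _ (by omega) (by omega)
    _ = 36 * carlesonSup d E * (L + 1) := by push_cast; ring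
    _ ≤ 36 * carlesonSup d E * (L + L) := by gcongr
    _ = _ := by ring

lemma exponent_sub_one {d : ℕ} (hd : 3 ≤ d) :
    (d : ℝ) / ((d : ℝ) - 1) - 1 = 1 / ((d : ℝ) - 1) := by
  have : (3 : ℝ) ≤ d := by exact_mod_cast hd
  have : (d : ℝ) - 1 ≠ 0 := by linarith
  field_simp
  ring

lemma one_lt_exponent {d : ℕ} (hd : 3 ≤ d) : 1 < (d : ℝ) / ((d : ℝ) - 1) := by
  have : (3 : ℝ) ≤ d := by exact_mod_cast hd
  rw [lt_div_iff₀ (by linarith)]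
  linarith

lemma closure_inter_dyadicIco_subset (E : Set ℝ) (k : ℤ) (m : ℕ) :
    closure E ∩ dyadicIco k ⊆ nearSet E k m := by
  rintro r ⟨hr, hrk⟩
  cases m with
  | zero => exact hrk
  | succ n =>
    have h1 : (0 : ℝ) < 2 ^ (k - 1) := by positivity
    -- The second bound keeps `t` in the window `(2^(k-1), 2^(k+2))` demanded by `nearSet`.
    obtain ⟨t, htE, ht⟩ := Metric.mem_closure_iff.1 hr (min (2 ^ (k - n)) (2 ^ (k - 1)))
      (by positivity)
    rw [lt_min_iff] at ht
    have e1 : (2 : ℝ) ^ k = 2 * 2 ^ (k - 1) := by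
      rw [← zpow_one_add₀ (by norm_num)]; congr 1; ring
    have e2 : (2 : ℝ) ^ (k + 1) = 4 * 2 ^ (k - 1) := by
      rw [zpow_add_one₀ (by norm_num), e1]; ring
    have e3 : (2 : ℝ) ^ (k + 2) = 8 * 2 ^ (k - 1) := by
      rw [show k + 2 = k + 1 + 1 by ring, zpow_add_one₀ (by norm_num), e2]; ring
    have h2 := ht.2
    rw [Real.dist_eq, abs_lt] at h2
    have h3 := hrk.1
    have h4 := hrk.2
    refine ⟨hrk, mem_biUnion (x := t) ⟨htE, ?_, ?_⟩ ?_⟩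
    · linarith
    · linarith
    · rw [Metric.mem_ball]; exact ht.1

/-- Under the Carleson condition the closure of `E` is a null set. -/
lemma volume_closure_eq_zero {d : ℕ} (hd : 3 ≤ d) {E : Set ℝ} (hE : E ⊆ Ioi 0)
    (hC : carlesonSup d E < ⊤) : volume (closure E) = 0 := by
  set q : ℝ := 1 / ((d : ℝ) - 1)
  have hd' : (3 : ℝ) ≤ d := by exact_mod_cast hd
  have hq : 0 < q := by
    have : 0 < (d : ℝ) - 1 := by linarith
    positivity
  have hsub : closure E ⊆ {0} ∪ ⋃ k, closure E ∩ dyadicIco k := by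
    intro r hr
    have h0 : 0 ≤ r := by
      have h1 : closure E ⊆ Ici 0 := by
        rw [← closure_Ioi]
        exact closure_mono hE
      exact h1 hr
    rcases h0.eq_or_lt with h1 | h1
    · exact Or.inl h1.symm
    · obtain ⟨k, hk⟩ := exists_mem_dyadicIco h1
      exact Or.inr (mem_iUnion.2 ⟨k, hr, hk⟩)
  refine measure_mono_null hsub (measure_union_null (by simp) (measure_iUnion_null fun k => ?_))
  by_contra hv
  set v := volume (closure E ∩ dyadicIco k)
  have h2k : ENNReal.ofReal ((2 : ℝ) ^ k) ≠ 0 := by simp; positivity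
  -- The part of `closure E` in a dyadic interval lies in every near set. Its measure `v` times the
  -- sum of `m^q` over `m ≤ L`, which is of order `L^(1+q)`, is therefore at most a constant times
  -- `L`. So `L^q` would stay bounded if `v` were positive.
  have key : ∀ L : ℕ, 1 ≤ L → ENNReal.ofReal ((L : ℝ) ^ q) ≤
      ENNReal.ofReal (1 + q) * (72 * carlesonSup d E) * ENNReal.ofReal (2 ^ k) / v := by
    intro L hL
    rw [ENNReal.le_div_iff_mul_le (Or.inl hv) (Or.inl ?_)]
    swap
    · refine ((measure_mono inter_subset_right).trans_lt ?_).ne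
      rw [volume_dyadicIco]; exact ENNReal.ofReal_lt_top
    have h1 := sum_mul_volume_nearSet_le d E k hL
    have h2 := (Finset.single_le_sum (f := fun k : ℤ => (ENNReal.ofReal (2 ^ k))⁻¹ *
      ∑ m ∈ Finset.range L, ENNReal.ofReal (((m + 1 : ℕ) : ℝ) ^ (1 / ((d : ℝ) - 1))) *
        volume (nearSet E k (m + 1))) (fun _ _ => zero_le) (Finset.mem_Icc.2
          (show k - (L : ℤ) ≤ k ∧ k ≤ k + L from ⟨by omega, by omega⟩))).trans h1
    have h3 : (ENNReal.ofReal (2 ^ k))⁻¹ *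
        ((∑ m ∈ Finset.range L, ENNReal.ofReal (((m + 1 : ℕ) : ℝ) ^ q)) * v) ≤
        72 * carlesonSup d E * L := by
      refine le_trans ?_ h2
      rw [Finset.sum_mul]
      gcongr with m _
      exact measure_mono (closure_inter_dyadicIco_subset E k (m + 1))
    have h4 := rpow_le_mul_sum_rpow (p := 1 + q) (by linarith) L
    rw [add_sub_cancel_left] at h4
    have h5 := ENNReal.ofReal_le_ofReal h4
    rw [ENNReal.ofReal_mul (by positivity), ENNReal.ofReal_sum_of_nonneg
      (fun m _ => by positivity), Real.rpow_add (by positivity), Real.rpow_one,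
      ENNReal.ofReal_mul (by positivity), ENNReal.ofReal_natCast] at h5
    have hL0 : (L : ℝ≥0∞) ≠ 0 := by simp; omega
    rw [← ENNReal.mul_le_mul_iff_right hL0 (by simp)]
    calc (L : ℝ≥0∞) * (ENNReal.ofReal ((L : ℝ) ^ q) * v)
        = (L * ENNReal.ofReal ((L : ℝ) ^ q)) * v := by ring
      _ ≤ ENNReal.ofReal (1 + q) *
          (∑ m ∈ Finset.range L, ENNReal.ofReal (((m + 1 : ℕ) : ℝ) ^ q)) * v := by gcongr
      _ = ENNReal.ofReal (1 + q) * ENNReal.ofReal (2 ^ k) * ((ENNReal.ofReal (2 ^ k))⁻¹ *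
          ((∑ m ∈ Finset.range L, ENNReal.ofReal (((m + 1 : ℕ) : ℝ) ^ q)) * v)) := by
          rw [mul_assoc (ENNReal.ofReal (1 + q)) (ENNReal.ofReal (2 ^ k)), ← mul_assoc
            (ENNReal.ofReal (2 ^ k)), ENNReal.mul_inv_cancel h2k ENNReal.ofReal_ne_top]
          ring
      _ ≤ ENNReal.ofReal (1 + q) * ENNReal.ofReal (2 ^ k) * (72 * carlesonSup d E * L) := by gcongr
      _ = _ := by ring
  have hfin : ENNReal.ofReal (1 + q) * (72 * carlesonSup d E) * ENNReal.ofReal (2 ^ k) / v ≠ ∞ := by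
    refine ENNReal.div_ne_top ?_ hv
    have := hC.ne
    finiteness
  obtain ⟨L, hL⟩ := exists_nat_gt (max 1 ((ENNReal.ofReal (1 + q) * (72 * carlesonSup d E) *
    ENNReal.ofReal (2 ^ k) / v).toReal ^ (1 / q)))
  rw [max_lt_iff] at hL
  have h1 := key L (by exact_mod_cast hL.1.le)
  rw [ENNReal.ofReal_le_iff_le_toReal hfin] at h1
  have h2 := Real.rpow_lt_rpow (by positivity) hL.2 hq
  rw [← Real.rpow_mul ENNReal.toReal_nonneg, one_div_mul_cancel hq.ne', Real.rpow_one] at h2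
  linarith

/-! ### Layers at a given distance from E and their Carleson condition -/

/-- The points of a dyadic interval at a given scale of distance from `E`. -/
def layer (E : Set ℝ) (k : ℤ) (n : ℕ) : Set ℝ := nearSet E k n \ nearSet E k (n + 1)

lemma measurableSet_layer (E : Set ℝ) (k : ℤ) (n : ℕ) : MeasurableSet (layer E k n) :=
  (measurableSet_nearSet E k n).diff (measurableSet_nearSet E k (n + 1))

lemma layer_subset (E : Set ℝ) (k : ℤ) (n : ℕ) : layer E k n ⊆ dyadicIco k :=
  sdiff_subset.trans (nearSet_subset E k n)

lemma disjoint_layer (E : Set ℝ) (k : ℤ) : Pairwise (Function.onFun Disjoint (layer E k)) := by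
  refine (pairwise_disjoint_on _).2 fun m n hmn => ?_
  refine disjoint_left.2 fun r hm hn => hm.2 ?_
  exact nearSet_antitone E k hmn hn.1

lemma sum_volume_layer_le (E : Set ℝ) (k : ℤ) (m : ℕ) (s : Finset ℕ) (hs : ∀ n ∈ s, m ≤ n) :
    ∑ n ∈ s, volume (layer E k n) ≤ volume (nearSet E k m) := by
  rw [← measure_biUnion_finset (fun i _ j _ hij => disjoint_layer E k hij)
    (fun n _ => measurableSet_layer E k n)]
  refine measure_mono (iUnion₂_subset fun n hn => ?_)
  exact sdiff_subset.trans (nearSet_antitone E k (hs n hn))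

lemma Ioi_diff_closure_subset (E : Set ℝ) :
    Ioi (0 : ℝ) \ closure E ⊆ ⋃ z : ℤ × ℕ, layer E z.1 z.2 := by
  rintro r ⟨hr, hrE⟩
  obtain ⟨k, hk⟩ := exists_mem_dyadicIco hr
  obtain ⟨ε, hε, hball⟩ := Metric.isOpen_iff.1 isClosed_closure.isOpen_compl r hrE
  obtain ⟨n, hn⟩ := exists_pow_lt_of_lt_one (y := (1 / 2 : ℝ)) (show 0 < ε / 2 ^ k by positivity)
    (by norm_num)
  have hex : ∃ n, r ∉ nearSet E k (n + 1) := by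
    refine ⟨n, fun h => ?_⟩
    have h2 := h.2
    simp only [mem_iUnion, exists_prop] at h2
    obtain ⟨t, ⟨htE, _⟩, htr⟩ := h2
    refine hball (a := t) ?_ (subset_closure htE)
    rw [Metric.mem_ball, dist_comm]
    refine lt_trans htr ?_
    rw [lt_div_iff₀ (by positivity)] at hn
    rw [zpow_sub₀ (by norm_num), zpow_natCast]
    calc (2 : ℝ) ^ k / 2 ^ n = (1 / 2) ^ n * 2 ^ k := by rw [div_pow, one_pow]; ring
      _ < ε := hn
  classical
  refine mem_iUnion.2 ⟨(k, Nat.find hex), ?_, Nat.find_spec hex⟩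
  rcases Nat.eq_zero_or_pos (Nat.find hex) with h0 | h0
  · simp only [h0]; exact hk
  · have := Nat.find_min hex (Nat.sub_lt h0 one_pos)
    rw [not_not, show Nat.find hex - 1 + 1 = Nat.find hex from Nat.sub_add_cancel h0] at this
    exact this

/-- The bound `2n + 5 ≤ 7n` needs `n ≥ 1`; the summand 1 takes care of `n = 0`. The sum on the right
is prepared for a summation by parts over layers. -/
lemma two_mul_add_rpow_le {p : ℝ} (hp : 1 ≤ p) (n : ℕ) :
    (2 * n + 5 : ℝ≥0∞) ^ p ≤ ENNReal.ofReal (7 ^ p) * (1 + ENNReal.ofReal p *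
      ∑ m ∈ Finset.range n, ENNReal.ofReal (((m + 1 : ℕ) : ℝ) ^ (p - 1))) := by
  have hp0 : 0 ≤ p := by linarith
  have hS : 0 ≤ ∑ m ∈ Finset.range n, ((m + 1 : ℕ) : ℝ) ^ (p - 1) :=
    Finset.sum_nonneg fun m _ => by positivity
  have e : (2 * n + 5 : ℝ≥0∞) = ENNReal.ofReal (2 * n + 5) := by
    rw [ENNReal.ofReal_add (by positivity) (by norm_num), ENNReal.ofReal_mul (by norm_num)]
    simp
  rw [e, ENNReal.ofReal_rpow_of_nonneg (by positivity) hp0,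
    ← ENNReal.ofReal_sum_of_nonneg (fun m _ => by positivity), ← ENNReal.ofReal_mul hp0,
    ← ENNReal.ofReal_one, ← ENNReal.ofReal_add zero_le_one (by positivity),
    ← ENNReal.ofReal_mul (by positivity)]
  refine ENNReal.ofReal_le_ofReal ?_
  have h7 : (0 : ℝ) ≤ 7 ^ p := by positivity
  rcases Nat.eq_zero_or_pos n with rfl | hn
  · simp only [Nat.cast_zero, mul_zero, zero_add, Finset.range_zero, Finset.sum_empty, add_zero,
      mul_one]
    exact Real.rpow_le_rpow (by norm_num) (by norm_num) hp0
  · have hn' : (1 : ℝ) ≤ n := by exact_mod_cast hn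
    calc (2 * n + 5 : ℝ) ^ p ≤ (7 * n) ^ p :=
          Real.rpow_le_rpow (by positivity) (by linarith) hp0
      _ = 7 ^ p * n ^ p := Real.mul_rpow (by norm_num) (by positivity)
      _ ≤ 7 ^ p * (p * ∑ m ∈ Finset.range n, ((m + 1 : ℕ) : ℝ) ^ (p - 1)) := by
          gcongr
          exact rpow_le_mul_sum_rpow hp n
      _ ≤ _ := by gcongr; linarith

/-- The normalized measure of a layer. -/
def layerWeight (E : Set ℝ) (z : ℤ × ℕ) : ℝ≥0∞ :=
  (ENNReal.ofReal (2 ^ z.1))⁻¹ * volume (layer E z.1 z.2)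

/-- Summation by parts: after `n^p` is expanded as a sum over `m < n` and the sums are exchanged,
the disjoint layers with `n > m` fit into `nearSet E k (m + 1)`, whose measure the entropy weights
control. The constant 3 is the count `2L + 1 ≤ 3L` of the intervals in the box. -/
lemma sum_layerWeight_le {d : ℕ} (hd : 3 ≤ d) (E : Set ℝ) {p : ℝ} (hp : p = d / ((d : ℝ) - 1))
    (k₀ : ℤ) {L : ℕ} (hL : 1 ≤ L) :
    ∑ k ∈ Finset.Icc (k₀ - L) (k₀ + L), ∑ n ∈ Finset.range (L + 1),
      layerWeight E (k, n) * (2 * n + 5 : ℝ≥0∞) ^ p ≤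
    ENNReal.ofReal (7 ^ p) * (3 + ENNReal.ofReal p * (72 * carlesonSup d E)) * L := by
  have hp1 : 1 < p := hp ▸ one_lt_exponent hd
  have hq : p - 1 = 1 / ((d : ℝ) - 1) := hp ▸ exponent_sub_one hd
  set c : ℕ → ℝ≥0∞ := fun m => ENNReal.ofReal (((m + 1 : ℕ) : ℝ) ^ (p - 1))
  have hcard : (Finset.Icc (k₀ - L) (k₀ + L)).card = 2 * L + 1 := by
    rw [Int.card_Icc]; omega
  have one : ∀ k : ℤ, ∑ n ∈ Finset.range (L + 1), layerWeight E (k, n) * (2 * n + 5 : ℝ≥0∞) ^ p ≤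
      ENNReal.ofReal (7 ^ p) * (1 + ENNReal.ofReal p * ((ENNReal.ofReal (2 ^ k))⁻¹ *
        ∑ m ∈ Finset.range L, c m * volume (nearSet E k (m + 1)))) := by
    intro k
    have h0 : ENNReal.ofReal ((2 : ℝ) ^ k) ≠ 0 := by simp; positivity
    calc _ ≤ ∑ n ∈ Finset.range (L + 1), layerWeight E (k, n) *
          (ENNReal.ofReal (7 ^ p) * (1 + ENNReal.ofReal p * ∑ m ∈ Finset.range n, c m)) := by
          gcongr with n _
          exact two_mul_add_rpow_le hp1.le n
      _ = ENNReal.ofReal (7 ^ p) * ((ENNReal.ofReal (2 ^ k))⁻¹ *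
          (∑ n ∈ Finset.range (L + 1), volume (layer E k n)) +
          ENNReal.ofReal p * ((ENNReal.ofReal (2 ^ k))⁻¹ *
          ∑ n ∈ Finset.range (L + 1), volume (layer E k n) * ∑ m ∈ Finset.range n, c m)) := by
          simp only [Finset.mul_sum, ← Finset.sum_add_distrib]
          refine Finset.sum_congr rfl fun n _ => ?_
          rw [← Finset.mul_sum, layerWeight]
          rw [← Finset.mul_sum, ← Finset.mul_sum, ← Finset.mul_sum]
          ring
      _ ≤ _ := by
          gcongr
          · calc _ ≤ (ENNReal.ofReal (2 ^ k))⁻¹ * volume (nearSet E k 0) := by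
                  gcongr
                  exact sum_volume_layer_le E k 0 _ fun n _ => Nat.zero_le n
              _ = 1 := by
                  rw [nearSet, volume_dyadicIco, ENNReal.inv_mul_cancel h0 ENNReal.ofReal_ne_top]
          · calc ∑ n ∈ Finset.range (L + 1), volume (layer E k n) * ∑ m ∈ Finset.range n, c m
                = ∑ n ∈ Finset.range (L + 1), ∑ m ∈ Finset.range L,
                  if m < n then c m * volume (layer E k n) else 0 := by
                  refine Finset.sum_congr rfl fun n hn => ?_
                  rw [← Finset.sum_filter, Finset.mul_sum]
                  rw [Finset.mem_range] at hn
                  refine Finset.sum_congr ?_ fun m _ => mul_comm _ _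
                  ext m
                  simp only [Finset.mem_range, Finset.mem_filter]
                  omega
              _ = ∑ m ∈ Finset.range L, c m *
                  ∑ n ∈ (Finset.range (L + 1)).filter (fun n => m < n), volume (layer E k n) := by
                  rw [Finset.sum_comm]
                  refine Finset.sum_congr rfl fun m _ => ?_
                  rw [← Finset.sum_filter, Finset.mul_sum]
              _ ≤ _ := by
                  gcongr with m _
                  exact sum_volume_layer_le E k (m + 1) _ fun n hn => (Finset.mem_filter.1 hn).2
  calc _ ≤ ∑ k ∈ Finset.Icc (k₀ - L) (k₀ + L), ENNReal.ofReal (7 ^ p) * (1 + ENNReal.ofReal p *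
        ((ENNReal.ofReal (2 ^ k))⁻¹ *
        ∑ m ∈ Finset.range L, c m * volume (nearSet E k (m + 1)))) :=
        Finset.sum_le_sum fun k _ => one k
    _ = ENNReal.ofReal (7 ^ p) * ((2 * L + 1) + ENNReal.ofReal p *
        ∑ k ∈ Finset.Icc (k₀ - L) (k₀ + L), ((ENNReal.ofReal (2 ^ k))⁻¹ *
        ∑ m ∈ Finset.range L, c m * volume (nearSet E k (m + 1)))) := by
        rw [← Finset.mul_sum, Finset.sum_add_distrib, ← Finset.mul_sum, Finset.sum_const, hcard]
        simp
    _ ≤ ENNReal.ofReal (7 ^ p) * ((2 * L + L) + ENNReal.ofReal p * (72 * carlesonSup d E * L)) := by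
        gcongr
        · exact_mod_cast hL
        · simp only [c, hq]
          exact sum_mul_volume_nearSet_le d E k₀ hL
    _ = _ := by ring

/-! ### Radii comparable to the distance to the origin -/

/-- The mass of `g` in a dyadic interval. -/
def dyadicMass (d : ℕ) (g : ℝ → ℝ≥0∞) (j : ℤ) : ℝ≥0∞ :=
  ∫⁻ s in dyadicIco j, ENNReal.ofReal (s ^ (d - 2)) * g s

/-- Hölder on one dyadic interval. The powers of `2^j` cancel precisely at the critical exponent,
because `(d-2)p + (p-1) = d - 1`. -/
lemma dyadicMass_rpow_le {d : ℕ} (hd : 3 ≤ d) {p : ℝ} (hp : p = d / ((d : ℝ) - 1))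
    {g : ℝ → ℝ≥0∞} (hg : Measurable g) (j : ℤ) :
    dyadicMass d g j ^ p ≤ ENNReal.ofReal ((2 ^ (d - 2)) ^ p) *
      ∫⁻ s in dyadicIco j, g s ^ p ∂(radialMeasure d) := by
  have hp1 : 1 < p := hp ▸ one_lt_exponent hd
  have hp0 : 0 < p := by linarith
  have hd' : (3 : ℝ) ≤ d := by exact_mod_cast hd
  set x : ℝ := 2 ^ j
  have hx : 0 < x := by positivity
  have hx2 : (2 : ℝ) ^ (j + 1) = 2 * x := by rw [zpow_add_one₀ (by norm_num), mul_comm]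
  have h1 : dyadicMass d g j ≤ ENNReal.ofReal ((2 * x) ^ (d - 2)) * ∫⁻ s in dyadicIco j, g s := by
    rw [dyadicMass, ← lintegral_const_mul' _ _ ENNReal.ofReal_ne_top]
    refine setLIntegral_mono' (measurableSet_dyadicIco j) fun s hs => ?_
    gcongr
    · exact (mem_dyadicIco_pos hs).le
    · rw [← hx2]; exact hs.2.le
  have h2 := lintegral_rpow_le_measure_rpow_mul (μ := volume.restrict (dyadicIco j))
    hg.aemeasurable hp1
  rw [Measure.restrict_apply_univ, volume_dyadicIco] at h2
  have h3 : ∫⁻ s in dyadicIco j, g s ^ p ≤ ENNReal.ofReal ((x ^ (d - 1))⁻¹) *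
      ∫⁻ s in dyadicIco j, g s ^ p ∂(radialMeasure d) := by
    rw [setLIntegral_radialMeasure d _ (measurableSet_dyadicIco j) fun s hs => mem_dyadicIco_pos hs,
      ← lintegral_const_mul' _ _ ENNReal.ofReal_ne_top]
    refine setLIntegral_mono' (measurableSet_dyadicIco j) fun s hs => ?_
    rw [← mul_assoc, ← ENNReal.ofReal_mul (by positivity)]
    refine le_mul_of_one_le_left zero_le ?_
    rw [ENNReal.one_le_ofReal, inv_mul_eq_div, one_le_div (by positivity)]
    exact pow_le_pow_left₀ hx.le hs.1 _
  calc dyadicMass d g j ^ p ≤ (ENNReal.ofReal ((2 * x) ^ (d - 2)) *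
        ∫⁻ s in dyadicIco j, g s) ^ p := ENNReal.rpow_le_rpow h1 hp0.le
    _ ≤ ENNReal.ofReal ((2 * x) ^ (d - 2)) ^ p * (ENNReal.ofReal x ^ (p - 1) *
        (ENNReal.ofReal ((x ^ (d - 1))⁻¹) *
          ∫⁻ s in dyadicIco j, g s ^ p ∂(radialMeasure d))) := by
        rw [ENNReal.mul_rpow_of_nonneg _ _ hp0.le]
        gcongr
        exact h2.trans (by gcongr)
    _ = _ := by
        rw [← mul_assoc, ← mul_assoc, ENNReal.ofReal_rpow_of_nonneg (by positivity) hp0.le,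
          ENNReal.ofReal_rpow_of_pos hx, ← ENNReal.ofReal_mul (by positivity),
          ← ENNReal.ofReal_mul (by positivity)]
        congr 2
        have e1 : (x ^ (d - 2)) ^ p * x ^ (p - 1) = x ^ (d - 1) := by
          rw [← Real.rpow_natCast, ← Real.rpow_mul hx.le, ← Real.rpow_add hx, ← Real.rpow_natCast,
            Nat.cast_sub (by omega), Nat.cast_sub (by omega)]
          congr 1
          rw [hp]
          have : (d : ℝ) - 1 ≠ 0 := by linarith
          push_cast
          field_simp
          ring
        rw [mul_pow, Real.mul_rpow (by positivity) (by positivity), mul_assoc _ _ (x ^ (p - 1)), e1,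
          mul_assoc, mul_inv_cancel₀ (by positivity), mul_one]

lemma tsum_setLIntegral_dyadicIco (d : ℕ) (F : ℝ → ℝ≥0∞) :
    ∑' j, ∫⁻ s in dyadicIco j, F s ∂(radialMeasure d) = ∫⁻ s, F s ∂(radialMeasure d) := by
  rw [← lintegral_iUnion measurableSet_dyadicIco pairwise_disjoint_dyadicIco, iUnion_dyadicIco]
  rw [setLIntegral_radialMeasure d _ measurableSet_Ioi subset_rfl, lintegral_radialMeasure']

/-- With `u` the cosine of the angle between the sides `r` and `t`, `(1 - u) * 2rt = s² - (r-t)² ≤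
s²`, and `2rt > r²`. Hence `1 - u² ≤ 2(1 - u)` is at most `(2s/r)²`, so the square root is at most
`2s/r`. -/
lemma kernel_le {d : ℕ} (hd : 3 ≤ d) {r t s : ℝ} (hr : 0 < r) (htr : r / 2 < t)
    (hs : |r - t| < s) : kernel d r t s ≤ 2 ^ (d - 2) / r ^ (d - 1) * s ^ (d - 2) := by
  have ht : 0 < t := by linarith
  have hs0 : 0 < s := (abs_nonneg _).trans_lt hs
  have h1 : (r - t) ^ 2 ≤ s ^ 2 := by
    rw [sq_le_sq, abs_of_pos hs0]; exact hs.le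
  set u := (r ^ 2 + t ^ 2 - s ^ 2) / (2 * r * t)
  have hu : u * (2 * r * t) = r ^ 2 + t ^ 2 - s ^ 2 := div_mul_cancel₀ _ (by positivity)
  have hu1 : u ≤ 1 := by
    refine (div_le_one (by positivity)).2 ?_
    nlinarith
  have h2 : 1 - u ^ 2 ≤ (2 * s / r) ^ 2 := by
    have h3 : 2 * (1 - u) ≤ (2 * s / r) ^ 2 := by
      rw [div_pow, le_div_iff₀ (by positivity)]
      have h4 : (1 - u) * (2 * r * t) ≤ s ^ 2 := by nlinarith [sq_nonneg (r - t)]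
      have h5 : (1 - u) * r ^ 2 ≤ (1 - u) * (2 * r * t) := by
        refine mul_le_mul_of_nonneg_left ?_ (by linarith)
        nlinarith
      nlinarith
    nlinarith
  have h6 : √(1 - u ^ 2) ≤ 2 * s / r := (Real.sqrt_le_sqrt h2).trans
    (le_of_eq (Real.sqrt_sq (by positivity)))
  obtain ⟨n, rfl⟩ : ∃ n, d = n + 3 := ⟨d - 3, by omega⟩
  calc kernel (n + 3) r t s = √(1 - u ^ 2) ^ n * (s / (r * t)) := rfl
    _ ≤ (2 * s / r) ^ n * (s / (r * (r / 2))) := by gcongr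
    _ = _ := by
        rw [show n + 3 - 2 = n + 1 by omega, show n + 3 - 1 = n + 2 by omega, div_pow, mul_pow]
        field_simp
        ring

/-- A point outside `nearSet E k (n + 1)` satisfies `|r - t| ≥ 2^(k-n)` for all comparable `t` in
`E`, and `r + t < 3r < 2^(k+3)`. So only shells from `k - n` to `k + 2` occur; the range is made
symmetric to fit the discrete embedding. -/
lemma radialMean_le_sum {d : ℕ} (hd : 3 ≤ d) {E : Set ℝ} {g : ℝ → ℝ≥0∞} {k : ℤ} {n : ℕ} {r : ℝ}
    (hr : r ∈ layer E k n) {t : ℝ} (ht : t ∈ E) (h1 : r / 2 < t) (h2 : t < 2 * r) :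
    radialMean d g r t ≤ ENNReal.ofReal (2 ^ (d - 2) / r ^ (d - 1)) *
      ∑ j ∈ Finset.Icc (k - (n + 2 : ℕ)) (k + (n + 2 : ℕ)), dyadicMass d g j := by
  have hrk := layer_subset E k n hr
  have hr0 := mem_dyadicIco_pos hrk
  have e0 : (2 : ℝ) ^ (k - 1) = 2 ^ k / 2 := zpow_sub_one₀ (by norm_num) k
  have e1 : (2 : ℝ) ^ (k + 1) = 2 ^ k * 2 := zpow_add_one₀ (by norm_num) k
  have e2 : (2 : ℝ) ^ (k + 2) = 2 ^ k * 4 := by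
    rw [zpow_add₀ (by norm_num)]; norm_num
  have e3 : (2 : ℝ) ^ (k + 2 + 1) = 2 ^ k * 8 := by
    rw [zpow_add₀ (by norm_num), zpow_add₀ (by norm_num)]; norm_num; ring
  have hrl := hrk.1
  have hru := hrk.2
  have hfar : (2 : ℝ) ^ (k - n) ≤ |r - t| := by
    by_contra hlt
    rw [not_le, ← Real.dist_eq] at hlt
    refine hr.2 ⟨hrk, mem_biUnion (x := t) ⟨ht, ?_, ?_⟩ hlt⟩
    · linarith
    · linarith
  have hsub : Ioo |r - t| (r + t) ⊆
      ⋃ j ∈ Finset.Icc (k - (n + 2 : ℕ)) (k + (n + 2 : ℕ)), dyadicIco j := by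
    intro s hs
    have hs0 : 0 < s := (abs_nonneg _).trans_lt hs.1
    obtain ⟨j, hj⟩ := exists_mem_dyadicIco hs0
    have h3 : (2 : ℝ) ^ (k - n) < 2 ^ (j + 1) := (hfar.trans_lt hs.1).trans hj.2
    have h4 : (2 : ℝ) ^ j < 2 ^ (k + 2 + 1) := by
      refine hj.1.trans_lt (hs.2.trans ?_)
      linarith
    rw [zpow_lt_zpow_iff_right₀ (by norm_num)] at h3 h4
    refine mem_biUnion (x := j) ?_ hj
    simp only [Finset.mem_coe, Finset.mem_Icc]
    push_cast
    omega
  calc radialMean d g r t ≤ ENNReal.ofReal (2 ^ (d - 2) / r ^ (d - 1)) *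
        ∫⁻ s in Ioo |r - t| (r + t), ENNReal.ofReal (s ^ (d - 2)) * g s := by
        rw [radialMean, ← lintegral_const_mul' _ _ ENNReal.ofReal_ne_top]
        refine setLIntegral_mono' measurableSet_Ioo fun s hs => ?_
        rw [← mul_assoc, ← ENNReal.ofReal_mul (by positivity)]
        gcongr
        exact kernel_le hd hr0 h1 hs.1
    _ ≤ _ := by
        gcongr
        refine (lintegral_mono_set hsub).trans ?_
        rw [lintegral_biUnion_finset (fun i _ j _ hij => pairwise_disjoint_dyadicIco hij)
          (fun j _ => measurableSet_dyadicIco j)]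
        rfl

/-- Radii comparable to the distance to the origin. -/
lemma lintegral_radialMean_comparable {d : ℕ} (hd : 3 ≤ d) {p : ℝ} (hp : p = d / ((d : ℝ) - 1))
    {E : Set ℝ} (hC : carlesonSup d E < ⊤) :
    ∃ C : ℝ≥0∞, C ≠ ∞ ∧ ∀ g : ℝ → ℝ≥0∞, Measurable g →
      ∫⁻ s, g s ^ p ∂(radialMeasure d) ≠ ∞ →
      ∃ H : ℝ → ℝ≥0∞, Measurable H ∧
        (∀ r t, 0 < r → r ∉ closure E → t ∈ E → r / 2 < t → t < 2 * r →
          radialMean d g r t ^ p ≤ H r) ∧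
        ∫⁻ r, H r ∂(radialMeasure d) ≤ C * ∫⁻ s, g s ^ p ∂(radialMeasure d) := by
  have hp1 : 1 < p := hp ▸ one_lt_exponent hd
  have hp0 : 0 < p := by linarith
  have hd' : (3 : ℝ) ≤ d := by exact_mod_cast hd
  set A : ℝ := (2 ^ (d - 2)) ^ p
  have hA : 0 ≤ A := by positivity
  set K : ℝ≥0∞ := ENNReal.ofReal (7 ^ p) * (3 + ENNReal.ofReal p * (72 * carlesonSup d E))
  refine ⟨ENNReal.ofReal A * (K * ENNReal.ofReal (5 * (2 ^ p * (p / (p - 1)))) *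
    ENNReal.ofReal A), ?_, fun g hg hfin => ?_⟩
  · have := hC.ne
    simp only [K]
    finiteness
  have hG : ∀ j, dyadicMass d g j ≠ ∞ := by
    intro j h
    have h1 := dyadicMass_rpow_le hd hp hg j
    rw [h, ENNReal.top_rpow_of_pos hp0, top_le_iff] at h1
    refine ENNReal.mul_ne_top ENNReal.ofReal_ne_top ?_ h1
    exact ne_top_of_le_ne_top hfin (setLIntegral_le_lintegral _ _)
  set S : ℤ × ℕ → ℝ≥0∞ := fun z =>
    ∑ j ∈ Finset.Icc (z.1 - (z.2 + 2 : ℕ)) (z.1 + (z.2 + 2 : ℕ)), dyadicMass d g j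
  set F : ℤ × ℕ → ℝ → ℝ≥0∞ := fun z r => (ENNReal.ofReal (2 ^ (d - 2) / r ^ (d - 1)) * S z) ^ p
  have hF : ∀ z, Measurable ((layer E z.1 z.2).indicator (F z)) := fun z =>
    Measurable.indicator (by fun_prop) (measurableSet_layer E z.1 z.2)
  -- Here `(d-1)p = d` enters: `r^(d-1) * r^(-(d-1)p) = r^(-1)`, which is at most `2^(-k)` on the
  -- layer.
  have hlayer : ∀ z : ℤ × ℕ, ∫⁻ r, (layer E z.1 z.2).indicator (F z) r ∂(radialMeasure d) ≤
      ENNReal.ofReal A * (layerWeight E z * S z ^ p) := by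
    rintro ⟨k, n⟩
    rw [lintegral_indicator (measurableSet_layer E k n), setLIntegral_radialMeasure d _
      (measurableSet_layer E k n) fun r hr => mem_dyadicIco_pos (layer_subset E k n hr)]
    calc _ ≤ ∫⁻ r in layer E k n, ENNReal.ofReal A * (ENNReal.ofReal (2 ^ k))⁻¹ * S (k, n) ^ p := by
          refine setLIntegral_mono' (measurableSet_layer E k n) fun r hr => ?_
          have hrk := layer_subset E k n hr
          have hr0 := mem_dyadicIco_pos hrk
          calc _ = ENNReal.ofReal (A * r⁻¹) * S (k, n) ^ p := by
                simp only [F]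
                rw [ENNReal.mul_rpow_of_nonneg _ _ hp0.le, ← mul_assoc,
                  ENNReal.ofReal_rpow_of_nonneg (by positivity) hp0.le,
                  ← ENNReal.ofReal_mul (by positivity)]
                congr 2
                rw [Real.div_rpow (by positivity) (by positivity), ← mul_div_assoc, mul_comm,
                  mul_div_assoc]
                congr 1
                rw [← Real.rpow_natCast, ← Real.rpow_mul hr0.le, ← Real.rpow_sub hr0,
                  ← Real.rpow_neg_one]
                congr 1
                rw [Nat.cast_sub (by omega), hp]
                have : (d : ℝ) - 1 ≠ 0 := by linarith
                push_cast
                field_simp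
                ring
            _ ≤ ENNReal.ofReal A * (ENNReal.ofReal (2 ^ k))⁻¹ * S (k, n) ^ p := by
                rw [ENNReal.ofReal_mul hA, ENNReal.ofReal_inv_of_pos hr0]
                gcongr
                exact hrk.1
      _ = _ := by
          rw [setLIntegral_const, layerWeight]
          ring
  refine ⟨fun r => ∑' z, (layer E z.1 z.2).indicator (F z) r, Measurable.tsum hF, ?_, ?_⟩
  · intro r t hr hrE ht h1 h2
    obtain ⟨z, hz⟩ := mem_iUnion.1 (Ioi_diff_closure_subset E ⟨hr, hrE⟩)
    refine le_trans ?_ (ENNReal.le_tsum z)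
    rw [indicator_of_mem hz]
    exact ENNReal.rpow_le_rpow (radialMean_le_sum hd hz ht h1 h2) hp0.le
  calc _ = ∑' z, ∫⁻ r, (layer E z.1 z.2).indicator (F z) r ∂(radialMeasure d) :=
        lintegral_tsum fun z => (hF z).aemeasurable
    _ ≤ ∑' z : ℤ × ℕ, ENNReal.ofReal A * (layerWeight E z * S z ^ p) :=
        ENNReal.tsum_le_tsum hlayer
    _ ≤ ENNReal.ofReal A * (K * ENNReal.ofReal (5 * (2 ^ p * (p / (p - 1)))) *
          ∑' j, dyadicMass d g j ^ p) := by
        rw [ENNReal.tsum_mul_left]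
        gcongr
        exact tsum_mul_rpow_sum_Icc_le hp1 (fun k₀ L hL => sum_layerWeight_le hd E hp k₀ hL) hG
    _ ≤ ENNReal.ofReal A * (K * ENNReal.ofReal (5 * (2 ^ p * (p / (p - 1)))) *
          (ENNReal.ofReal A * ∫⁻ s, g s ^ p ∂(radialMeasure d))) := by
        gcongr
        rw [← tsum_setLIntegral_dyadicIco, ← ENNReal.tsum_mul_left]
        exact ENNReal.tsum_le_tsum fun j => dyadicMass_rpow_le hd hp hg j
    _ = _ := by ring

/-! ### The Carleson condition is sufficient -/

lemma lintegral_norm_eq_radialMeasure {d : ℕ} [NeZero d] {G : ℝ → ℝ≥0∞} (hG : Measurable G) :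
    ∫⁻ x : Euc d, G ‖x‖ = area d * ∫⁻ r, G r ∂(radialMeasure d) := by
  rw [lintegral_norm hG, lintegral_radialMeasure']

lemma lintegral_enorm_rpow_profile {d : ℕ} [NeZero d] {f : Euc d → ℂ} {f₀ f₁ : ℝ → ℂ}
    (hf₀ : ∀ x, f x = f₀ ‖x‖) (hf₁ : Measurable f₁)
    (h : volume {s | 0 < s ∧ f₀ s ≠ f₁ s} = 0) (p : ℝ) :
    ∫⁻ x, ‖f x‖ₑ ^ p = area d * ∫⁻ s, ‖f₁ s‖ₑ ^ p ∂(radialMeasure d) := by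
  rw [← lintegral_norm_eq_radialMeasure (hf₁.enorm.pow_const p)]
  obtain ⟨N, hN, hNm, hN0⟩ := exists_measurable_superset_of_null h
  have hS : volume (N ∪ {(0 : ℝ)}) = 0 := measure_union_null hN0 (by simp)
  have h1 := volume_norm_mem_eq_zero (d := d) (hNm.union (measurableSet_singleton 0)) hS
  refine lintegral_congr_ae ?_
  filter_upwards [measure_eq_zero_iff_ae_notMem.1 h1] with x hx
  have hx' : ‖x‖ ∉ N ∪ {0} := hx
  have hx0 : 0 < ‖x‖ := lt_of_le_of_ne (norm_nonneg x) fun h => hx' (Or.inr h.symm)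
  have : f₀ ‖x‖ = f₁ ‖x‖ := by
    by_contra hne
    exact hx' (Or.inl (hN ⟨hx0, hne⟩))
  rw [hf₀, this]

lemma setLIntegral_Icc_ne_top {d : ℕ} {p : ℝ} (hp : 1 < p) {g : ℝ → ℝ≥0∞} (hg : Measurable g)
    (hfin : ∫⁻ s, g s ^ p ∂(radialMeasure d) ≠ ∞) {a b : ℝ} (ha : 0 < a) :
    ∫⁻ s in Icc a b, g s ≠ ∞ := by
  have hp0 : 0 < p := by linarith
  have h2 := lintegral_rpow_le_measure_rpow_mul (μ := volume.restrict (Icc a b))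
    hg.aemeasurable hp
  rw [Measure.restrict_apply_univ, Real.volume_Icc] at h2
  have h3 : ∫⁻ s in Icc a b, g s ^ p ≤ ENNReal.ofReal ((a ^ (d - 1))⁻¹) *
      ∫⁻ s in Icc a b, g s ^ p ∂(radialMeasure d) := by
    rw [setLIntegral_radialMeasure d _ measurableSet_Icc fun s hs => ha.trans_le hs.1,
      ← lintegral_const_mul' _ _ ENNReal.ofReal_ne_top]
    refine setLIntegral_mono' measurableSet_Icc fun s hs => ?_
    rw [← mul_assoc, ← ENNReal.ofReal_mul (by positivity)]
    refine le_mul_of_one_le_left zero_le ?_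
    rw [ENNReal.one_le_ofReal, inv_mul_eq_div, one_le_div (by positivity)]
    exact pow_le_pow_left₀ ha.le hs.1 _
  have h4 : ∫⁻ s in Icc a b, g s ^ p ∂(radialMeasure d) ≠ ∞ :=
    ne_top_of_le_ne_top hfin (setLIntegral_le_lintegral _ _)
  have h5 : ∫⁻ s in Icc a b, g s ^ p ≠ ∞ := ne_top_of_le_ne_top (by finiteness) h3
  intro htop
  rw [htop, ENNReal.top_rpow_of_pos hp0, top_le_iff] at h2
  refine ENNReal.mul_ne_top (ENNReal.rpow_ne_top_of_nonneg (by linarith) ENNReal.ofReal_ne_top)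
    h5 h2

/-- The Carleson condition implies the maximal estimate. -/
theorem boundedOnRadial_of_carlesonSup {d : ℕ} (hd : 3 ≤ d) {E : Set ℝ} (hE : E ⊆ Ioi 0)
    (hC : carlesonSup d E < ⊤) :
    BoundedOnRadial d E (ENNReal.ofReal ((d : ℝ) / ((d : ℝ) - 1))) := by
  have : NeZero d := ⟨by omega⟩
  set p : ℝ := (d : ℝ) / ((d : ℝ) - 1) with hp
  have hp1 : 1 < p := one_lt_exponent hd
  have hp0 : 0 < p := by linarith
  -- The null closure serves twice: points with `‖x‖` in `closure E` lie in no useful layer and are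
  -- discarded, and the maximal function is measurable.
  have hE0 := volume_closure_eq_zero hd hE hC
  obtain ⟨C₁, hC₁, h₁⟩ := lintegral_radialMean_small (d := d) hp1
  obtain ⟨C₂, hC₂, h₂⟩ := lintegral_radialMean_large hd hp1
  obtain ⟨C₃, hC₃, h₃⟩ := lintegral_radialMean_comparable hd hp hC
  set C := C₁ + C₂ + C₃
  have hCtop : C ≠ ∞ := by simp only [C]; finiteness
  have hc := kernelConst_ne_top hd
  have hq0 : ENNReal.ofReal p ≠ 0 := by simp [hp0]
  have hqr : (ENNReal.ofReal p).toReal = p := ENNReal.toReal_ofReal hp0.le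
  have hKtop : kernelConst d * C ^ (1 / p) ≠ ∞ :=
    ENNReal.mul_ne_top hc (ENNReal.rpow_ne_top_of_nonneg (by positivity) hCtop)
  refine ⟨(kernelConst d * C ^ (1 / p)).toNNReal, fun f ⟨f₀, hf₀⟩ hf => ?_⟩
  obtain ⟨f₁, hf₁, h⟩ := exists_measurable_profile hf.1 hf₀
  set g : ℝ → ℝ≥0∞ := fun s => ‖f₁ s‖ₑ
  have hg : Measurable g := hf₁.enorm
  have hgtop : ∀ s, g s ≠ ∞ := fun s => enorm_ne_top
  have hfp : ∫⁻ x, ‖f x‖ₑ ^ p = area d * ∫⁻ s, g s ^ p ∂(radialMeasure d) :=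
    lintegral_enorm_rpow_profile hf₀ hf₁ h p
  have hJ : ∫⁻ s, g s ^ p ∂(radialMeasure d) ≠ ∞ := by
    have h1 := (eLpNorm_lt_top_iff_lintegral_rpow_enorm_lt_top hq0 ENNReal.ofReal_ne_top).1 hf.2
    rw [hqr, hfp] at h1
    exact fun h2 => h1.ne (by rw [h2, ENNReal.mul_top (area_ne_zero d)])
  obtain ⟨H₁, hH₁, hH₁', hH₁''⟩ := h₁ g hg hgtop
  obtain ⟨H₂, hH₂, hH₂', hH₂''⟩ := h₂ g hg
  obtain ⟨H₃, hH₃, hH₃', hH₃''⟩ := h₃ g hg hJ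
  set H : ℝ → ℝ≥0∞ := fun r => H₁ r + H₂ r + H₃ r
  have hH : Measurable H := (hH₁.add hH₂).add hH₃
  have hHint : ∫⁻ r, H r ∂(radialMeasure d) ≤ C * ∫⁻ s, g s ^ p ∂(radialMeasure d) := by
    simp only [H, C]
    rw [lintegral_add_right _ hH₃, lintegral_add_right _ hH₂, add_mul, add_mul]
    gcongr
  have hHint' : ∫⁻ x : Euc d, H ‖x‖ ≤ C * ∫⁻ x, ‖f x‖ₑ ^ p := by
    rw [lintegral_norm_eq_radialMeasure hH, hfp, mul_left_comm]
    gcongr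
  -- The three regimes are combined in one majorant `H` that does not depend on `t`, so the supremum
  -- over `E` costs nothing.
  have hmean : ∀ r t, 0 < r → r ∉ closure E → t ∈ E → radialMean d g r t ^ p ≤ H r := by
    intro r t hr hrE ht
    rcases le_or_gt t (r / 2) with h1 | h1
    · exact (hH₁' r t (hE ht) h1).trans (le_self_add.trans le_self_add)
    rcases le_or_gt (2 * r) t with h2 | h2
    · exact (hH₂' r t hr h2).trans (le_add_self.trans le_self_add)
    · exact (hH₃' r t hr hrE ht h1 h2).trans le_add_self
  have hgood : ∀ᵐ x : Euc d, ‖x‖ ∉ closure E ∪ {0} := by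
    have hS : volume (closure E ∪ {0}) = 0 := measure_union_null hE0 (by simp)
    exact measure_eq_zero_iff_ae_notMem.1 (volume_norm_mem_eq_zero (d := d)
      (isClosed_closure.measurableSet.union (measurableSet_singleton 0)) hS)
  have hHfin : ∀ᵐ x : Euc d, H ‖x‖ < ∞ := by
    refine ae_lt_top (hH.comp measurable_norm) (ne_top_of_le_ne_top ?_ hHint')
    rw [hfp]
    have := area_ne_top d
    finiteness
  have hmax : ∀ᵐ x : Euc d, maximalFunction E f x ^ p ≤ kernelConst d ^ p * H ‖x‖ := by
    filter_upwards [hgood] with x hx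
    have hx0 : x ≠ 0 := fun h0 => hx (Or.inr (by simp [h0]))
    rw [← ENNReal.le_rpow_inv_iff hp0]
    refine iSup₂_le fun t ht => ?_
    rw [ENNReal.le_rpow_inv_iff hp0]
    calc _ ≤ (kernelConst d * radialMean d g ‖x‖ t) ^ p :=
          ENNReal.rpow_le_rpow (enorm_sphericalMean_le hd hf₀ hf₁ h hx0 (hE ht)) hp0.le
      _ ≤ _ := by
          rw [ENNReal.mul_rpow_of_nonneg _ _ hp0.le]
          gcongr
          exact hmean _ _ (norm_pos_iff.2 hx0) (fun h1 => hx (Or.inl h1)) ht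
  have hnorm : eLpNorm (maximalFunction E f) (ENNReal.ofReal p) volume ≤
      (kernelConst d * C ^ (1 / p)) * eLpNorm f (ENNReal.ofReal p) volume := by
    rw [eLpNorm_eq_lintegral_rpow_enorm_toReal hq0 ENNReal.ofReal_ne_top,
      eLpNorm_eq_lintegral_rpow_enorm_toReal hq0 ENNReal.ofReal_ne_top, hqr]
    simp only [enorm_eq_self]
    calc (∫⁻ x, maximalFunction E f x ^ p) ^ (1 / p)
        ≤ (kernelConst d ^ p * (C * ∫⁻ x, ‖f x‖ₑ ^ p)) ^ (1 / p) := by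
          refine ENNReal.rpow_le_rpow ?_ (by positivity)
          refine (lintegral_mono_ae hmax).trans ?_
          rw [lintegral_const_mul' _ _ (ENNReal.rpow_ne_top_of_nonneg hp0.le hc)]
          gcongr
      _ = _ := by
          rw [ENNReal.mul_rpow_of_nonneg _ _ (by positivity),
            ENNReal.mul_rpow_of_nonneg _ _ (by positivity), ← ENNReal.rpow_mul,
            mul_one_div_cancel hp0.ne', ENNReal.rpow_one, mul_assoc]
  refine ⟨?_, ⟨?_, ?_⟩, ?_⟩
  · filter_upwards [hgood, hHfin] with x hx hxH t ht
    have hx0 : x ≠ 0 := fun h0 => hx (Or.inr (by simp [h0]))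
    refine meanExists_of_lintegral_ne_top hd hf₀ hf₁ h hx0 (hE ht) fun htop => ?_
    have h1 := hmean ‖x‖ t (norm_pos_iff.2 hx0) (fun h1 => hx (Or.inl h1)) ht
    rw [radialMean, htop, ENNReal.top_rpow_of_pos hp0, top_le_iff] at h1
    exact hxH.ne h1
  · exact (aemeasurable_maximalFunction hd hf₀ hf₁ h
      (fun a b ha => setLIntegral_Icc_ne_top hp1 hg hJ ha) hE hE0).aestronglyMeasurable
  · exact hnorm.trans_lt (ENNReal.mul_lt_top hKtop.lt_top hf.2)
  · rw [ENNReal.coe_toNNReal hKtop]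
    exact hnorm

/-! ### Grid neighbourhoods of E -/

/-- The left endpoints of the grid of mesh `2^{k-n}` in `[2^k, 2^{k+1}]`. -/
def gridPoint (k : ℤ) (n i : ℕ) : ℝ := 2 ^ k + i * 2 ^ (k - n : ℤ)

open Classical in
/-- The indices of the grid intervals which meet `E`. -/
def gridIndices (E : Set ℝ) (k : ℤ) (n : ℕ) : Finset ℕ :=
  (Finset.range (2 ^ n)).filter fun i =>
    ∃ t ∈ dyadicPiece E k, t ∈ Icc (gridPoint k n i) (gridPoint k n i + 2 ^ (k - n : ℤ))

/-- The union of the grid intervals which meet `E`. -/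
def gridSet (E : Set ℝ) (k : ℤ) (n : ℕ) : Set ℝ :=
  ⋃ i ∈ gridIndices E k n, Ico (gridPoint k n i) (gridPoint k n (i + 1))

lemma gridPoint_succ (k : ℤ) (n i : ℕ) :
    gridPoint k n (i + 1) = gridPoint k n i + 2 ^ (k - n : ℤ) := by
  unfold gridPoint; push_cast; ring

lemma gridPoint_monotone (k : ℤ) (n : ℕ) : Monotone (gridPoint k n) := fun i j hij => by
  unfold gridPoint
  gcongr

lemma gridPoint_last (k : ℤ) (n : ℕ) : gridPoint k n (2 ^ n) = 2 ^ (k + 1) := by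
  unfold gridPoint
  rw [zpow_sub₀ (by norm_num), zpow_natCast, zpow_add_one₀ (by norm_num)]
  push_cast
  field_simp
  norm_num

lemma dyadicPiece_subset_grid (E : Set ℝ) (k : ℤ) (n : ℕ) :
    dyadicPiece E k ⊆ ⋃ i ∈ gridIndices E k n,
      Icc (gridPoint k n i) (gridPoint k n i + 2 ^ (k - n : ℤ)) := by
  intro t ht
  have hh : (0 : ℝ) < 2 ^ (k - n : ℤ) := by positivity
  suffices h : ∃ i < 2 ^ n, t ∈ Icc (gridPoint k n i) (gridPoint k n i + 2 ^ (k - n : ℤ)) by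
    obtain ⟨i, hi, hit⟩ := h
    refine mem_biUnion (x := i) ?_ hit
    simp only [gridIndices, Finset.coe_filter, mem_ofPred_eq, Finset.mem_range]
    exact ⟨hi, t, ht, hit⟩
  have h1 := ht.1.1
  have h2 := ht.1.2
  rcases h2.eq_or_lt with h3 | h3
  -- For the right endpoint `2^(k+1)` the floor below would give the index `2^n`, which is out of
  -- range; the last closed cell contains it.
  · have hpos : 0 < 2 ^ n := by positivity
    refine ⟨2 ^ n - 1, Nat.sub_lt hpos one_pos, ?_⟩
    have h4 := gridPoint_succ k n (2 ^ n - 1)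
    rw [Nat.sub_add_cancel hpos, gridPoint_last] at h4
    exact ⟨by linarith, by linarith⟩
  · set i := ⌊(t - 2 ^ k) / 2 ^ (k - n : ℤ)⌋₊
    have h4 : (i : ℝ) ≤ (t - 2 ^ k) / 2 ^ (k - n : ℤ) :=
      Nat.floor_le (div_nonneg (by linarith) hh.le)
    have h5 := Nat.lt_floor_add_one ((t - 2 ^ k) / 2 ^ (k - n : ℤ))
    rw [le_div_iff₀ hh] at h4
    rw [div_lt_iff₀ hh] at h5
    have h6 : gridPoint k n i ≤ t := by unfold gridPoint; linarith
    refine ⟨i, ?_, h6, ?_⟩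
    · by_contra h7
      have h8 := gridPoint_monotone k n (not_lt.1 h7)
      rw [gridPoint_last] at h8
      linarith
    · unfold gridPoint; linarith

lemma entropyNumber_le_card (E : Set ℝ) (k : ℤ) (n : ℕ) :
    entropyNumber (dyadicPiece E k) (2 ^ (k - n : ℤ)) ≤ ((gridIndices E k n).card : ℕ∞) := by
  classical
  unfold entropyNumber
  refine (iInf₂_le ((gridIndices E k n).image (gridPoint k n)) ?_).trans ?_
  · refine (dyadicPiece_subset_grid E k n).trans ?_
    simp
  · exact_mod_cast Finset.card_image_le

lemma card_gridIndices_le (E : Set ℝ) (k : ℤ) (n : ℕ) : (gridIndices E k n).card ≤ 2 ^ n := by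
  classical
  unfold gridIndices
  refine (Finset.card_filter_le _ _).trans ?_
  simp

lemma measurableSet_gridSet (E : Set ℝ) (k : ℤ) (n : ℕ) : MeasurableSet (gridSet E k n) :=
  Finset.measurableSet_biUnion _ fun _ _ => measurableSet_Ico

lemma volume_gridSet (E : Set ℝ) (k : ℤ) (n : ℕ) :
    volume (gridSet E k n) = (gridIndices E k n).card * ENNReal.ofReal (2 ^ (k - n : ℤ)) := by
  have hdisj : Pairwise (Function.onFun Disjoint fun i =>
      Ico (gridPoint k n i) (gridPoint k n (i + 1))) :=
    (gridPoint_monotone k n).pairwise_disjoint_on_Ico_succ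
  rw [gridSet, measure_biUnion_finset (fun i _ j _ hij => hdisj hij) fun _ _ => measurableSet_Ico,
    Finset.sum_congr rfl (g := fun _ => ENNReal.ofReal (2 ^ (k - n : ℤ)))]
  · simp
  · intro i _
    rw [Real.volume_Ico, gridPoint_succ, add_sub_cancel_left]

lemma gridSet_subset (E : Set ℝ) (k : ℤ) (n : ℕ) : gridSet E k n ⊆ dyadicIco k := by
  refine iUnion₂_subset fun i hi => ?_
  classical
  simp only [gridIndices, Finset.mem_filter, Finset.mem_range] at hi
  refine Ico_subset_Ico ?_ ?_
  · have := gridPoint_monotone k n (Nat.zero_le i)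
    simpa [gridPoint] using this
  · rw [← gridPoint_last k n]
    exact gridPoint_monotone k n (Nat.succ_le_of_lt hi.1)

lemma exists_near_of_mem_gridSet {E : Set ℝ} {k : ℤ} {n : ℕ} {r : ℝ} (hr : r ∈ gridSet E k n) :
    ∃ t ∈ dyadicPiece E k, |r - t| ≤ 2 ^ (k - n : ℤ) := by
  classical
  obtain ⟨i, hi, hri⟩ := mem_iUnion₂.1 hr
  simp only [gridIndices, Finset.mem_filter] at hi
  obtain ⟨_, t, ht, ht1, ht2⟩ := hi
  rw [gridPoint_succ] at hri
  exact ⟨t, ht, abs_le.2 ⟨by linarith [hri.1], by linarith [hri.2]⟩⟩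

/-- The grid cells meeting `E` form a cover, so the entropy number is at most their number, which is
the measure of the grid set divided by the mesh. This turns the weights into integrals. -/
lemma natWeight_le_volume_gridSet (d : ℕ) (E : Set ℝ) (k : ℤ) (n : ℕ) :
    natWeight d E k n ≤ ENNReal.ofReal ((n : ℝ) ^ (1 / ((d : ℝ) - 1))) *
      (ENNReal.ofReal (2 ^ k)⁻¹ * volume (gridSet E k n)) := by
  rw [volume_gridSet, natWeight]
  calc _ ≤ ((gridIndices E k n).card : ℝ≥0∞) * ENNReal.ofReal ((2 : ℝ) ^ (-(n : ℤ)) *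
        (n : ℝ) ^ (1 / ((d : ℝ) - 1))) := by
        gcongr
        have := ENat.toENNReal_le.2 (entropyNumber_le_card E k n)
        simpa using this
    _ = _ := by
        have e : (2 : ℝ) ^ (-(n : ℤ)) = (2 ^ k)⁻¹ * 2 ^ (k - n : ℤ) := by
          rw [sub_eq_add_neg, zpow_add₀ (by norm_num), ← mul_assoc, inv_mul_cancel₀ (by positivity),
            one_mul]
        rw [e, ENNReal.ofReal_mul (by positivity), ENNReal.ofReal_mul (by positivity)]
        ring

/-- Two cells always suffice at scale `2^(k-1)`. The case `n = 1` needs this separate bound because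
the lower bound for the test functions carries the factor `n - 1`. -/
lemma natWeight_one_le (d : ℕ) (E : Set ℝ) (k : ℤ) : natWeight d E k 1 ≤ 1 := by
  refine (natWeight_le_volume_gridSet d E k 1).trans ?_
  rw [volume_gridSet]
  have h1 : ((gridIndices E k 1).card : ℝ≥0∞) ≤ 2 := by
    exact_mod_cast card_gridIndices_le E k 1
  calc _ ≤ ENNReal.ofReal (((1 : ℕ) : ℝ) ^ (1 / ((d : ℝ) - 1))) *
        (ENNReal.ofReal (2 ^ k)⁻¹ * (2 * ENNReal.ofReal (2 ^ (k - (1 : ℕ) : ℤ)))) := by gcongr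
    _ = 1 := by
        rw [Nat.cast_one, Real.one_rpow, ENNReal.ofReal_one, one_mul,
          show (2 : ℝ≥0∞) = ENNReal.ofReal 2 by simp, ← ENNReal.ofReal_mul (by norm_num),
          ← ENNReal.ofReal_mul (by positivity), ← ENNReal.ofReal_one]
        congr 1
        rw [zpow_sub₀ (by norm_num)]
        field_simp
        norm_num

/-! ### Test functions and lower bounds for their means -/

/-- Now `(1 - u) * 2rt = s² - (r-t)² ≥ (3/4) s²` and `2rt ≤ 4r²`, so `1 - u ≥ (s/(4r))²`. The
condition `s ≤ r` makes `u ≥ 0`, hence `1 - u² ≥ 1 - u`. -/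
lemma le_kernel {d : ℕ} (hd : 3 ≤ d) {r t s : ℝ} (hr : 0 < r) (ht : 0 < t) (htr : t ≤ 2 * r)
    (hs0 : 0 < s) (hs : 2 * |r - t| ≤ s) (hsr : s ≤ r) :
    s ^ (d - 2) / (4 ^ (d - 2) * r ^ (d - 1)) ≤ kernel d r t s := by
  have h1 : (r - t) ^ 2 ≤ s ^ 2 / 4 := by
    rw [← sq_abs]
    nlinarith [abs_nonneg (r - t)]
  set u := (r ^ 2 + t ^ 2 - s ^ 2) / (2 * r * t)
  have hu : u * (2 * r * t) = r ^ 2 + t ^ 2 - s ^ 2 := div_mul_cancel₀ _ (by positivity)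
  have hu0 : 0 ≤ u := div_nonneg (by nlinarith) (by positivity)
  have hu1 : u ≤ 1 := by
    refine (div_le_one (by positivity)).2 ?_
    nlinarith
  have h2 : (s / (4 * r)) ^ 2 ≤ 1 - u ^ 2 := by
    have h3 : (s / (4 * r)) ^ 2 ≤ 1 - u := by
      rw [div_pow, div_le_iff₀ (by positivity)]
      have h4 : 3 / 4 * s ^ 2 ≤ (1 - u) * (2 * r * t) := by nlinarith
      have h5 : (1 - u) * (2 * r * t) ≤ (1 - u) * (2 * r * (2 * r)) := by
        refine mul_le_mul_of_nonneg_left ?_ (by linarith)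
        gcongr
      nlinarith
    nlinarith
  have h6 : s / (4 * r) ≤ √(1 - u ^ 2) := Real.le_sqrt_of_sq_le h2
  obtain ⟨n, rfl⟩ : ∃ n, d = n + 3 := ⟨d - 3, by omega⟩
  calc _ = (s / (4 * r)) ^ n * (s / (r * (4 * r))) := by
        rw [show n + 3 - 2 = n + 1 by omega, show n + 3 - 1 = n + 2 by omega, div_pow, mul_pow]
        field_simp
        ring
    _ ≤ √(1 - u ^ 2) ^ n * (s / (r * t)) := by
        gcongr
        linarith
    _ = kernel (n + 3) r t s := rfl

/-- The union of the dyadic intervals of order between `j₀` and `j₁`. -/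
def dyadicBlock (j₀ j₁ : ℤ) : Set ℝ := ⋃ j ∈ Finset.Icc j₀ j₁, dyadicIco j

lemma measurableSet_dyadicBlock (j₀ j₁ : ℤ) : MeasurableSet (dyadicBlock j₀ j₁) :=
  Finset.measurableSet_biUnion _ fun j _ => measurableSet_dyadicIco j

/-- The profile `s^{-(d-1)}`, cut off to a block of dyadic intervals. -/
def testProfile (d : ℕ) (j₀ j₁ : ℤ) (s : ℝ) : ℝ :=
  (dyadicBlock j₀ j₁).indicator (fun s => (s ^ (d - 1))⁻¹) s

lemma measurable_testProfile (d : ℕ) (j₀ j₁ : ℤ) : Measurable (testProfile d j₀ j₁) :=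
  Measurable.indicator (by fun_prop) (measurableSet_dyadicBlock j₀ j₁)

lemma testProfile_nonneg (d : ℕ) (j₀ j₁ : ℤ) (s : ℝ) : 0 ≤ testProfile d j₀ j₁ s := by
  refine indicator_nonneg (fun s hs => ?_) s
  obtain ⟨j, _, hj⟩ := mem_iUnion₂.1 hs
  have := mem_dyadicIco_pos hj
  positivity

lemma testProfile_le (d : ℕ) (j₀ j₁ : ℤ) (s : ℝ) :
    testProfile d j₀ j₁ s ≤ (((2 : ℝ) ^ j₀) ^ (d - 1))⁻¹ := by
  unfold testProfile
  by_cases hs : s ∈ dyadicBlock j₀ j₁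
  · rw [indicator_of_mem hs]
    obtain ⟨j, hj, hs⟩ := mem_iUnion₂.1 hs
    have h1 : (2 : ℝ) ^ j₀ ≤ s := (zpow_le_zpow_right₀ (by norm_num)
      (Finset.mem_Icc.1 hj).1).trans hs.1
    gcongr
  · rw [indicator_of_notMem hs]
    positivity

/-- Since `(d-1)p = d`, the integrand is `1/s`, which contributes at most 1 on each dyadic interval.
-/
lemma lintegral_testProfile_rpow_le {d : ℕ} (hd : 3 ≤ d) {p : ℝ} (hp : p = d / ((d : ℝ) - 1))
    (j₀ j₁ : ℤ) : ∫⁻ s, ENNReal.ofReal (testProfile d j₀ j₁ s) ^ p ∂(radialMeasure d) ≤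
      (Finset.Icc j₀ j₁).card := by
  have hp1 : 1 < p := hp ▸ one_lt_exponent hd
  have hp0 : 0 < p := by linarith
  have hd' : (3 : ℝ) ≤ d := by exact_mod_cast hd
  have e : ∀ s, ENNReal.ofReal (testProfile d j₀ j₁ s) ^ p = (dyadicBlock j₀ j₁).indicator
      (fun s => ENNReal.ofReal (s ^ (d - 1))⁻¹ ^ p) s := by
    intro s
    by_cases hs : s ∈ dyadicBlock j₀ j₁
    · rw [indicator_of_mem hs, testProfile, indicator_of_mem hs]
    · rw [indicator_of_notMem hs, testProfile, indicator_of_notMem hs, ENNReal.ofReal_zero,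
        ENNReal.zero_rpow_of_pos hp0]
  simp only [e]
  rw [lintegral_indicator (measurableSet_dyadicBlock j₀ j₁), dyadicBlock,
    lintegral_biUnion_finset (fun i _ j _ hij => pairwise_disjoint_dyadicIco hij)
      fun j _ => measurableSet_dyadicIco j]
  refine (Finset.sum_le_card_nsmul _ _ 1 fun j _ => ?_).trans (by simp)
  rw [setLIntegral_radialMeasure d _ (measurableSet_dyadicIco j) fun s hs => mem_dyadicIco_pos hs]
  calc _ ≤ ∫⁻ s in dyadicIco j, (ENNReal.ofReal (2 ^ j))⁻¹ := by
        refine setLIntegral_mono' (measurableSet_dyadicIco j) fun s hs => ?_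
        have hs0 := mem_dyadicIco_pos hs
        rw [ENNReal.ofReal_rpow_of_pos (by positivity), ← ENNReal.ofReal_mul (by positivity),
          ← ENNReal.ofReal_inv_of_pos (by positivity)]
        refine ENNReal.ofReal_le_ofReal ?_
        have : s ^ (d - 1) * ((s ^ (d - 1))⁻¹) ^ p = s⁻¹ := by
          rw [Real.inv_rpow (by positivity), ← Real.rpow_natCast, ← Real.rpow_mul hs0.le,
            ← div_eq_mul_inv, ← Real.rpow_sub hs0, ← Real.rpow_neg_one]
          congr 1
          rw [Nat.cast_sub (by omega), hp]
          have : (d : ℝ) - 1 ≠ 0 := by linarith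
          push_cast
          field_simp
          ring
        rw [this]
        have := hs.1
        gcongr
    _ = 1 := by
        rw [setLIntegral_const, volume_dyadicIco, ENNReal.inv_mul_cancel _ ENNReal.ofReal_ne_top]
        simp; positivity

lemma le_radialMean_testProfile {d : ℕ} (hd : 3 ≤ d) {j₀ j₁ k : ℤ} {n : ℕ} {r t : ℝ}
    (hr : r ∈ dyadicIco k) (ht : t ∈ Icc ((2 : ℝ) ^ k) (2 ^ (k + 1)))
    (hrt : |r - t| ≤ 2 ^ (k - n : ℤ)) (h0 : j₀ ≤ k - n + 1) (h1 : k ≤ j₁ + 1) :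
    ENNReal.ofReal (1 / (2 * 4 ^ (d - 2) * r ^ (d - 1))) * ((n - 1 : ℕ) : ℝ≥0∞) ≤
      radialMean d (fun s => ENNReal.ofReal (testProfile d j₀ j₁ s)) r t := by
  have hr0 := mem_dyadicIco_pos hr
  have ht0 : 0 < t := lt_of_lt_of_le (by positivity) ht.1
  have hrk := hr.1
  have ht2 := ht.2
  rw [zpow_add_one₀ (by norm_num)] at ht2
  have hj : ∀ j ∈ Finset.Ico (k - n + 1) k, ∀ s ∈ dyadicIco j,
      0 < s ∧ 2 * |r - t| ≤ s ∧ s < r := by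
    intro j hj s hs
    rw [Finset.mem_Ico] at hj
    have e1 : (2 : ℝ) ^ (k - n + 1 : ℤ) ≤ 2 ^ j := zpow_le_zpow_right₀ (by norm_num) hj.1
    have e2 : (2 : ℝ) ^ (j + 1) ≤ 2 ^ k := zpow_le_zpow_right₀ (by norm_num) (by omega)
    rw [zpow_add_one₀ (by norm_num)] at e1
    exact ⟨mem_dyadicIco_pos hs, by linarith [hs.1], by linarith [hs.2]⟩
  have hsub : (⋃ j ∈ Finset.Ico (k - n + 1) k, dyadicIco j) ⊆ Ioo |r - t| (r + t) := by
    intro s hs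
    obtain ⟨j, hjm, hsj⟩ := mem_iUnion₂.1 hs
    obtain ⟨h2, h3, h4⟩ := hj j hjm s hsj
    exact ⟨by linarith [abs_nonneg (r - t)], by linarith⟩
  calc _ = ∑ j ∈ Finset.Ico (k - n + 1) k,
          ENNReal.ofReal (1 / (2 * 4 ^ (d - 2) * r ^ (d - 1))) := by
        rw [Finset.sum_const, Int.card_Ico, nsmul_eq_mul, mul_comm]
        congr 2
        omega
    _ ≤ ∑ j ∈ Finset.Ico (k - n + 1) k, ∫⁻ s in dyadicIco j, ENNReal.ofReal (kernel d r t s) *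
          ENNReal.ofReal (testProfile d j₀ j₁ s) := by
        refine Finset.sum_le_sum fun j hjm => ?_
        have hjm' := Finset.mem_Ico.1 hjm
        calc _ = ∫⁻ s in dyadicIco j,
              ENNReal.ofReal (1 / (4 ^ (d - 2) * r ^ (d - 1) * 2 ^ (j + 1))) := by
              rw [setLIntegral_const, volume_dyadicIco, ← ENNReal.ofReal_mul (by positivity),
                zpow_add_one₀ (by norm_num)]
              congr 1
              field_simp
          _ ≤ _ := by
              refine setLIntegral_mono' (measurableSet_dyadicIco j) fun s hs => ?_
              obtain ⟨h2, h3, h4⟩ := hj j hjm s hs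
              have hblock : s ∈ dyadicBlock j₀ j₁ :=
                mem_biUnion (x := j) (by
                  simp only [Finset.mem_coe, Finset.mem_Icc]; omega) hs
              have hk := le_kernel hd hr0 ht0 (by linarith) h2 h3 h4.le
              rw [testProfile, indicator_of_mem hblock,
                ← ENNReal.ofReal_mul (kernel_nonneg hr0.le ht0.le h2.le)]
              refine ENNReal.ofReal_le_ofReal ?_
              calc _ ≤ 1 / (4 ^ (d - 2) * r ^ (d - 1) * s) := by
                    gcongr
                    exact hs.2.le
                _ = s ^ (d - 2) / (4 ^ (d - 2) * r ^ (d - 1)) * (s ^ (d - 1))⁻¹ := by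
                    rw [show d - 1 = d - 2 + 1 by omega, pow_succ s]
                    field_simp
                _ ≤ _ := by gcongr
    _ = ∫⁻ s in ⋃ j ∈ Finset.Ico (k - n + 1) k, dyadicIco j, ENNReal.ofReal (kernel d r t s) *
          ENNReal.ofReal (testProfile d j₀ j₁ s) :=
        (lintegral_biUnion_finset (fun i _ j _ hij => pairwise_disjoint_dyadicIco hij)
          (fun j _ => measurableSet_dyadicIco j) _).symm
    _ ≤ _ := lintegral_mono_set hsub

/-- The radial function with profile `testProfile`. -/
def testFunction (d : ℕ) (j₀ j₁ : ℤ) (x : Euc d) : ℂ := (testProfile d j₀ j₁ ‖x‖ : ℂ)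

lemma enorm_ofReal_testProfile (d : ℕ) (j₀ j₁ : ℤ) (s : ℝ) :
    ‖((testProfile d j₀ j₁ s : ℝ) : ℂ)‖ₑ = ENNReal.ofReal (testProfile d j₀ j₁ s) := by
  rw [← ofReal_norm, Complex.norm_of_nonneg (testProfile_nonneg d j₀ j₁ s)]

lemma measurable_testFunction (d : ℕ) (j₀ j₁ : ℤ) : Measurable (testFunction d j₀ j₁) :=
  Complex.measurable_ofReal.comp ((measurable_testProfile d j₀ j₁).comp measurable_norm)

lemma lintegral_testFunction_rpow_le {d : ℕ} (hd : 3 ≤ d) {p : ℝ} (hp : p = d / ((d : ℝ) - 1))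
    (j₀ j₁ : ℤ) : ∫⁻ x, ‖testFunction d j₀ j₁ x‖ₑ ^ p ≤ area d * (Finset.Icc j₀ j₁).card := by
  have : NeZero d := ⟨by omega⟩
  rw [lintegral_enorm_rpow_profile (f := testFunction d j₀ j₁) (f₀ := fun s => (testProfile d j₀ j₁ s : ℂ))
    (f₁ := fun s => (testProfile d j₀ j₁ s : ℂ)) (fun _ => rfl)
    (Complex.measurable_ofReal.comp (measurable_testProfile d j₀ j₁)) (by simp)]
  simp only [enorm_ofReal_testProfile]
  exact mul_le_mul_right (lintegral_testProfile_rpow_le hd hp j₀ j₁) _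

/-- Equality holds, and not only an upper bound, because the test function is nonnegative and there
is no cancellation. -/
lemma enorm_sphericalMean_testFunction {d : ℕ} (hd : 3 ≤ d) (j₀ j₁ : ℤ) {x : Euc d} (hx : x ≠ 0)
    {t : ℝ} (ht : 0 < t) : ‖sphericalMean (testFunction d j₀ j₁) t x‖ₑ =
      kernelConst d * radialMean d (fun s => ENNReal.ofReal (testProfile d j₀ j₁ s)) ‖x‖ t := by
  have h1 := lintegral_enorm_sphere hd (f := testFunction d j₀ j₁)
    (f₀ := fun s => (testProfile d j₀ j₁ s : ℂ)) (f₁ := fun s => (testProfile d j₀ j₁ s : ℂ))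
    (fun _ => rfl) (Complex.measurable_ofReal.comp (measurable_testProfile d j₀ j₁)) (by simp)
    hx ht
  simp only [enorm_ofReal_testProfile, testFunction] at h1
  rw [radialMean, ← h1]
  have hm : Measurable fun y : Metric.sphere (0 : Euc d) 1 =>
      testProfile d j₀ j₁ ‖x - t • (y : Euc d)‖ :=
    (measurable_testProfile d j₀ j₁).comp (by fun_prop)
  have hint : Integrable (fun y : Metric.sphere (0 : Euc d) 1 =>
      testProfile d j₀ j₁ ‖x - t • (y : Euc d)‖) (sphereMeasure d) := by
    refine Integrable.of_bound hm.aestronglyMeasurable (((2 : ℝ) ^ j₀) ^ (d - 1))⁻¹ ?_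
    refine Filter.Eventually.of_forall fun y => ?_
    rw [Real.norm_of_nonneg (testProfile_nonneg ..)]
    exact testProfile_le ..
  have h2 : sphericalMean (testFunction d j₀ j₁) t x =
      ((∫ y : Metric.sphere (0 : Euc d) 1, testProfile d j₀ j₁ ‖x - t • (y : Euc d)‖
        ∂(sphereMeasure d) : ℝ) : ℂ) := integral_ofReal
  rw [h2, ← ofReal_norm, Complex.norm_of_nonneg
    (integral_nonneg fun y => testProfile_nonneg ..),
    ofReal_integral_eq_lintegral_ofReal hint
      (Filter.Eventually.of_forall fun y => testProfile_nonneg ..)]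

/-- Only the largest element `m` matters: at most `m` summands, each at most `m^(p-1)`, add up to at
most `m^p`. As `m ≥ 2`, `m ≤ 2(m-1)`. -/
lemma sum_ofReal_rpow_le {p : ℝ} (hp : 1 < p) (S : Finset ℕ) (hS : ∀ n ∈ S, 2 ≤ n) {M : ℝ≥0∞}
    (hM : ∀ n ∈ S, ((n - 1 : ℕ) : ℝ≥0∞) ≤ M) :
    ∑ n ∈ S, ENNReal.ofReal ((n : ℝ) ^ (p - 1)) ≤ (2 * M) ^ p := by
  rcases S.eq_empty_or_nonempty with rfl | hne
  · simp
  set m := S.max' hne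
  have hm : m ∈ S := S.max'_mem hne
  have hm2 := hS m hm
  have hcard : S.card ≤ m := by
    have h1 : S ⊆ Finset.Icc 1 m := fun n hn =>
      Finset.mem_Icc.2 ⟨by have := hS n hn; omega, S.le_max' n hn⟩
    simpa using Finset.card_le_card h1
  have hm0 : (0 : ℝ) < m := by exact_mod_cast (by omega : 0 < m)
  calc _ ≤ ∑ n ∈ S, ENNReal.ofReal ((m : ℝ) ^ (p - 1)) := by
        refine Finset.sum_le_sum fun n hn => ENNReal.ofReal_le_ofReal ?_
        refine Real.rpow_le_rpow (by positivity) ?_ (by linarith)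
        exact_mod_cast S.le_max' n hn
    _ ≤ (m : ℝ≥0∞) * ENNReal.ofReal ((m : ℝ) ^ (p - 1)) := by
        rw [Finset.sum_const, nsmul_eq_mul]
        gcongr
    _ = (m : ℝ≥0∞) ^ p := by
        rw [← ENNReal.ofReal_natCast, ← ENNReal.ofReal_mul (by positivity),
          ENNReal.ofReal_rpow_of_pos hm0, ← Real.rpow_one_add' (by positivity) (by linarith),
          add_sub_cancel]
    _ ≤ (2 * M) ^ p := by
        refine ENNReal.rpow_le_rpow ?_ (by linarith)
        calc (m : ℝ≥0∞) ≤ ((2 * (m - 1) : ℕ) : ℝ≥0∞) := by exact_mod_cast (by omega)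
          _ = 2 * ((m - 1 : ℕ) : ℝ≥0∞) := by push_cast; rfl
          _ ≤ _ := mul_le_mul_right (hM m hm) _

/-- A minorant for the maximal function of the test functions, as a function of `|x|`. -/
def gridSum (d : ℕ) (E : Set ℝ) (k₁ : ℤ) (L : ℕ) (r : ℝ) : ℝ≥0∞ :=
  ∑ k ∈ Finset.Icc k₁ (k₁ + L), ∑ n ∈ Finset.Icc 2 L, (gridSet E k n).indicator
    (fun r => ENNReal.ofReal (r ^ d)⁻¹ * ENNReal.ofReal ((n : ℝ) ^ (1 / ((d : ℝ) - 1)))) r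

lemma measurable_gridSum (d : ℕ) (E : Set ℝ) (k₁ : ℤ) (L : ℕ) :
    Measurable (gridSum d E k₁ L) := by
  refine Finset.measurable_sum _ fun k _ => Finset.measurable_sum _ fun n _ =>
    Measurable.indicator (by fun_prop) (measurableSet_gridSet E k n)

/-- Against `r^(d-1) dr` the factor `r^(-d)` becomes `1/r`, which exceeds `2^(-k-1)` on the dyadic
interval; this is the source of the factor 2. -/
lemma natWeight_le_setLIntegral {d : ℕ} (hd : 3 ≤ d) (E : Set ℝ) (k : ℤ) (n : ℕ) :
    natWeight d E k n ≤ 2 * ∫⁻ r, (gridSet E k n).indicator (fun r => ENNReal.ofReal (r ^ d)⁻¹ *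
      ENNReal.ofReal ((n : ℝ) ^ (1 / ((d : ℝ) - 1)))) r ∂(radialMeasure d) := by
  rw [lintegral_indicator (measurableSet_gridSet E k n), setLIntegral_radialMeasure d _
    (measurableSet_gridSet E k n) fun r hr => mem_dyadicIco_pos (gridSet_subset E k n hr)]
  set c := ENNReal.ofReal ((n : ℝ) ^ (1 / ((d : ℝ) - 1)))
  calc _ ≤ c * (ENNReal.ofReal (2 ^ k)⁻¹ * volume (gridSet E k n)) :=
        natWeight_le_volume_gridSet d E k n
    _ = 2 * ∫⁻ r in gridSet E k n, ENNReal.ofReal (2 ^ (k + 1))⁻¹ * c := by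
        rw [setLIntegral_const, zpow_add_one₀ (by norm_num), mul_inv,
          ENNReal.ofReal_mul (by positivity), ENNReal.ofReal_inv_of_pos (x := 2) (by norm_num),
          ENNReal.ofReal_ofNat]
        calc _ = (2 * 2⁻¹) * (c * (ENNReal.ofReal (2 ^ k)⁻¹ * volume (gridSet E k n))) := by
              rw [ENNReal.mul_inv_cancel (by norm_num) (by norm_num), one_mul]
          _ = _ := by ring
    _ ≤ _ := by
        refine mul_le_mul_right (setLIntegral_mono' (measurableSet_gridSet E k n)
          fun r hr => ?_) _
        have hr1 := gridSet_subset E k n hr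
        have hr0 := mem_dyadicIco_pos hr1
        rw [← mul_assoc, ← ENNReal.ofReal_mul (p := r ^ (d - 1)) (by positivity)]
        refine mul_le_mul_left (ENNReal.ofReal_le_ofReal ?_) _
        calc _ ≤ r⁻¹ := by
              gcongr
              exact hr1.2.le
          _ = _ := by
              obtain ⟨m, rfl⟩ : ∃ m, d = m + 1 := ⟨d - 1, by omega⟩
              rw [Nat.add_sub_cancel, pow_succ]
              field_simp

lemma sum_natWeight_le_lintegral_gridSum {d : ℕ} (hd : 3 ≤ d) (E : Set ℝ) (k₁ : ℤ) (L : ℕ) :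
    ∑ k ∈ Finset.Icc k₁ (k₁ + L), ∑ n ∈ Finset.Icc 2 L, natWeight d E k n ≤
      2 * ∫⁻ r, gridSum d E k₁ L r ∂(radialMeasure d) := by
  unfold gridSum
  have hm : ∀ (k : ℤ) (n : ℕ), Measurable ((gridSet E k n).indicator (fun r : ℝ =>
      ENNReal.ofReal (r ^ d)⁻¹ * ENNReal.ofReal ((n : ℝ) ^ (1 / ((d : ℝ) - 1))))) := fun k n =>
    Measurable.indicator (by fun_prop) (measurableSet_gridSet E k n)
  rw [lintegral_finsetSum _ fun k _ => Finset.measurable_sum _ fun n _ => hm k n, Finset.mul_sum]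
  refine Finset.sum_le_sum fun k _ => ?_
  rw [lintegral_finsetSum _ fun n _ => hm k n, Finset.mul_sum]
  exact Finset.sum_le_sum fun n _ => natWeight_le_setLIntegral hd E k n

/-- The constant in the lower bound for the maximal function of the test functions. -/
def lowerConst (d : ℕ) : ℝ≥0∞ := kernelConst d * ENNReal.ofReal (1 / (2 * 4 ^ (d - 2)))

lemma lowerConst_ne_top {d : ℕ} (hd : 3 ≤ d) : lowerConst d ≠ ∞ :=
  ENNReal.mul_ne_top (kernelConst_ne_top hd) ENNReal.ofReal_ne_top

lemma lowerConst_ne_zero {d : ℕ} (hd : 3 ≤ d) : lowerConst d ≠ 0 :=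
  mul_ne_zero (kernelConst_ne_zero hd) (by simp)

/-- At a given point only one `k` contributes, and each `n` in the inner sum forces the maximal
function to be at least `a (n - 1)`, where `a ^ p` is `lowerConst d ^ p * r^(-d)`. The sum of
`n^(p-1)` over these `n` is then bounded by `sum_ofReal_rpow_le`. -/
lemma gridSum_le {d : ℕ} (hd : 3 ≤ d) {p : ℝ} (hp : p = d / ((d : ℝ) - 1)) {E : Set ℝ}
    (k₁ : ℤ) (L : ℕ) {x : Euc d} (hx : x ≠ 0) :
    lowerConst d ^ p * gridSum d E k₁ L ‖x‖ ≤
      (2 * maximalFunction E (testFunction d (k₁ - L) (k₁ + L)) x) ^ p := by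
  classical
  have hp1 : 1 < p := hp ▸ one_lt_exponent hd
  have hp0 : 0 < p := by linarith
  have hr0 : 0 < ‖x‖ := norm_pos_iff.2 hx
  set r := ‖x‖
  set M := maximalFunction E (testFunction d (k₁ - L) (k₁ + L)) x
  by_cases hk : ∃ k ∈ Finset.Icc k₁ (k₁ + L), r ∈ dyadicIco k
  swap
  · have h0 : gridSum d E k₁ L r = 0 := by
      refine Finset.sum_eq_zero fun k hk' => Finset.sum_eq_zero fun n _ => ?_
      exact indicator_of_notMem (fun h => hk ⟨k, hk', gridSet_subset E k n h⟩) _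
    rw [h0, mul_zero]
    exact zero_le
  obtain ⟨k, hk, hrk⟩ := hk
  set S := (Finset.Icc 2 L).filter fun n => r ∈ gridSet E k n
  have h1 : gridSum d E k₁ L r = ENNReal.ofReal (r ^ d)⁻¹ *
      ∑ n ∈ S, ENNReal.ofReal ((n : ℝ) ^ (p - 1)) := by
    rw [gridSum, Finset.sum_eq_single k, Finset.mul_sum, Finset.sum_filter, hp, exponent_sub_one hd]
    · simp only [indicator_apply]
    · intro j _ hj
      refine Finset.sum_eq_zero fun n _ => indicator_of_notMem (fun h => ?_) _
      exact (pairwise_disjoint_dyadicIco hj).le_bot ⟨gridSet_subset E j n h, hrk⟩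
    · exact fun h => absurd hk h
  set a := lowerConst d * ENNReal.ofReal (r ^ (d - 1))⁻¹
  have ha0 : a ≠ 0 := mul_ne_zero (lowerConst_ne_zero hd) (by simp; positivity)
  have hatop : a ≠ ∞ := ENNReal.mul_ne_top (lowerConst_ne_top hd) ENNReal.ofReal_ne_top
  have h2 : ∀ n ∈ S, ((n - 1 : ℕ) : ℝ≥0∞) ≤ M / a := by
    intro n hn
    obtain ⟨hnL, hrn⟩ := Finset.mem_filter.1 hn
    rw [Finset.mem_Icc] at hnL hk
    obtain ⟨t, ht, hrt⟩ := exists_near_of_mem_gridSet hrn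
    have ht0 : 0 < t := lt_of_lt_of_le (by positivity) ht.1.1
    rw [ENNReal.le_div_iff_mul_le (Or.inl ha0) (Or.inl hatop)]
    have h3 : ‖sphericalMean (testFunction d (k₁ - L) (k₁ + L)) t x‖ₑ ≤ M :=
      le_iSup₂_of_le (f := fun t (_ : t ∈ E) =>
        ‖sphericalMean (testFunction d (k₁ - L) (k₁ + L)) t x‖ₑ) t ht.2 le_rfl
    refine le_trans ?_ h3
    rw [enorm_sphericalMean_testFunction hd _ _ hx ht0]
    have h4 := le_radialMean_testProfile hd hrk ht.1 hrt (j₀ := k₁ - L) (j₁ := k₁ + L)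
      (by omega) (by omega)
    calc _ = kernelConst d * (ENNReal.ofReal (1 / (2 * 4 ^ (d - 2) * r ^ (d - 1))) *
          ((n - 1 : ℕ) : ℝ≥0∞)) := by
          rw [one_div, mul_inv, ENNReal.ofReal_mul (by positivity)]
          simp only [a, lowerConst, one_div]
          ring
      _ ≤ _ := mul_le_mul_right h4 _
  have h5 := sum_ofReal_rpow_le hp1 S
    (fun n hn => (Finset.mem_Icc.1 (Finset.mem_filter.1 hn).1).1) h2
  have ha : a ^ p = lowerConst d ^ p * ENNReal.ofReal (r ^ d)⁻¹ := by
    rw [ENNReal.mul_rpow_of_nonneg _ _ hp0.le, ENNReal.ofReal_rpow_of_pos (by positivity)]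
    congr 2
    rw [Real.inv_rpow (by positivity), ← Real.rpow_natCast, ← Real.rpow_mul hr0.le,
      ← Real.rpow_natCast]
    congr 2
    have : (d : ℝ) - 1 ≠ 0 := by
      have : (3 : ℝ) ≤ d := by exact_mod_cast hd
      linarith
    rw [Nat.cast_sub (by omega), hp]
    push_cast
    field_simp
  rw [h1, ← mul_assoc, ← ha]
  calc _ ≤ a ^ p * (2 * (M / a)) ^ p := mul_le_mul_right h5 _
    _ = (2 * M) ^ p := by
        rw [← ENNReal.mul_rpow_of_nonneg _ _ hp0.le, mul_left_comm, ENNReal.mul_div_cancel ha0 hatop]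

/-- The maximal estimate bounds the sums of the weights over boxes. -/
lemma exists_sum_natWeight_le {d : ℕ} (hd : 3 ≤ d) {E : Set ℝ}
    (hB : BoundedOnRadial d E (ENNReal.ofReal ((d : ℝ) / ((d : ℝ) - 1)))) :
    ∃ K : ℝ≥0∞, K ≠ ∞ ∧ ∀ (k₁ : ℤ) (L : ℕ), 1 ≤ L →
      ∑ k ∈ Finset.Icc k₁ (k₁ + L), ∑ n ∈ Finset.Icc 1 L, natWeight d E k n ≤ K * L := by
  have : NeZero d := ⟨by omega⟩
  obtain ⟨C, hC⟩ := hB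
  set p : ℝ := (d : ℝ) / ((d : ℝ) - 1) with hp
  have hp1 : 1 < p := one_lt_exponent hd
  have hp0 : 0 < p := by linarith
  have hq0 : ENNReal.ofReal p ≠ 0 := by simp [hp0]
  have hqr : (ENNReal.ofReal p).toReal = p := ENNReal.toReal_ofReal hp0.le
  have hκ0 : lowerConst d ^ p ≠ 0 := by simp [lowerConst_ne_zero hd, lowerConst_ne_top hd]
  have hκtop : lowerConst d ^ p ≠ ∞ :=
    ENNReal.rpow_ne_top_of_nonneg hp0.le (lowerConst_ne_top hd)
  have hA0 := area_ne_zero d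
  have hAtop := area_ne_top d
  set B : ℝ≥0∞ := (2 * C) ^ p / lowerConst d ^ p
  have hBtop : B ≠ ∞ :=
    ENNReal.div_ne_top (ENNReal.rpow_ne_top_of_nonneg hp0.le (by finiteness)) hκ0
  refine ⟨2 * (B * 3) + 2, by finiteness, fun k₁ L hL => ?_⟩
  -- This block contains the shells `k - n + 1, …, k - 1` for all `k` from `k₁` to `k₁ + L` and all
  -- `n ≤ L`, and it has `2L + 1 ≤ 3L` shells.
  set f := testFunction d (k₁ - L) (k₁ + L)
  have hcard : ((Finset.Icc (k₁ - L) (k₁ + L)).card : ℝ≥0∞) ≤ 3 * L := by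
    rw [Int.card_Icc]
    exact_mod_cast (by omega)
  have hfp : ∫⁻ x, ‖f x‖ₑ ^ p ≤ area d * (3 * L) :=
    (lintegral_testFunction_rpow_le hd hp _ _).trans (mul_le_mul_right hcard _)
  have hfLp : MemLp f (ENNReal.ofReal p) volume := by
    refine ⟨(measurable_testFunction d _ _).aestronglyMeasurable, ?_⟩
    rw [eLpNorm_lt_top_iff_lintegral_rpow_enorm_lt_top hq0 ENNReal.ofReal_ne_top, hqr]
    exact hfp.trans_lt (by finiteness)
  obtain ⟨_, _, hM⟩ := hC f ⟨fun s => (testProfile d (k₁ - L) (k₁ + L) s : ℂ), fun _ => rfl⟩ hfLp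
  have hMp : ∫⁻ x, maximalFunction E f x ^ p ≤ (C : ℝ≥0∞) ^ p * ∫⁻ x, ‖f x‖ₑ ^ p := by
    rw [eLpNorm_eq_lintegral_rpow_enorm_toReal hq0 ENNReal.ofReal_ne_top,
      eLpNorm_eq_lintegral_rpow_enorm_toReal hq0 ENNReal.ofReal_ne_top, hqr] at hM
    simp only [enorm_eq_self] at hM
    have h1 := ENNReal.rpow_le_rpow hM hp0.le
    rwa [ENNReal.mul_rpow_of_nonneg _ _ hp0.le, ← ENNReal.rpow_mul, ← ENNReal.rpow_mul,
      one_div_mul_cancel hp0.ne', ENNReal.rpow_one, ENNReal.rpow_one] at h1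
  have hne : ∀ᵐ x : Euc d, x ≠ 0 := by
    have : Nontrivial (Euc d) := by
      have : Nonempty (Fin d) := ⟨0⟩
      infer_instance
    exact measure_eq_zero_iff_ae_notMem.1 (measure_singleton (0 : Euc d))
  have hsum : lowerConst d ^ p * (area d * ∫⁻ r, gridSum d E k₁ L r ∂(radialMeasure d)) ≤
      (2 * C) ^ p * (area d * (3 * L)) := by
    rw [← lintegral_norm_eq_radialMeasure (measurable_gridSum d E k₁ L),
      ← lintegral_const_mul' _ _ hκtop]
    calc _ ≤ ∫⁻ x, (2 * maximalFunction E f x) ^ p := by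
          refine lintegral_mono_ae ?_
          filter_upwards [hne] with x hx using gridSum_le hd hp k₁ L hx
      _ = 2 ^ p * ∫⁻ x, maximalFunction E f x ^ p := by
          simp only [ENNReal.mul_rpow_of_nonneg _ _ hp0.le]
          exact lintegral_const_mul' _ _ (ENNReal.rpow_ne_top_of_nonneg hp0.le (by norm_num))
      _ ≤ 2 ^ p * ((C : ℝ≥0∞) ^ p * (area d * (3 * L))) :=
          mul_le_mul_right (hMp.trans (mul_le_mul_right hfp _)) _
      _ = _ := by rw [ENNReal.mul_rpow_of_nonneg _ _ hp0.le, mul_assoc]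
  have hint : ∫⁻ r, gridSum d E k₁ L r ∂(radialMeasure d) ≤ B * (3 * L) := by
    rw [mul_left_comm _ (area d), mul_left_comm _ (area d),
      ENNReal.mul_le_mul_iff_right hA0 hAtop] at hsum
    have h1 : B * (3 * L) = (2 * C) ^ p * (3 * L) / lowerConst d ^ p := by
      simp only [B, div_eq_mul_inv]
      ring
    rwa [h1, ENNReal.le_div_iff_mul_le (Or.inl hκ0) (Or.inl hκtop), mul_comm]
  have hone : ∑ k ∈ Finset.Icc k₁ (k₁ + L), natWeight d E k 1 ≤ 2 * L := by
    refine (Finset.sum_le_card_nsmul _ _ 1 fun k _ => natWeight_one_le d E k).trans ?_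
    rw [Int.card_Icc, nsmul_eq_mul, mul_one]
    exact_mod_cast (by omega)
  have hsplit : ∀ k, ∑ n ∈ Finset.Icc 1 L, natWeight d E k n =
      natWeight d E k 1 + ∑ n ∈ Finset.Icc 2 L, natWeight d E k n := by
    intro k
    rw [← Finset.insert_Icc_add_one_left_eq_Icc hL, Finset.sum_insert (by simp)]
    rfl
  simp only [hsplit]
  rw [Finset.sum_add_distrib]
  calc _ ≤ 2 * (L : ℝ≥0∞) + 2 * (B * (3 * L)) :=
        add_le_add hone ((sum_natWeight_le_lintegral_gridSum hd E k₁ L).trans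
          (mul_le_mul_right hint _))
    _ = _ := by ring

/-- The maximal estimate implies the Carleson condition. -/
theorem carlesonSup_lt_top_of_boundedOnRadial {d : ℕ} (hd : 3 ≤ d) {E : Set ℝ}
    (hB : BoundedOnRadial d E (ENNReal.ofReal ((d : ℝ) / ((d : ℝ) - 1)))) :
    carlesonSup d E < ⊤ := by
  obtain ⟨K, hK, h⟩ := exists_sum_natWeight_le hd hB
  refine lt_of_le_of_lt ?_ hK.lt_top
  refine iSup_le fun a => iSup_le fun b => iSup_le fun hab => ?_
  -- The integer points of the tent with `n ≥ 1` satisfy `n ≤ L` and `⌈a⌉ ≤ k ≤ ⌈a⌉ + L`; since `b -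
  -- a ≥ 1`, `L` is at least 1.
  set L : ℕ := ⌊b - a⌋₊
  have hL : 1 ≤ L := Nat.one_le_floor_iff _ |>.2 hab
  have hLab : (L : ℝ) ≤ b - a := Nat.floor_le (by linarith)
  have hLab' : b - a < L + 1 := Nat.lt_floor_add_one _
  rw [ENNReal.div_le_iff (by simp; linarith) ENNReal.ofReal_ne_top]
  set P : Set (ℤ × ℕ+) := {q | ((q.1 : ℝ), ((q.2 : ℕ) : ℝ)) ∈ tent a b}
  have h3 : ∑' q : {q : ℤ × ℕ+ // ((q.1 : ℝ), ((q.2 : ℕ) : ℝ)) ∈ tent a b},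
      weight d E q.1.1 q.1.2 = ∑' q, P.indicator (fun q => weight d E q.1 q.2) q :=
    tsum_subtype P (fun q => weight d E q.1 q.2)
  set e : ℤ × ℕ ↪ ℤ × ℕ+ := ⟨fun q => (q.1, q.2.succPNat), fun q q' h => by
    simp only [Prod.mk.injEq] at h
    exact Prod.ext h.1 (Nat.succPNat_injective h.2)⟩
  set T := (Finset.Icc ⌈a⌉ (⌈a⌉ + L) ×ˢ Finset.range L).map e
  have hT : ∀ q ∉ T, P.indicator (fun q => weight d E q.1 q.2) q = 0 := by
    refine fun q hq => indicator_of_notMem (fun hqP => hq ?_) _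
    obtain ⟨⟨h4, h5⟩, _, h6⟩ := hqP
    simp only at h4 h5 h6
    have h7 : ⌈a⌉ ≤ q.1 := Int.ceil_le.2 h4
    have h8 : (q.1 : ℝ) < ((⌈a⌉ + L + 1 : ℤ) : ℝ) := by
      push_cast
      linarith [Int.le_ceil a]
    have h8' : q.1 < ⌈a⌉ + L + 1 := by exact_mod_cast h8
    have h9 : (q.2 : ℕ) ≤ L := Nat.le_floor h6
    refine Finset.mem_map.2 ⟨(q.1, PNat.natPred q.2), ?_, ?_⟩
    · have := q.2.natPred_add_one
      simp only [Finset.mem_product, Finset.mem_Icc, Finset.mem_range]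
      omega
    · exact Prod.ext rfl (PNat.succPNat_natPred q.2)
  rw [h3, tsum_eq_sum hT]
  calc _ ≤ ∑ q ∈ T, weight d E q.1 q.2 :=
        Finset.sum_le_sum fun q _ => indicator_le_self' (fun _ _ => zero_le) q
    _ = ∑ k ∈ Finset.Icc ⌈a⌉ (⌈a⌉ + L), ∑ n ∈ Finset.range L, natWeight d E k (n + 1) := by
        rw [Finset.sum_map, Finset.sum_product]
        rfl
    _ = ∑ k ∈ Finset.Icc ⌈a⌉ (⌈a⌉ + L), ∑ n ∈ Finset.Icc 1 L, natWeight d E k n := by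
        refine Finset.sum_congr rfl fun k _ => ?_
        rw [Finset.range_eq_Ico, Finset.sum_Ico_add' (fun n => natWeight d E k n) 0 L 1]
        rfl
    _ ≤ K * L := h _ L hL
    _ ≤ _ := by
        refine mul_le_mul_right ?_ _
        rw [← ENNReal.ofReal_natCast]
        exact ENNReal.ofReal_le_ofReal hLab

/-! ### Tents and the two forms of the Carleson condition -/

lemma measurableSet_tent (a b : ℝ) : MeasurableSet (tent a b) := by
  refine MeasurableSet.inter (measurable_fst measurableSet_Icc) (MeasurableSet.inter ?_ ?_)
  · exact measurableSet_le measurable_const measurable_snd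
  · exact measurableSet_le measurable_snd measurable_const

lemma entropyMeasure_tent (d : ℕ) (E : Set ℝ) (a b : ℝ) : entropyMeasure d E (tent a b) =
    ∑' q : {q : ℤ × ℕ+ // ((q.1 : ℝ), ((q.2 : ℕ) : ℝ)) ∈ tent a b}, weight d E q.1.1 q.1.2 := by
  set P : Set (ℤ × ℕ+) := {q | ((q.1 : ℝ), ((q.2 : ℕ) : ℝ)) ∈ tent a b}
  refine Eq.trans ?_ (tsum_subtype P (fun q => weight d E q.1 q.2)).symm
  rw [entropyMeasure, Measure.sum_apply _ (measurableSet_tent a b)]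
  refine tsum_congr fun q => ?_
  rw [Measure.smul_apply, Measure.dirac_apply' _ (measurableSet_tent a b), smul_eq_mul]
  by_cases hq : q ∈ P
  · rw [indicator_of_mem hq, indicator_of_mem (s := tent a b) hq, Pi.one_apply, mul_one]
  · rw [indicator_of_notMem hq, indicator_of_notMem (s := tent a b) hq, mul_zero]

/-- Only intervals of length at least one matter in the Carleson condition. -/
theorem isCarleson_entropyMeasure_iff (d : ℕ) (E : Set ℝ) :
    IsCarleson (entropyMeasure d E) ↔ carlesonSup d E < ⊤ := by
  constructor
  · rintro ⟨C, hC⟩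
    refine lt_of_le_of_lt ?_ (ENNReal.coe_lt_top (r := C))
    refine iSup_le fun a => iSup_le fun b => iSup_le fun hab => ?_
    rw [← entropyMeasure_tent]
    exact ENNReal.div_le_of_le_mul (hC a b (by linarith))
  · intro h
    refine ⟨(carlesonSup d E).toNNReal, fun a b hab => ?_⟩
    rw [ENNReal.coe_toNNReal h.ne, entropyMeasure_tent]
    rcases le_or_gt 1 (b - a) with h1 | h1
    · rw [← ENNReal.div_le_iff (by simpa using hab) ENNReal.ofReal_ne_top]
      unfold carlesonSup
      exact le_iSup_of_le a (le_iSup₂_of_le (f := fun (b : ℝ) (_ : 1 ≤ b - a) =>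
        (∑' q : {q : ℤ × ℕ+ // ((q.1 : ℝ), ((q.2 : ℕ) : ℝ)) ∈ tent a b},
          weight d E q.1.1 q.1.2) / ENNReal.ofReal (b - a)) b h1 le_rfl)
    -- A tent of height below 1 misses every point with `n ≥ 1`.
    · have : IsEmpty {q : ℤ × ℕ+ // ((q.1 : ℝ), ((q.2 : ℕ) : ℝ)) ∈ tent a b} := by
        refine ⟨fun q => ?_⟩
        have h2 : (((q.1.2 : ℕ) : ℝ)) ≤ b - a := q.2.2.2
        have h3 : (1 : ℝ) ≤ ((q.1.2 : ℕ) : ℝ) := by exact_mod_cast q.1.2.pos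
        linarith
      rw [tsum_empty]
      exact zero_le

end SphericalMaximal

end

theorem theorem1p4 (d : ℕ) (hd : 3 ≤ d) (E : Set ℝ) (hE : E ⊆ Set.Ioi 0) :
    (SphericalMaximal.BoundedOnRadial d E (ENNReal.ofReal ((d : ℝ) / ((d : ℝ) - 1))) ↔
      SphericalMaximal.IsCarleson (SphericalMaximal.entropyMeasure d E)) ∧
    (SphericalMaximal.IsCarleson (SphericalMaximal.entropyMeasure d E) ↔
      SphericalMaximal.carlesonSup d E < ⊤) := by
  have h := SphericalMaximal.isCarleson_entropyMeasure_iff d E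
  refine ⟨?_, h⟩
  exact ⟨fun hB => h.2 (SphericalMaximal.carlesonSup_lt_top_of_boundedOnRadial hd hB),
    fun hC => SphericalMaximal.boundedOnRadial_of_carlesonSup hd hE (h.1 hC)⟩
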